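/- Let $M^n$ be a compact smooth manifold (without boundary), let $m\in\mathbb{R}\cup\{\pm\infty\}$ and $\mu\in\mathbb{R}$. A smooth metric measure space (SMMS) on $M$ with dimensional parameter $m$ is a pair $(g,e^{-\phi}\,\mathrm{dvol}_g)$ with $g$ a smooth Riemannian metric and $\phi\in C^\infty(M)$, where $\phi=0$ if $m=0$; we write $v^m=e^{-\phi}$, so that $v^{-2}=e^{2\phi/m}$ for finite $m\neq0$ (and $v=1$ for $m=0$). Put $$\mathrm{Ric}_\phi^m=\mathrm{Ric}+\nabla^2\phi-\tfrac1m d\phi\otimes d\phi,\qquad R_\phi^m=R+2\Delta\phi-\tfrac{m+1}{m}|\nabla\phi|^2,\qquad \Delta_\phi\phi=\Delta\phi-|\nabla\phi|^2,$$ with $\frac1m=0$ and $\frac{m+1}{m}=1$ if $|m|=\infty$, and with the terms containing $\frac1m$ omitted (they multiply quantities that vanish) if $m=0$. The $(m,\mu)$-energy functional is $$\mathcal{W}_\mu^m=\int_M\left(R_\phi^m+m\mu v^{-2}\right)v^m\,\mathrm{dvol}_g\quad(|m|<\infty),\qquad \mathcal{W}_\mu^m=\int_M\left(R_\phi^m+2\mu(\phi-n)\right)e^{-\phi}\,\mathrm{dvol}_g\quad(|m|=\infty).$$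 Let $\mathcal{C}_1(M,m)$ be the set of those $(g,e^{-\phi}\,\mathrm{dvol}_g)$ with $\int_M e^{-\phi}\,\mathrm{dvol}_g=1$, and let $(g,e^{-\phi}\,\mathrm{dvol}_g)\in\mathcal{C}_1(M,m)$. (1) Let $(h,\psi)=(\delta g,\delta\phi)$ be a variation of $(g,e^{-\phi}\,\mathrm{dvol}_g)$ that remains in $\mathcal{C}_1(M,m)$, that is, the velocity at $s=0$ of a smooth curve $(g_s,e^{-\phi_s}\mathrm{dvol}_{g_s})$ in $\mathcal{C}_1(M,m)$ through $(g,e^{-\phi}\,\mathrm{dvol}_g)$. Then $$0=\int_M\left(\psi-\tfrac12\mathrm{tr}_g h\right)e^{-\phi}\,\mathrm{dvol}_g,$$ and the derivative $\delta\mathcal{W}_\mu^m$ of $\mathcal{W}_\mu^m$ at $s=0$ along any smooth curve of SMMS with parameter $m$ through $(g,e^{-\phi}\,\mathrm{dvol}_g)$ with velocity $(h,\psi)$ exists and equals, if $|m|<\infty$, $$\delta\mathcal{W}_\mu^m=-\int_M\Big[\big\langle\mathrm{Ric}_\phi^m-\tfrac1m\Delta_\phi\phi\,g-\mu v^{-2}g,\,h\big\rangle+\big(R_\phi^m-\tfrac2m\Delta_\phi\phi+(m-2)\mu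 v^{-2}\big)\big(\psi-\tfrac12\mathrm{tr}_g h\big)\Big]e^{-\phi}\,\mathrm{dvol}_g,$$ and, if $|m|=\infty$, $$\delta\mathcal{W}_\mu^m=-\int_M\Big[\big\langle\mathrm{Ric}_\phi^m-\mu g,\,h\big\rangle+\big(R_\phi^m+2\mu(\phi-n-1)\big)\big(\psi-\tfrac12\mathrm{tr}_g h\big)\Big]e^{-\phi}\,\mathrm{dvol}_g.$$ (2) Suppose $m+n\neq2$. If $(g,v^m\,\mathrm{dvol}_g)$ is a critical point of $\mathcal{W}_\mu^m$ on $\mathcal{C}_1(M,m)$ (the derivative of $\mathcal{W}_\mu^m$ at $s=0$ vanishes along every smooth curve in $\mathcal{C}_1(M,m)$ through it), then it is quasi-Einstein with characteristic constant $\mu$: there is a constant $\lambda\in\mathbb{R}$ with $\mathrm{Ric}_\phi^m=\lambda g$ and, if $|m|<\infty$, $R_\phi^m+m\mu v^{-2}=(m+n)\lambda$, while, if $|m|=\infty$, $\mu=\lambda$ and $R_\phi^m+2\lambda(\phi-n)$ is constant. -/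

import Mathlib

open Set MeasureTheory
open scoped Manifold ContDiff Topology

noncomputable section

namespace WeightedMeasure

/-! ### Riemannian geometry in coordinates

`G y` is the matrix `(g_ij)` of a metric at the point with coordinates `y`. -/

section Coordinates

variable {n : ℕ}

/-- The partial derivative `∂_i f`. -/
def pd (i : Fin n) (f : EuclideanSpace ℝ (Fin n) → ℝ) (y : EuclideanSpace ℝ (Fin n)) : ℝ :=
  fderiv ℝ f y (EuclideanSpace.single i 1)

/-- The Christoffel symbol
`Γ^k_ij = (1/2) ∑_l g^{kl} (∂_i g_jl + ∂_j g_il - ∂_l g_ij)`. -/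
def christoffel (G : EuclideanSpace ℝ (Fin n) → Matrix (Fin n) (Fin n) ℝ) (k i j : Fin n)
    (y : EuclideanSpace ℝ (Fin n)) : ℝ :=
  (1 / 2) * ∑ l, (G y)⁻¹ k l *
    (pd i (fun z => G z j l) y + pd j (fun z => G z i l) y - pd l (fun z => G z i j) y)

/-- The Ricci tensor
`R_ij = ∂_k Γ^k_ij - ∂_j Γ^k_ik + Γ^k_kl Γ^l_ij - Γ^k_jl Γ^l_ik` (summed over `k` and `l`). -/
def ricciCoord (G : EuclideanSpace ℝ (Fin n) → Matrix (Fin n) (Fin n) ℝ)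
    (y : EuclideanSpace ℝ (Fin n)) : Matrix (Fin n) (Fin n) ℝ :=
  Matrix.of fun i j =>
    (∑ k, pd k (christoffel G k i j) y) - (∑ k, pd j (christoffel G k i k) y)
      + (∑ k, ∑ l, christoffel G k k l y * christoffel G l i j y)
      - (∑ k, ∑ l, christoffel G k j l y * christoffel G l i k y)

/-- The Hessian `(∇²f)_ij = ∂_i ∂_j f - Γ^k_ij ∂_k f` (summed over `k`). -/
def hessianCoord (G : EuclideanSpace ℝ (Fin n) → Matrix (Fin n) (Fin n) ℝ)
    (f : EuclideanSpace ℝ (Fin n) → ℝ) (y : EuclideanSpace ℝ (Fin n)) :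
    Matrix (Fin n) (Fin n) ℝ :=
  Matrix.of fun i j => pd i (pd j f) y - ∑ k, christoffel G k i j y * pd k f y

/-- The trace `g^{ij} T_ij`, for the matrices `A = (g_ij)` and `T` at a point. -/
def traceCoord (A T : Matrix (Fin n) (Fin n) ℝ) : ℝ :=
  ∑ i, ∑ j, A⁻¹ i j * T i j

/-- The inner product `g^{ia} g^{jb} T_ij U_ab` of two `(0,2)`-tensors, for the matrices
`A = (g_ij)`, `T` and `U` at a point. -/
def innerCoord (A T U : Matrix (Fin n) (Fin n) ℝ) : ℝ :=
  ∑ i, ∑ j, ∑ a, ∑ b, A⁻¹ i a * A⁻¹ j b * T i j * U a b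

end Coordinates

/-! ### Riemannian geometry on a manifold -/

section Manifold

variable {n : ℕ} {M : Type*} [TopologicalSpace M] [ChartedSpace (EuclideanSpace ℝ (Fin n)) M]

/-- The `i`-th coordinate vector field of the chart centred at `x₀`, at the point with
coordinates `y`. -/
def coordVec (x₀ : M) (y : EuclideanSpace ℝ (Fin n)) (i : Fin n) :
    TangentSpace (𝓡 n) ((extChartAt (𝓡 n) x₀).symm y) :=
  mfderiv 𝓘(ℝ, EuclideanSpace ℝ (Fin n)) (𝓡 n) (extChartAt (𝓡 n) x₀).symm y
    (EuclideanSpace.single i (1 : ℝ) : EuclideanSpace ℝ (Fin n))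

/-- The matrix of a `(0,2)`-tensor field in the chart centred at `x₀`, at the point with
coordinates `y`. -/
def tensorCoord (T : ∀ x : M, TangentSpace (𝓡 n) x →L[ℝ] TangentSpace (𝓡 n) x →L[ℝ] ℝ)
    (x₀ : M) (y : EuclideanSpace ℝ (Fin n)) : Matrix (Fin n) (Fin n) ℝ :=
  Matrix.of fun i j => T ((extChartAt (𝓡 n) x₀).symm y) (coordVec x₀ y i) (coordVec x₀ y j)

/-- The coordinate expression of a function in the chart centred at `x₀`. -/
def funCoord (f : M → ℝ) (x₀ : M) (y : EuclideanSpace ℝ (Fin n)) : ℝ :=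
  f ((extChartAt (𝓡 n) x₀).symm y)

/-- The matrix at `p` of a `(0,2)`-tensor field in the chart centred at `p`. All matrices of
tensors at a point below refer to this chart. -/
def tensorAt (T : ∀ x : M, TangentSpace (𝓡 n) x →L[ℝ] TangentSpace (𝓡 n) x →L[ℝ] ℝ)
    (p : M) : Matrix (Fin n) (Fin n) ℝ :=
  tensorCoord T p (extChartAt (𝓡 n) p p)

variable [IsManifold (𝓡 n) ∞ M]

variable (n M) in
/-- Smooth Riemannian metrics on the manifold `M`. -/
abbrev SmoothMetric :=
  Bundle.ContMDiffRiemannianMetric (𝓡 n) ∞ (EuclideanSpace ℝ (Fin n))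
    (fun x : M => TangentSpace (𝓡 n) x)

/-- The matrix `(g_ij)` in the chart centred at `x₀`. -/
def metricCoord (g : SmoothMetric n M) (x₀ : M) (y : EuclideanSpace ℝ (Fin n)) :
    Matrix (Fin n) (Fin n) ℝ :=
  tensorCoord g.inner x₀ y

/-- The matrix `(g_ij)` at `p`. -/
def metricAt (g : SmoothMetric n M) (p : M) : Matrix (Fin n) (Fin n) ℝ := tensorAt g.inner p

/-- The Ricci tensor at `p`. -/
def ricciAt (g : SmoothMetric n M) (p : M) : Matrix (Fin n) (Fin n) ℝ :=
  ricciCoord (metricCoord g p) (extChartAt (𝓡 n) p p)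

/-- The Hessian of a function at `p`. -/
def hessianAt (g : SmoothMetric n M) (f : M → ℝ) (p : M) : Matrix (Fin n) (Fin n) ℝ :=
  hessianCoord (metricCoord g p) (funCoord f p) (extChartAt (𝓡 n) p p)

/-- The tensor `df ⊗ df` at `p`. -/
def diffSqAt (f : M → ℝ) (p : M) : Matrix (Fin n) (Fin n) ℝ :=
  Matrix.of fun i j => pd i (funCoord f p) (extChartAt (𝓡 n) p p) *
    pd j (funCoord f p) (extChartAt (𝓡 n) p p)

/-- The trace `tr_g T` of a `(0,2)`-tensor with matrix `T` at `p`. -/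
def traceAt (g : SmoothMetric n M) (p : M) (T : Matrix (Fin n) (Fin n) ℝ) : ℝ :=
  traceCoord (metricAt g p) T

/-- The inner product `⟨T, U⟩_g` of `(0,2)`-tensors with matrices `T` and `U` at `p`. -/
def innerAt (g : SmoothMetric n M) (p : M) (T U : Matrix (Fin n) (Fin n) ℝ) : ℝ :=
  innerCoord (metricAt g p) T U

/-- The scalar curvature `R`. -/
def scalarCurv (g : SmoothMetric n M) (p : M) : ℝ := traceAt g p (ricciAt g p)

/-- The Laplacian `Δf = tr ∇²f`. -/
def laplacian (g : SmoothMetric n M) (f : M → ℝ) (p : M) : ℝ := traceAt g p (hessianAt g f p)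

/-- The squared length `|∇f|²`. -/
def gradSq (g : SmoothMetric n M) (f : M → ℝ) (p : M) : ℝ := traceAt g p (diffSqAt f p)

variable (n M) in
/-- A smooth partition of unity subordinate to the charts of the manifold. -/
def chartPartition [CompactSpace M] [T2Space M] : SmoothPartitionOfUnity M (𝓡 n) M univ :=
  Classical.choose (SmoothPartitionOfUnity.exists_isSubordinate_chartAt_source (𝓡 n) M)

variable (n M) in
theorem chartPartition_isSubordinate [CompactSpace M] [T2Space M] :
    (chartPartition n M).IsSubordinate
      (fun x => (chartAt (EuclideanSpace ℝ (Fin n)) x).source) :=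
  Classical.choose_spec (SmoothPartitionOfUnity.exists_isSubordinate_chartAt_source (𝓡 n) M)

/-- The Riemannian volume measure `dvol_g`, obtained by gluing the measures
`√(det g_ij) dy¹ ⋯ dyⁿ` of the charts with a partition of unity (all but finitely many members
of which vanish, as `M` is compact). -/
def dvol [CompactSpace M] [T2Space M] [MeasurableSpace M] (g : SmoothMetric n M) : Measure M :=
  Measure.sum fun x₀ : M =>
    (((volume : Measure (EuclideanSpace ℝ (Fin n))).restrict
      (extChartAt (𝓡 n) x₀).target).withDensity fun y =>
        ENNReal.ofReal (chartPartition n M x₀ ((extChartAt (𝓡 n) x₀).symm y) *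
          Real.sqrt (metricCoord g x₀ y).det)).map (extChartAt (𝓡 n) x₀).symm

end Manifold

/-! ### Smooth metric measure spaces -/

/-- `1 / m`, with `1 / ±∞ = 0`. (The value for `m = 0` is `0`; it is only ever multiplied by
terms that vanish for `m = 0`.) -/
def invDim (m : EReal) : ℝ := (m⁻¹).toReal

variable (n : ℕ) (M : Type*) [TopologicalSpace M] [ChartedSpace (EuclideanSpace ℝ (Fin n)) M]
  [IsManifold (𝓡 n) ∞ M] (m : EReal)

/-- A smooth metric measure space `(M, g, e^{-φ} dvol_g, m)` on the manifold `M`, with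
`e^{-φ} = v^m`. For `m = 0` the measure is always `v⁰ dvol_g = dvol_g`, that is, `φ = 0`. -/
structure SMMS where
  metric : SmoothMetric n M
  phi : M → ℝ
  phi_smooth : ContMDiff (𝓡 n) 𝓘(ℝ, ℝ) ∞ phi
  phi_eq_zero : m = 0 → phi = 0

variable {n M m}

namespace SMMS

/-- `v^{-2} = e^{2φ/m}`. -/
def vInvSq (S : SMMS n M m) (p : M) : ℝ := Real.exp (2 * invDim m * S.phi p)

/-- The Bakry-Émery Ricci tensor `Ric_φ^m = Ric + ∇²φ - (1/m) dφ ⊗ dφ` at `p`. -/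
def bakryEmeryRicci (S : SMMS n M m) (p : M) : Matrix (Fin n) (Fin n) ℝ :=
  ricciAt S.metric p + hessianAt S.metric S.phi p - invDim m • diffSqAt S.phi p

/-- The weighted scalar curvature `R_φ^m = R + 2Δφ - ((m+1)/m) |∇φ|²`. -/
def weightedScalar (S : SMMS n M m) (p : M) : ℝ :=
  scalarCurv S.metric p + 2 * laplacian S.metric S.phi p
    - (1 + invDim m) * gradSq S.metric S.phi p

/-- `Δ_φ φ = Δφ - ⟨∇φ, ∇φ⟩`. -/
def weightedLaplacianPhi (S : SMMS n M m) (p : M) : ℝ :=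
  laplacian S.metric S.phi p - gradSq S.metric S.phi p

/-- The integral of a function against the weighted measure `v^m dvol_g = e^{-φ} dvol_g`. -/
def integral [CompactSpace M] [T2Space M] [MeasurableSpace M] (S : SMMS n M m) (f : M → ℝ) : ℝ :=
  ∫ p, f p * Real.exp (-S.phi p) ∂(dvol S.metric)

/-- The `(m, μ)`-energy functional. -/
def energy [CompactSpace M] [T2Space M] [MeasurableSpace M] (μ : ℝ) (S : SMMS n M m) : ℝ :=
  if m = ⊤ ∨ m = ⊥ then
    S.integral fun p => S.weightedScalar p + 2 * μ * (S.phi p - n)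
  else
    S.integral fun p => S.weightedScalar p + m.toReal * μ * S.vInvSq p

/-- `S` is quasi-Einstein with quasi-Einstein constant `lam`: `Ric_φ^m = lam g`. -/
def IsQuasiEinstein (S : SMMS n M m) (lam : ℝ) : Prop :=
  ∀ p, S.bakryEmeryRicci p = lam • metricAt S.metric p

/-- The quasi-Einstein space `S` with quasi-Einstein constant `lam` has characteristic constant
`μ`: `R_φ^m + m μ v^{-2} = (m + n) lam` when `m` is finite, while for infinite `m` the
characteristic constant is `lam`, and `R_φ^m + 2 lam (φ - n)` is a constant `-μ'`. -/
def HasCharacteristicConstant (S : SMMS n M m) (lam μ : ℝ) : Prop :=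
  if m = ⊤ ∨ m = ⊥ then
    μ = lam ∧ ∃ μ' : ℝ, ∀ p, S.weightedScalar p + 2 * lam * (S.phi p - n) = -μ'
  else
    ∀ p, S.weightedScalar p + m.toReal * μ * S.vInvSq p = (m.toReal + n) * lam

/-- A curve of metrics and measures that is smooth, jointly in the parameter `s` and the point
of `M`, for `s` near `0`. -/
def IsSmoothCurve (γ : ℝ → SMMS n M m) : Prop :=
  ∃ ε > 0,
    ContMDiffOn (𝓘(ℝ, ℝ).prod (𝓡 n))
      ((𝓡 n).prod 𝓘(ℝ, EuclideanSpace ℝ (Fin n) →L[ℝ] EuclideanSpace ℝ (Fin n) →L[ℝ] ℝ)) ∞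
      (fun q : ℝ × M =>
        (Bundle.TotalSpace.mk' (EuclideanSpace ℝ (Fin n) →L[ℝ] EuclideanSpace ℝ (Fin n) →L[ℝ] ℝ)
          q.2 ((γ q.1).metric.inner q.2) :
          Bundle.TotalSpace (EuclideanSpace ℝ (Fin n) →L[ℝ] EuclideanSpace ℝ (Fin n) →L[ℝ] ℝ)
            (fun x : M => TangentSpace (𝓡 n) x →L[ℝ] TangentSpace (𝓡 n) x →L[ℝ] ℝ)))
      (Ioo (-ε) ε ×ˢ univ) ∧
    ContMDiffOn (𝓘(ℝ, ℝ).prod (𝓡 n)) 𝓘(ℝ, ℝ) ∞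
      (fun q : ℝ × M => (γ q.1).phi q.2) (Ioo (-ε) ε ×ˢ univ)

/-- The curve `γ` has velocity `(δg, δφ) = (h, ψ)` at `s = 0`. -/
def HasVelocity (γ : ℝ → SMMS n M m)
    (h : ∀ x : M, TangentSpace (𝓡 n) x →L[ℝ] TangentSpace (𝓡 n) x →L[ℝ] ℝ) (ψ : M → ℝ) : Prop :=
  (∀ (x : M) (u w : TangentSpace (𝓡 n) x),
    HasDerivAt (fun s => (γ s).metric.inner x u w) (h x u w) 0) ∧
  ∀ x : M, HasDerivAt (fun s => (γ s).phi x) (ψ x) 0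

variable (n M m) in
/-- The space `C₁(M, m)` of metrics and measures of unit weighted volume. -/
def unitVolume [CompactSpace M] [T2Space M] [MeasurableSpace M] : Set (SMMS n M m) :=
  {S | S.integral (fun _ => 1) = 1}

/-- `γ` is a smooth curve in `C₁(M, m)` that passes through `S` at `s = 0`. -/
def IsUnitVolumeCurve [CompactSpace M] [T2Space M] [MeasurableSpace M]
    (γ : ℝ → SMMS n M m) (S : SMMS n M m) : Prop :=
  IsSmoothCurve γ ∧ γ 0 = S ∧ ∀ᶠ s in 𝓝 (0 : ℝ), γ s ∈ unitVolume n M m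

/-- `S` is a critical point of the energy functional on `C₁(M, m)`. -/
def IsCriticalPoint [CompactSpace M] [T2Space M] [MeasurableSpace M] (μ : ℝ)
    (S : SMMS n M m) : Prop :=
  ∀ γ : ℝ → SMMS n M m, IsUnitVolumeCurve γ S → HasDerivAt (fun s => (γ s).energy μ) 0 0

end SMMS

end WeightedMeasure

end

/-!
Write `κ = 1/m` and consider, for a function `P` of one variable, the functional
`∫ (R_φ + P(φ)) e^{-φ} dvol`. Both energies have this form: `P t = m μ e^{2 κ t}` for finite `m` and
`P t = 2 μ (t - n)` for infinite `m`.

*First variation.* In a chart, the derivative of the density `(R_φ + P(φ)) e^{-φ} √det g` along a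
smooth family `(g_s, φ_s)` with velocity `(h, ψ)` is the Euler-Lagrange integrand times
`e^{-φ} √det g`, plus the divergence of a vector density
(`IsMetricFamily.hasDerivAt_energyDensity`). The scalar curvature enters through the Palatini
identity: the contraction `g^{ij} δR_ij` is the divergence of the vector field
`g^{ij} δΓ^k_ij - g^{ik} δΓ^l_il`, up to a term in `dφ` that comes from the weight
(`IsMetricFamily.sum_inv_mul_deriv_ricci`). That term is rewritten with
`IsMetricFamily.sum_pd_mul_palatiniField`, where `⟨∇²φ, h⟩` appears. The terms from `Δφ` and
`|∇φ|²` are divergences of weighted gradients, so that only `Ric_φ`, `Δ_φ φ` and `R_φ` remain.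

*From charts to the manifold.* The Christoffel symbols are characterised by the Koszul formula,
which gives their transformation under a change of coordinates (`IsCoordChange.connectionForm_eq`);
the Ricci tensor and the Hessian are then tensors, and the variation of the connection is one too.
Hence the local vector densities agree on overlaps (`IsCoordChange.fluxDensity_eq`), and a
divergence `∂_k W^k` of such a density has integral zero (`densityIntegral_divergence`): with a
partition of unity `ρ_a`, integration by parts in each chart leaves `-∑ a, ∫ dρ_a(W)`, and
`∑ a, dρ_a = 0`. Differentiation under the integral sign now yields
`IsSmoothFamily.hasDerivAt_integral_weightedScalar`, and `δ ∫ e^{-φ} dvol = -∫ (ψ - (1/2) tr h)`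
(`IsSmoothFamily.hasDerivAt_volume`) gives the condition on variations of unit volume. For finite
`m` the derivative of `P` contributes `2 m κ μ v⁻² ψ`; here `m κ = 1` unless `m = 0`, and `ψ = 0` if
`m = 0`.

*Critical points.* Every smooth `(h, ψ)` with `∫ (ψ - (1/2) tr h) e^{-φ} dvol = 0` is the velocity
of a curve of unit volume: rescale the straight line by a function of its volume, which is
stationary at `s = 0` (`SMMS.exists_isUnitVolumeCurve`). A critical point therefore satisfies
`∫ ⟨Ric_φ - c g, h⟩ + Q (ψ - (1/2) tr h) = 0` for all such variations (`SMMS.IsStationary`). If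
`m ≠ 0`, the choice `h = Ric_φ - c g` and `ψ - (1/2) tr h = Q - ∫ Q` forces `Ric_φ = c g` and `Q`
constant (`SMMS.IsStationary.eq_smul_and_const`). For infinite `m` this is the claim, as `c = μ`.
For finite `m`, the trace identity `R_φ = n c + Δ_φ φ` (`SMMS.weightedScalar_of_eq_smul`) turns
`Q` into `(m + n - 2) c`, so that `c` is constant when `m + n ≠ 2`. If `m = 0`, then `ψ = 0`
and only `Ric = (c + Q/2 + k) g` with a constant `k` follows
(`SMMS.IsStationary.exists_eq_smul`); its trace determines the scalar curvature as `n ≠ 2`.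
-/

noncomputable section

namespace WeightedMeasure

/-! ### Functions jointly smooth in a parameter and in coordinates -/

section LocalCalculus

variable {n : ℕ}

theorem two_le_infty : (2 : WithTop ℕ∞) ≤ ∞ := WithTop.coe_le_coe.2 le_top

/-- A real function of a parameter `s` and of coordinates `y`, jointly smooth on `Ω`. -/
def JointlySmoothOn (Ω : Set (ℝ × EuclideanSpace ℝ (Fin n)))
    (F : ℝ → EuclideanSpace ℝ (Fin n) → ℝ) : Prop :=
  ContDiffOn ℝ ∞ (fun z : ℝ × EuclideanSpace ℝ (Fin n) => F z.1 z.2) Ω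

variable {Ω : Set (ℝ × EuclideanSpace ℝ (Fin n))} {F F' : ℝ → EuclideanSpace ℝ (Fin n) → ℝ}
  {s : ℝ} {y : EuclideanSpace ℝ (Fin n)}

theorem JointlySmoothOn.contDiffAt (hF : JointlySmoothOn Ω F) (hΩ : IsOpen Ω) (hz : (s, y) ∈ Ω) :
    ContDiffAt ℝ ∞ (fun z : ℝ × EuclideanSpace ℝ (Fin n) => F z.1 z.2) (s, y) :=
  ContDiffOn.contDiffAt hF (hΩ.mem_nhds hz)

theorem JointlySmoothOn.hasFDerivAt (hF : JointlySmoothOn Ω F) (hΩ : IsOpen Ω)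
    (hz : (s, y) ∈ Ω) :
    HasFDerivAt (fun z : ℝ × EuclideanSpace ℝ (Fin n) => F z.1 z.2)
      (fderiv ℝ (fun z : ℝ × EuclideanSpace ℝ (Fin n) => F z.1 z.2) (s, y)) (s, y) :=
  ((hF.contDiffAt hΩ hz).differentiableAt (by simp)).hasFDerivAt

theorem JointlySmoothOn.space_contDiffAt (hF : JointlySmoothOn Ω F) (hΩ : IsOpen Ω)
    (hz : (s, y) ∈ Ω) : ContDiffAt ℝ ∞ (F s) y :=
  (hF.contDiffAt hΩ hz).comp y (f := fun x => (s, x)) (contDiffAt_const.prodMk contDiffAt_id)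

theorem JointlySmoothOn.time_contDiffAt (hF : JointlySmoothOn Ω F) (hΩ : IsOpen Ω)
    (hz : (s, y) ∈ Ω) : ContDiffAt ℝ ∞ (fun t => F t y) s :=
  (hF.contDiffAt hΩ hz).comp s (f := fun x => (x, y)) (contDiffAt_id.prodMk contDiffAt_const)

theorem JointlySmoothOn.differentiableAt (hF : JointlySmoothOn Ω F) (hΩ : IsOpen Ω)
    (hz : (s, y) ∈ Ω) : DifferentiableAt ℝ (F s) y :=
  (hF.space_contDiffAt hΩ hz).differentiableAt (by simp)

theorem JointlySmoothOn.hasDerivAt (hF : JointlySmoothOn Ω F) (hΩ : IsOpen Ω)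
    (hz : (s, y) ∈ Ω) : HasDerivAt (fun t => F t y) (deriv (fun t => F t y) s) s :=
  ((hF.time_contDiffAt hΩ hz).differentiableAt (by simp)).hasDerivAt

theorem JointlySmoothOn.pd_eq (hF : JointlySmoothOn Ω F) (hΩ : IsOpen Ω) (hz : (s, y) ∈ Ω)
    (i : Fin n) :
    pd i (F s) y = fderiv ℝ (fun z : ℝ × EuclideanSpace ℝ (Fin n) => F z.1 z.2) (s, y)
      (0, EuclideanSpace.single i 1) := by
  have h := (hF.hasFDerivAt hΩ hz).comp y
    ((hasFDerivAt_const s y).prodMk (hasFDerivAt_id y))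
  have h' : HasFDerivAt (F s) _ y := h
  simp [pd, h'.fderiv]

theorem JointlySmoothOn.deriv_eq (hF : JointlySmoothOn Ω F) (hΩ : IsOpen Ω) (hz : (s, y) ∈ Ω) :
    deriv (fun t => F t y) s =
      fderiv ℝ (fun z : ℝ × EuclideanSpace ℝ (Fin n) => F z.1 z.2) (s, y) (1, 0) := by
  have h := (hF.hasFDerivAt hΩ hz).comp_hasDerivAt s
    ((hasDerivAt_id s).prodMk (hasDerivAt_const s y))
  exact h.deriv

theorem JointlySmoothOn.fderiv_apply (hF : JointlySmoothOn Ω F) (hΩ : IsOpen Ω)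
    (v : ℝ × EuclideanSpace ℝ (Fin n)) :
    JointlySmoothOn Ω fun s y =>
      fderiv ℝ (fun z : ℝ × EuclideanSpace ℝ (Fin n) => F z.1 z.2) (s, y) v := by
  have := ContDiffOn.fderiv_of_isOpen (m := ∞) hF hΩ (by simp)
  exact this.clm_apply contDiffOn_const

theorem JointlySmoothOn.pd (hF : JointlySmoothOn Ω F) (hΩ : IsOpen Ω) (i : Fin n) :
    JointlySmoothOn Ω fun s y => pd i (F s) y :=
  (hF.fderiv_apply hΩ _).congr fun _ hz => hF.pd_eq hΩ hz i

theorem JointlySmoothOn.deriv (hF : JointlySmoothOn Ω F) (hΩ : IsOpen Ω) :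
    JointlySmoothOn Ω fun s y => deriv (fun t => F t y) s :=
  (hF.fderiv_apply hΩ _).congr fun _ hz => hF.deriv_eq hΩ hz

theorem JointlySmoothOn.congr (hF : JointlySmoothOn Ω F)
    (h : ∀ s y, (s, y) ∈ Ω → F' s y = F s y) : JointlySmoothOn Ω F' :=
  ContDiffOn.congr hF fun z hz => h z.1 z.2 hz

theorem JointlySmoothOn.mono {Ω' : Set (ℝ × EuclideanSpace ℝ (Fin n))}
    (hF : JointlySmoothOn Ω F) (h : Ω' ⊆ Ω) : JointlySmoothOn Ω' F :=
  ContDiffOn.mono hF h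

theorem JointlySmoothOn.const (c : ℝ) : JointlySmoothOn Ω fun _ _ => c := contDiffOn_const

theorem JointlySmoothOn.add (hF : JointlySmoothOn Ω F) (hF' : JointlySmoothOn Ω F') :
    JointlySmoothOn Ω fun s y => F s y + F' s y := ContDiffOn.add hF hF'

theorem JointlySmoothOn.sub (hF : JointlySmoothOn Ω F) (hF' : JointlySmoothOn Ω F') :
    JointlySmoothOn Ω fun s y => F s y - F' s y := ContDiffOn.sub hF hF'

theorem JointlySmoothOn.neg (hF : JointlySmoothOn Ω F) :
    JointlySmoothOn Ω fun s y => -F s y := ContDiffOn.neg hF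

theorem JointlySmoothOn.mul (hF : JointlySmoothOn Ω F) (hF' : JointlySmoothOn Ω F') :
    JointlySmoothOn Ω fun s y => F s y * F' s y := ContDiffOn.mul hF hF'

theorem JointlySmoothOn.sum {ι : Type*} {t : Finset ι}
    {F : ι → ℝ → EuclideanSpace ℝ (Fin n) → ℝ} (hF : ∀ i, JointlySmoothOn Ω (F i)) :
    JointlySmoothOn Ω fun s y => ∑ i ∈ t, F i s y := ContDiffOn.sum fun i _ => hF i

theorem JointlySmoothOn.prod {ι : Type*} {t : Finset ι}
    {F : ι → ℝ → EuclideanSpace ℝ (Fin n) → ℝ} (hF : ∀ i, JointlySmoothOn Ω (F i)) :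
    JointlySmoothOn Ω fun s y => ∏ i ∈ t, F i s y := contDiffOn_prod fun i _ => hF i

theorem JointlySmoothOn.comp {f : ℝ → ℝ} (hf : ContDiff ℝ ∞ f) (hF : JointlySmoothOn Ω F) :
    JointlySmoothOn Ω fun s y => f (F s y) := hf.comp_contDiffOn hF

theorem JointlySmoothOn.inv (hF : JointlySmoothOn Ω F) (h0 : ∀ s y, (s, y) ∈ Ω → F s y ≠ 0) :
    JointlySmoothOn Ω fun s y => (F s y)⁻¹ := ContDiffOn.inv hF fun z hz => h0 z.1 z.2 hz

theorem JointlySmoothOn.sqrt (hF : JointlySmoothOn Ω F) (h0 : ∀ s y, (s, y) ∈ Ω → F s y ≠ 0) :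
    JointlySmoothOn Ω fun s y => Real.sqrt (F s y) :=
  ContDiffOn.sqrt hF fun z hz => h0 z.1 z.2 hz

/-- The parameter derivative commutes with the partial derivatives of a jointly smooth function. -/
theorem JointlySmoothOn.deriv_pd (hF : JointlySmoothOn Ω F) (hΩ : IsOpen Ω) (hz : (s, y) ∈ Ω)
    (i : Fin n) :
    HasDerivAt (fun t => WeightedMeasure.pd i (F t) y)
      (WeightedMeasure.pd i (fun x => _root_.deriv (fun t => F t x) s) y) s := by
  have h1 := (hF.pd hΩ i).hasDerivAt hΩ hz
  rw [(hF.pd hΩ i).deriv_eq hΩ hz] at h1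
  rw [(hF.deriv hΩ).pd_eq hΩ hz]
  convert h1 using 1
  have hev : ∀ᶠ z in 𝓝 (s, y), z ∈ Ω := hΩ.mem_nhds hz
  have e1 : (fun z : ℝ × EuclideanSpace ℝ (Fin n) =>
      _root_.deriv (fun t => F t z.2) z.1) =ᶠ[𝓝 (s, y)]
      fun z => fderiv ℝ (fun z : ℝ × EuclideanSpace ℝ (Fin n) => F z.1 z.2) z (1, 0) := by
    filter_upwards [hev] with z hz using hF.deriv_eq hΩ hz
  have e2 : (fun z : ℝ × EuclideanSpace ℝ (Fin n) => WeightedMeasure.pd i (F z.1) z.2) =ᶠ[𝓝 (s, y)]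
      fun z => fderiv ℝ (fun z : ℝ × EuclideanSpace ℝ (Fin n) => F z.1 z.2) z
        (0, EuclideanSpace.single i 1) := by
    filter_upwards [hev] with z hz using hF.pd_eq hΩ hz i
  rw [e1.fderiv_eq, e2.fderiv_eq]
  have hd : DifferentiableAt ℝ
      (fderiv ℝ (fun z : ℝ × EuclideanSpace ℝ (Fin n) => F z.1 z.2)) (s, y) :=
    ((hF.contDiffAt hΩ hz).fderiv_right (m := 1) two_le_infty).differentiableAt
      (by simp)
  rw [fderiv_clm_apply hd (by fun_prop), fderiv_clm_apply hd (by fun_prop)]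
  simp only [fderiv_fun_const, Pi.zero_apply, ContinuousLinearMap.comp_zero, zero_add,
    ContinuousLinearMap.flip_apply]
  exact ((hF.contDiffAt hΩ hz).isSymmSndFDerivAt
    (by simpa using two_le_infty)).eq _ _

/-! ### Partial derivatives -/

variable {f g : EuclideanSpace ℝ (Fin n) → ℝ}

theorem pd_congr (h : f =ᶠ[𝓝 y] g) (i : Fin n) : pd i f y = pd i g y := by
  simp [pd, h.fderiv_eq]

theorem pd_const (c : ℝ) (i : Fin n) : pd i (fun _ => c) y = 0 := by simp [pd]

theorem pd_add (hf : DifferentiableAt ℝ f y) (hg : DifferentiableAt ℝ g y) (i : Fin n) :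
    pd i (fun x => f x + g x) y = pd i f y + pd i g y := by
  simp [pd, fderiv_fun_add hf hg]

theorem pd_sub (hf : DifferentiableAt ℝ f y) (hg : DifferentiableAt ℝ g y) (i : Fin n) :
    pd i (fun x => f x - g x) y = pd i f y - pd i g y := by
  simp [pd, fderiv_fun_sub hf hg]

theorem pd_mul (hf : DifferentiableAt ℝ f y) (hg : DifferentiableAt ℝ g y) (i : Fin n) :
    pd i (fun x => f x * g x) y = pd i f y * g y + f y * pd i g y := by
  simp [pd, fderiv_fun_mul hf hg]; ring

theorem pd_sum {ι : Type*} {t : Finset ι} {f : ι → EuclideanSpace ℝ (Fin n) → ℝ}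
    (hf : ∀ j ∈ t, DifferentiableAt ℝ (f j) y) (i : Fin n) :
    pd i (fun x => ∑ j ∈ t, f j x) y = ∑ j ∈ t, pd i (f j) y := by
  simp [pd, fderiv_fun_sum hf]

/-- A partial derivative is the derivative along a coordinate line. -/
theorem hasDerivAt_line (hf : DifferentiableAt ℝ f y) (i : Fin n) :
    HasDerivAt (fun t : ℝ => f (y + t • EuclideanSpace.single i (1 : ℝ))) (pd i f y) 0 :=
  hf.hasFDerivAt.hasLineDerivAt _

/-- Second partial derivatives commute. -/
theorem pd_comm (hf : ContDiffAt ℝ ∞ f y) (i j : Fin n) : pd i (pd j f) y = pd j (pd i f) y := by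
  have hd : DifferentiableAt ℝ (fderiv ℝ f) y :=
    (hf.fderiv_right (m := 1) two_le_infty).differentiableAt (by simp)
  unfold pd
  rw [fderiv_clm_apply hd (by fun_prop), fderiv_clm_apply hd (by fun_prop)]
  simp only [fderiv_fun_const, Pi.zero_apply, ContinuousLinearMap.comp_zero, zero_add,
    ContinuousLinearMap.flip_apply]
  exact (hf.isSymmSndFDerivAt (by simpa using two_le_infty)).eq _ _

/-! ### Determinants and inverses of matrix-valued functions -/

/-- Jacobi's formula for the derivative of a determinant. -/
theorem hasDerivAt_det {A : ℝ → Matrix (Fin n) (Fin n) ℝ} {A' : Matrix (Fin n) (Fin n) ℝ} {t : ℝ}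
    (hA : ∀ i j, HasDerivAt (fun s => A s i j) (A' i j) t) (h0 : (A t).det ≠ 0) :
    HasDerivAt (fun s => (A s).det) ((A t).det * ∑ i, ∑ j, (A t)⁻¹ i j * A' j i) t := by
  have h1 : HasDerivAt (fun s => (A s).det)
      (∑ σ : Equiv.Perm (Fin n), (Equiv.Perm.sign σ : ℝ) *
        ∑ i, (∏ j ∈ Finset.univ.erase i, A t (σ j) j) • A' (σ i) i) t := by
    simp only [Matrix.det_apply']
    exact HasDerivAt.fun_sum fun σ _ =>
      (HasDerivAt.fun_finsetProd fun i _ => hA (σ i) i).const_mul _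
  convert h1 using 1
  have h2 : ∀ i, ∑ j, (A t).adjugate i j * A' j i = ((A t).updateCol i fun j => A' j i).det := by
    intro i
    rw [← Matrix.cramer_apply, Matrix.cramer_eq_adjugate_mulVec]; rfl
  have h3 : (A t).det * ∑ i, ∑ j, (A t)⁻¹ i j * A' j i
      = ∑ i, ∑ j, (A t).adjugate i j * A' j i := by
    simp only [Finset.mul_sum, Matrix.inv_def, Matrix.smul_apply, Ring.inverse_eq_inv', smul_eq_mul]
    refine Finset.sum_congr rfl fun i _ => Finset.sum_congr rfl fun j _ => ?_
    field_simp
  rw [h3, Finset.sum_congr rfl fun i _ => h2 i]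
  simp only [Matrix.det_apply', Finset.mul_sum]
  rw [Finset.sum_comm]
  refine Finset.sum_congr rfl fun σ _ => Finset.sum_congr rfl fun i _ => ?_
  rw [← Finset.mul_prod_erase _ _ (Finset.mem_univ i)]
  rw [Finset.prod_congr rfl (g := fun j => A t (σ j) j)]
  · simp; ring
  · intro j hj
    simp [Matrix.updateCol_ne (Finset.ne_of_mem_erase hj)]

theorem JointlySmoothOn.det {A : ℝ → EuclideanSpace ℝ (Fin n) → Matrix (Fin n) (Fin n) ℝ}
    (hA : ∀ i j, JointlySmoothOn Ω fun s y => A s y i j) :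
    JointlySmoothOn Ω fun s y => (A s y).det := by
  simp only [Matrix.det_apply']
  exact JointlySmoothOn.sum fun σ => (JointlySmoothOn.const _).mul
    (JointlySmoothOn.prod fun i => hA _ _)

theorem JointlySmoothOn.matrix_inv {A : ℝ → EuclideanSpace ℝ (Fin n) → Matrix (Fin n) (Fin n) ℝ}
    (hA : ∀ i j, JointlySmoothOn Ω fun s y => A s y i j)
    (h0 : ∀ s y, (s, y) ∈ Ω → (A s y).det ≠ 0) (i j : Fin n) :
    JointlySmoothOn Ω fun s y => (A s y)⁻¹ i j := by
  simp only [Matrix.inv_def, Matrix.smul_apply, Ring.inverse_eq_inv', smul_eq_mul,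
    Matrix.adjugate_apply]
  refine ((JointlySmoothOn.det hA).inv h0).mul (JointlySmoothOn.det fun k l => ?_)
  simp only [Matrix.updateRow_apply]
  split_ifs
  · exact JointlySmoothOn.const _
  · exact hA _ _

theorem sum_inv_mul {A : Matrix (Fin n) (Fin n) ℝ} (h : A.det ≠ 0) (i j : Fin n) :
    ∑ l, A⁻¹ i l * A l j = if i = j then 1 else 0 := by
  rw [← Matrix.mul_apply, Matrix.nonsing_inv_mul _ (isUnit_iff_ne_zero.2 h), Matrix.one_apply]

/-- The derivative of the inverse of a matrix is `-A⁻¹ A' A⁻¹`. -/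
theorem hasDerivAt_matrix_inv {A : ℝ → Matrix (Fin n) (Fin n) ℝ} {A' : Matrix (Fin n) (Fin n) ℝ}
    {t : ℝ} (hA : ∀ i j, HasDerivAt (fun s => A s i j) (A' i j) t) (h0 : (A t).det ≠ 0)
    (i j : Fin n) :
    HasDerivAt (fun s => (A s)⁻¹ i j) (-((A t)⁻¹ * A' * (A t)⁻¹) i j) t := by
  have hdet := hasDerivAt_det hA h0
  have hdiff : ∀ i j, DifferentiableAt ℝ (fun s => (A s)⁻¹ i j) t := by
    intro i j
    simp only [Matrix.inv_def, Matrix.smul_apply, Ring.inverse_eq_inv', smul_eq_mul,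
      Matrix.adjugate_apply, Matrix.det_apply' (Matrix.updateRow _ _ _)]
    refine (hdet.differentiableAt.fun_inv h0).fun_mul (DifferentiableAt.fun_sum fun σ _ =>
      (differentiableAt_const _).fun_mul (DifferentiableAt.fun_finsetProd fun k _ => ?_))
    simp only [Matrix.updateRow_apply]
    split_ifs
    · exact differentiableAt_const _
    · exact (hA _ _).differentiableAt
  set B : Matrix (Fin n) (Fin n) ℝ := Matrix.of fun i j => deriv (fun s => (A s)⁻¹ i j) t with hB
  have hBd : ∀ i j, HasDerivAt (fun s => (A s)⁻¹ i j) (B i j) t := fun i j =>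
    (hdiff i j).hasDerivAt
  have hev : ∀ᶠ s in 𝓝 t, (A s).det ≠ 0 := hdet.continuousAt.eventually_ne h0
  have key : B * A t + (A t)⁻¹ * A' = 0 := by
    ext i j
    have h1 : HasDerivAt (fun s => ∑ l, (A s)⁻¹ i l * A s l j)
        (∑ l, (B i l * A t l j + (A t)⁻¹ i l * A' l j)) t :=
      HasDerivAt.fun_sum fun l _ => (hBd i l).mul (hA l j)
    have h2 : HasDerivAt (fun s => ∑ l, (A s)⁻¹ i l * A s l j) 0 t := by
      refine (hasDerivAt_const t (if i = j then (1 : ℝ) else 0)).congr_of_eventuallyEq ?_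
      filter_upwards [hev] with s hs using sum_inv_mul hs i j
    have := h1.unique h2
    simpa [Matrix.mul_apply, Finset.sum_add_distrib] using this
  have hBe : B = -((A t)⁻¹ * A' * (A t)⁻¹) := by
    have hu := isUnit_iff_ne_zero.2 h0
    have : B * A t = -((A t)⁻¹ * A') := eq_neg_of_add_eq_zero_left key
    calc B = B * A t * (A t)⁻¹ := by rw [Matrix.mul_assoc, Matrix.mul_nonsing_inv _ hu, mul_one]
      _ = _ := by rw [this, neg_mul]
  have := hBd i j
  rwa [hBe] at this

end LocalCalculus

/-! ### The Levi-Civita connection in coordinates -/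

section LeviCivita

variable {n : ℕ}

/-- A family `G s` of Riemannian metrics in coordinates, smooth jointly in the parameter and the
point, on the open set `Ω`. Only the positivity of the determinant is recorded. -/
structure IsMetricFamily (Ω : Set (ℝ × EuclideanSpace ℝ (Fin n)))
    (G : ℝ → EuclideanSpace ℝ (Fin n) → Matrix (Fin n) (Fin n) ℝ) : Prop where
  isOpen : IsOpen Ω
  smooth : ∀ i j, JointlySmoothOn Ω fun s y => G s y i j
  symm : ∀ s y, (s, y) ∈ Ω → ∀ i j, G s y i j = G s y j i
  det_pos : ∀ s y, (s, y) ∈ Ω → 0 < (G s y).det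

/-- The weighted density `e^{-φ} √det(g_ij)`. -/
def densityCoord (A : Matrix (Fin n) (Fin n) ℝ) (t : ℝ) : ℝ := Real.sqrt A.det * Real.exp (-t)

namespace IsMetricFamily

variable {Ω : Set (ℝ × EuclideanSpace ℝ (Fin n))}
  {G : ℝ → EuclideanSpace ℝ (Fin n) → Matrix (Fin n) (Fin n) ℝ}
  {φ : ℝ → EuclideanSpace ℝ (Fin n) → ℝ} {s : ℝ} {y : EuclideanSpace ℝ (Fin n)}

theorem det_ne_zero (hG : IsMetricFamily Ω G) (hz : (s, y) ∈ Ω) : (G s y).det ≠ 0 :=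
  (hG.det_pos s y hz).ne'

theorem eventually_mem (hG : IsMetricFamily Ω G) (hz : (s, y) ∈ Ω) :
    ∀ᶠ x in 𝓝 y, (s, x) ∈ Ω :=
  (Continuous.prodMk_right s).continuousAt.eventually (hG.isOpen.mem_nhds hz)

theorem eventually_mem_time (hG : IsMetricFamily Ω G) (hz : (s, y) ∈ Ω) :
    ∀ᶠ t in 𝓝 s, (t, y) ∈ Ω :=
  (Continuous.prodMk_left y).continuousAt.eventually (hG.isOpen.mem_nhds hz)

theorem inv_smooth (hG : IsMetricFamily Ω G) (i j : Fin n) :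
    JointlySmoothOn Ω fun s y => (G s y)⁻¹ i j :=
  JointlySmoothOn.matrix_inv hG.smooth (fun _ _ hz => hG.det_ne_zero hz) i j

theorem inv_symm (hG : IsMetricFamily Ω G) (hz : (s, y) ∈ Ω) (i j : Fin n) :
    (G s y)⁻¹ i j = (G s y)⁻¹ j i := by
  have h : (G s y).transpose = G s y := by
    ext i j; exact hG.symm s y hz j i
  conv_lhs => rw [← h, ← Matrix.transpose_nonsing_inv, Matrix.transpose_apply]

theorem christoffel_smooth (hG : IsMetricFamily Ω G) (k i j : Fin n) :
    JointlySmoothOn Ω fun s y => christoffel (G s) k i j y :=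
  (JointlySmoothOn.const _).mul (JointlySmoothOn.sum fun l => (hG.inv_smooth k l).mul
    ((((hG.smooth j l).pd hG.isOpen i).add ((hG.smooth i l).pd hG.isOpen j)).sub
      ((hG.smooth i j).pd hG.isOpen l)))

theorem pd_symm (hG : IsMetricFamily Ω G) (hz : (s, y) ∈ Ω) (k i j : Fin n) :
    pd k (fun x => G s x i j) y = pd k (fun x => G s x j i) y :=
  pd_congr ((hG.eventually_mem hz).mono fun x hx => hG.symm s x hx i j) k

theorem christoffel_symm (hG : IsMetricFamily Ω G) (hz : (s, y) ∈ Ω) (k i j : Fin n) :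
    christoffel (G s) k i j y = christoffel (G s) k j i y := by
  unfold christoffel
  congr 1
  refine Finset.sum_congr rfl fun l _ => ?_
  rw [hG.pd_symm hz l i j]; ring

/-- The Christoffel symbols of the first kind. -/
theorem sum_mul_christoffel (hG : IsMetricFamily Ω G) (hz : (s, y) ∈ Ω) (m i j : Fin n) :
    ∑ k, G s y m k * christoffel (G s) k i j y =
      (1 / 2) * (pd i (fun x => G s x j m) y + pd j (fun x => G s x i m) y
        - pd m (fun x => G s x i j) y) := by
  set T : Fin n → ℝ := fun l => pd i (fun x => G s x j l) y + pd j (fun x => G s x i l) y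
        - pd l (fun x => G s x i j) y with hT
  have h1 : ∀ k, christoffel (G s) k i j y = ((1 / 2 : ℝ) • (G s y)⁻¹.mulVec T) k := by
    intro k; simp [christoffel, Matrix.mulVec, dotProduct, hT]
  have h2 : (G s y).mulVec ((1 / 2 : ℝ) • (G s y)⁻¹.mulVec T) = (1 / 2 : ℝ) • T := by
    rw [Matrix.mulVec_smul, Matrix.mulVec_mulVec,
      Matrix.mul_nonsing_inv _ (isUnit_iff_ne_zero.2 (hG.det_ne_zero hz)), Matrix.one_mulVec]
  have h3 := congrFun h2 m
  simpa [Matrix.mulVec, dotProduct, h1, hT] using h3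

/-- The Levi-Civita connection is compatible with the metric. -/
theorem pd_metric (hG : IsMetricFamily Ω G) (hz : (s, y) ∈ Ω) (k i j : Fin n) :
    pd k (fun x => G s x i j) y = (∑ l, G s y j l * christoffel (G s) l k i y) +
      ∑ l, G s y i l * christoffel (G s) l k j y := by
  rw [hG.sum_mul_christoffel hz, hG.sum_mul_christoffel hz, hG.pd_symm hz k j i]
  ring

theorem pd_metric_matrix (hG : IsMetricFamily Ω G) (hz : (s, y) ∈ Ω) (k : Fin n) :
    (Matrix.of fun i j => pd k (fun x => G s x i j) y) =
      (Matrix.of fun l i => christoffel (G s) l k i y).transpose * G s y +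
        G s y * (Matrix.of fun l i => christoffel (G s) l k i y) := by
  ext i j
  simp only [Matrix.of_apply, Matrix.add_apply, Matrix.mul_apply, Matrix.transpose_apply,
    hG.pd_metric hz k i j]
  congr 1
  exact Finset.sum_congr rfl fun l _ => by rw [hG.symm s y hz j l]; ring

theorem pd_inv (hG : IsMetricFamily Ω G) (hz : (s, y) ∈ Ω) (k i j : Fin n) :
    pd k (fun x => (G s x)⁻¹ i j) y =
      -∑ l, (christoffel (G s) i k l y * (G s y)⁻¹ l j
        + christoffel (G s) j k l y * (G s y)⁻¹ i l) := by
  have h1 := hasDerivAt_line ((hG.inv_smooth i j).differentiableAt hG.isOpen hz) k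
  have h2 := hasDerivAt_matrix_inv
    (A := fun t : ℝ => G s (y + t • EuclideanSpace.single k (1 : ℝ))) (t := 0)
    (A' := Matrix.of fun i j => pd k (fun x => G s x i j) y)
    (fun i j => hasDerivAt_line ((hG.smooth i j).differentiableAt hG.isOpen hz) k)
    (by simpa using hG.det_ne_zero hz) i j
  rw [h1.unique h2, hG.pd_metric_matrix hz]
  have hu := isUnit_iff_ne_zero.2 (hG.det_ne_zero hz)
  set Γ := (Matrix.of fun l i => christoffel (G s) l k i y) with hΓ
  have : (G s y)⁻¹ * (Γ.transpose * G s y + G s y * Γ) * (G s y)⁻¹ =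
      (G s y)⁻¹ * Γ.transpose + Γ * (G s y)⁻¹ := by
    rw [mul_add, add_mul, ← Matrix.mul_assoc, ← Matrix.mul_assoc,
      Matrix.nonsing_inv_mul _ hu, Matrix.one_mul, Matrix.mul_assoc _ (G s y) (G s y)⁻¹,
      Matrix.mul_nonsing_inv _ hu, Matrix.mul_one]
  simp only [zero_smul, add_zero]
  rw [this]
  simp only [hΓ, Matrix.add_apply, Matrix.mul_apply, Matrix.transpose_apply, Matrix.of_apply,
    Finset.sum_add_distrib]
  rw [add_comm]
  congr 2
  exact Finset.sum_congr rfl fun l _ => mul_comm _ _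

theorem density_smooth (hG : IsMetricFamily Ω G) (hφ : JointlySmoothOn Ω φ) :
    JointlySmoothOn Ω fun s y => densityCoord (G s y) (φ s y) :=
  ((JointlySmoothOn.det hG.smooth).sqrt fun _ _ hz => hG.det_ne_zero hz).mul
    (hφ.neg.comp Real.contDiff_exp)

end IsMetricFamily

/-- The derivative of the weighted density along a curve of metrics and functions. -/
theorem hasDerivAt_densityCoord {A : ℝ → Matrix (Fin n) (Fin n) ℝ}
    {A' : Matrix (Fin n) (Fin n) ℝ} {f : ℝ → ℝ} {f' t : ℝ}
    (hA : ∀ i j, HasDerivAt (fun s => A s i j) (A' i j) t) (hf : HasDerivAt f f' t)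
    (h0 : 0 < (A t).det) :
    HasDerivAt (fun s => densityCoord (A s) (f s))
      (densityCoord (A t) (f t) * ((1 / 2) * (∑ i, ∑ j, (A t)⁻¹ i j * A' j i) - f')) t := by
  have h1 := ((hasDerivAt_det hA h0.ne').sqrt h0.ne').mul hf.neg.exp
  refine HasDerivAt.congr_deriv h1 ?_
  have h2 : (A t).det = Real.sqrt (A t).det * Real.sqrt (A t).det :=
    (Real.mul_self_sqrt h0.le).symm
  have h3 : Real.sqrt (A t).det ≠ 0 := (Real.sqrt_pos.2 h0).ne'
  have h4 : (A t).det / (2 * √(A t).det) = √(A t).det / 2 := by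
    rw [div_eq_div_iff (by positivity) two_ne_zero]
    nlinarith
  rw [mul_div_right_comm, h4]
  simp only [densityCoord, Pi.neg_apply]
  ring

namespace IsMetricFamily

variable {Ω : Set (ℝ × EuclideanSpace ℝ (Fin n))}
  {G : ℝ → EuclideanSpace ℝ (Fin n) → Matrix (Fin n) (Fin n) ℝ}
  {φ : ℝ → EuclideanSpace ℝ (Fin n) → ℝ} {s : ℝ} {y : EuclideanSpace ℝ (Fin n)}

/-- `∂_k (e^{-φ} √det g) = e^{-φ} √det g (Γ^l_lk - ∂_k φ)`. -/
theorem pd_density (hG : IsMetricFamily Ω G) (hφ : JointlySmoothOn Ω φ) (hz : (s, y) ∈ Ω)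
    (k : Fin n) :
    pd k (fun x => densityCoord (G s x) (φ s x)) y = densityCoord (G s y) (φ s y) *
      ((∑ l, christoffel (G s) l l k y) - pd k (φ s) y) := by
  have h1 := hasDerivAt_line ((hG.density_smooth hφ).differentiableAt hG.isOpen hz) k
  have h2 := hasDerivAt_densityCoord
    (A := fun t : ℝ => G s (y + t • EuclideanSpace.single k (1 : ℝ))) (t := 0)
    (A' := Matrix.of fun i j => pd k (fun x => G s x i j) y)
    (fun i j => hasDerivAt_line ((hG.smooth i j).differentiableAt hG.isOpen hz) k)
    (hasDerivAt_line (hφ.differentiableAt hG.isOpen hz) k)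
    (by simpa using hG.det_pos s y hz)
  rw [h1.unique h2]
  simp only [zero_smul, add_zero]
  congr 2
  have hu := isUnit_iff_ne_zero.2 (hG.det_ne_zero hz)
  have h3 : ∀ B : Matrix (Fin n) (Fin n) ℝ,
      ∑ i, ∑ j, (G s y)⁻¹ i j * B j i = ((G s y)⁻¹ * B).trace := by
    intro B; simp [Matrix.trace, Matrix.mul_apply]
  rw [h3, hG.pd_metric_matrix hz, mul_add, Matrix.trace_add, ← Matrix.mul_assoc,
    ← Matrix.mul_assoc, Matrix.nonsing_inv_mul _ hu, Matrix.one_mul, Matrix.trace_mul_comm,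
    ← Matrix.mul_assoc, Matrix.mul_nonsing_inv _ hu, Matrix.one_mul, Matrix.trace_transpose]
  simp only [Matrix.trace, Matrix.diag_apply, Matrix.of_apply]
  rw [Finset.sum_congr rfl fun l _ => hG.christoffel_symm hz l k l]
  ring

/-- The divergence of a vector density `w V`, for `w = e^{-φ} √det g`. -/
theorem sum_pd_density_mul (hG : IsMetricFamily Ω G) (hφ : JointlySmoothOn Ω φ)
    (hz : (s, y) ∈ Ω) {V : Fin n → EuclideanSpace ℝ (Fin n) → ℝ}
    (hV : ∀ k, DifferentiableAt ℝ (V k) y) :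
    ∑ k, pd k (fun x => densityCoord (G s x) (φ s x) * V k x) y = densityCoord (G s y) (φ s y) *
      ∑ k, (pd k (V k) y + (∑ l, christoffel (G s) l l k y) * V k y - pd k (φ s) y * V k y) := by
  rw [Finset.mul_sum]
  refine Finset.sum_congr rfl fun k _ => ?_
  rw [pd_mul ((hG.density_smooth hφ).differentiableAt hG.isOpen hz) (hV k),
    hG.pd_density hφ hz]
  ring

end IsMetricFamily

end LeviCivita

/-! ### Rearranging iterated sums -/

section Sums

variable {ι : Type*} [Fintype ι]

theorem sum_congr_two {f f' : ι → ι → ℝ} (h : ∀ i j, f i j = f' i j) :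
    ∑ i, ∑ j, f i j = ∑ i, ∑ j, f' i j :=
  Finset.sum_congr rfl fun i _ => Finset.sum_congr rfl fun j _ => h i j

/-- An iterated sum may be reindexed by a permutation of its four indices. -/
theorem sum_reindex_four {f f' : ι → ι → ι → ι → ℝ} (σ τ : ι × ι × ι × ι → ι × ι × ι × ι)
    (h1 : ∀ x, τ (σ x) = x) (h2 : ∀ x, σ (τ x) = x)
    (h : ∀ i j k l, f i j k l =
      f' (σ (i, j, k, l)).1 (σ (i, j, k, l)).2.1 (σ (i, j, k, l)).2.2.1 (σ (i, j, k, l)).2.2.2) :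
    ∑ i, ∑ j, ∑ k, ∑ l, f i j k l = ∑ i, ∑ j, ∑ k, ∑ l, f' i j k l := by
  have e (f : ι → ι → ι → ι → ℝ) : ∑ i, ∑ j, ∑ k, ∑ l, f i j k l =
      ∑ x : ι × ι × ι × ι, f x.1 x.2.1 x.2.2.1 x.2.2.2 := by
    simp only [Fintype.sum_prod_type]
  rw [e, e]
  exact Fintype.sum_equiv ⟨σ, τ, h1, h2⟩ _ _ fun x => h _ _ _ _

/-- An iterated sum may be reindexed by a permutation of its three indices. -/
theorem sum_reindex_three {f f' : ι → ι → ι → ℝ} (σ τ : ι × ι × ι → ι × ι × ι)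
    (h1 : ∀ x, τ (σ x) = x) (h2 : ∀ x, σ (τ x) = x)
    (h : ∀ i j k, f i j k = f' (σ (i, j, k)).1 (σ (i, j, k)).2.1 (σ (i, j, k)).2.2) :
    ∑ i, ∑ j, ∑ k, f i j k = ∑ i, ∑ j, ∑ k, f' i j k := by
  have e (f : ι → ι → ι → ℝ) : ∑ i, ∑ j, ∑ k, f i j k =
      ∑ x : ι × ι × ι, f x.1 x.2.1 x.2.2 := by
    simp only [Fintype.sum_prod_type]
  rw [e, e]
  exact Fintype.sum_equiv ⟨σ, τ, h1, h2⟩ _ _ fun x => h _ _ _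

end Sums

/-! ### The variation of the Ricci tensor -/

section Palatini

variable {ι : Type*} [Fintype ι]

/-- Palatini's identity at a point, as an identity between contractions: `g` is the inverse
metric, `Γ` the connection, `C` its variation and `D k` the derivative `∂_k C`. All the terms
with `Γ` cancel when `∂_k g^ij` is expressed through `Γ`. -/
theorem palatini_contraction (g : ι → ι → ℝ) (Γ C : ι → ι → ι → ℝ) (D : ι → ι → ι → ι → ℝ)
    (hΓ : ∀ k i j, Γ k i j = Γ k j i)
    (hC : ∀ k i j, C k i j = C k j i) :
    ∑ i, ∑ j, g i j * ((∑ k, D k k i j) - (∑ k, D j k i k)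
        + (∑ k, ∑ l, (C k k l * Γ l i j + Γ k k l * C l i j))
        - ∑ k, ∑ l, (C k j l * Γ l i k + Γ k j l * C l i k)) =
      ∑ k, ((∑ i, ∑ j, (-(∑ l, (Γ i k l * g l j + Γ j k l * g i l)) * C k i j
            + g i j * D k k i j))
        - (∑ i, (-(∑ l, (Γ i k l * g l k + Γ k k l * g i l)) * (∑ l, C l i l)
            + g i k * ∑ l, D k l i l))
        + (∑ l, Γ l l k) * ((∑ i, ∑ j, g i j * C k i j) - ∑ i, g i k * ∑ l, C l i l)) := by
  have a1 : ∑ k, ∑ i, ∑ j, g i j * D k k i j = ∑ i, ∑ j, ∑ k, g i j * D k k i j :=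
    sum_reindex_three (fun (k, i, j) => (i, j, k)) (fun (i, j, k) => (k, i, j)) (fun _ => rfl)
      (fun _ => rfl) fun _ _ _ => rfl
  have a2 : ∑ k, ∑ i, ∑ l, g i k * D k l i l = ∑ i, ∑ j, ∑ k, g i j * D j k i k :=
    sum_reindex_three (fun (k, i, l) => (i, k, l)) (fun (i, j, k) => (j, i, k)) (fun _ => rfl)
      (fun _ => rfl) fun _ _ _ => rfl
  have b3 : ∑ k, ∑ i, ∑ l, ∑ m, Γ i k m * g m k * C l i l =
      ∑ i, ∑ j, ∑ k, ∑ l, g i j * (C k k l * Γ l i j) :=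
    sum_reindex_four (fun (k, i, l, m) => (m, k, l, i)) (fun (i, j, k, l) => (j, l, k, i))
      (fun _ => rfl) (fun _ => rfl) fun k i l m => by
        dsimp only; rw [hC l i l, hΓ i k m]; ring
  have b4 : ∑ k, ∑ i, ∑ j, ∑ l, Γ l l k * (g i j * C k i j) =
      ∑ i, ∑ j, ∑ k, ∑ l, g i j * (Γ k k l * C l i j) :=
    sum_reindex_four (fun (k, i, j, l) => (i, j, l, k)) (fun (i, j, k, l) => (l, i, j, k))
      (fun _ => rfl) (fun _ => rfl) fun k i j l => by
        dsimp only; ring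
  have b5 : ∑ k, ∑ i, ∑ j, ∑ l, Γ i k l * g l j * C k i j =
      ∑ i, ∑ j, ∑ k, ∑ l, g i j * (C k j l * Γ l i k) :=
    sum_reindex_four (fun (k, i, j, l) => (l, j, k, i)) (fun (i, j, k, l) => (k, l, j, i))
      (fun _ => rfl) (fun _ => rfl) fun k i j l => by
        dsimp only; rw [hC k i j, hΓ i k l]; ring
  have b6 : ∑ k, ∑ i, ∑ j, ∑ l, Γ j k l * g i l * C k i j =
      ∑ i, ∑ j, ∑ k, ∑ l, g i j * (Γ k j l * C l i k) :=
    sum_reindex_four (fun (k, i, j, l) => (i, l, j, k)) (fun (i, j, k, l) => (l, i, k, j))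
      (fun _ => rfl) (fun _ => rfl) fun k i j l => by
        dsimp only; rw [hΓ j k l]; ring
  have b7 : ∑ k, ∑ i, ∑ l, ∑ m, Γ k k m * g i m * C l i l =
      ∑ k, ∑ i, ∑ l, ∑ m, Γ m m k * (g i k * C l i l) :=
    sum_reindex_four (fun (k, i, l, m) => (m, i, l, k)) (fun (k, i, l, m) => (m, i, l, k))
      (fun _ => rfl) (fun _ => rfl) fun k i l m => by
        dsimp only; ring
  simp only [mul_add, mul_sub, add_mul, neg_mul, Finset.sum_add_distrib, Finset.sum_sub_distrib,
    Finset.sum_neg_distrib, Finset.mul_sum, Finset.sum_mul, neg_add] at a1 a2 b3 b4 b5 b6 b7 ⊢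
  linear_combination -a1 + a2 - b3 - b4 + b5 + b6 - b7

end Palatini

section Variation

variable {n : ℕ}

section

variable {ι : Type*} [Fintype ι] {y : EuclideanSpace ℝ (Fin n)}

theorem differentiableAt_sum_mul {f g : ι → EuclideanSpace ℝ (Fin n) → ℝ}
    (hf : ∀ i, DifferentiableAt ℝ (f i) y) (hg : ∀ i, DifferentiableAt ℝ (g i) y) :
    DifferentiableAt ℝ (fun x => ∑ i, f i x * g i x) y :=
  DifferentiableAt.fun_sum fun i _ => (hf i).mul (hg i)

theorem differentiableAt_sum_sum_mul {f g : ι → ι → EuclideanSpace ℝ (Fin n) → ℝ}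
    (hf : ∀ i j, DifferentiableAt ℝ (f i j) y) (hg : ∀ i j, DifferentiableAt ℝ (g i j) y) :
    DifferentiableAt ℝ (fun x => ∑ i, ∑ j, f i j x * g i j x) y :=
  DifferentiableAt.fun_sum fun i _ => differentiableAt_sum_mul (hf i) (hg i)

theorem pd_sum_mul {f g : ι → EuclideanSpace ℝ (Fin n) → ℝ}
    (hf : ∀ i, DifferentiableAt ℝ (f i) y) (hg : ∀ i, DifferentiableAt ℝ (g i) y) (k : Fin n) :
    pd k (fun x => ∑ i, f i x * g i x) y =
      ∑ i, (pd k (f i) y * g i y + f i y * pd k (g i) y) := by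
  rw [pd_sum fun i _ => (hf i).fun_mul (hg i)]
  exact Finset.sum_congr rfl fun i _ => pd_mul (hf i) (hg i) k

theorem pd_sum_sum_mul {f g : ι → ι → EuclideanSpace ℝ (Fin n) → ℝ}
    (hf : ∀ i j, DifferentiableAt ℝ (f i j) y) (hg : ∀ i j, DifferentiableAt ℝ (g i j) y)
    (k : Fin n) :
    pd k (fun x => ∑ i, ∑ j, f i j x * g i j x) y =
      ∑ i, ∑ j, (pd k (f i j) y * g i j y + f i j y * pd k (g i j) y) := by
  rw [pd_sum fun i _ => differentiableAt_sum_mul (hf i) (hg i)]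
  exact Finset.sum_congr rfl fun i _ => pd_sum_mul (hf i) (hg i) k

end

/-- The variation `∂Γ^k_ij/∂s` of the Christoffel symbols of a family of metrics. -/
def christoffelVar (G : ℝ → EuclideanSpace ℝ (Fin n) → Matrix (Fin n) (Fin n) ℝ) (s : ℝ)
    (k i j : Fin n) (y : EuclideanSpace ℝ (Fin n)) : ℝ :=
  deriv (fun t => christoffel (G t) k i j y) s

/-- The variation `h = ∂g/∂s` of a family of metrics. -/
def metricVar (G : ℝ → EuclideanSpace ℝ (Fin n) → Matrix (Fin n) (Fin n) ℝ) (s : ℝ)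
    (y : EuclideanSpace ℝ (Fin n)) : Matrix (Fin n) (Fin n) ℝ :=
  Matrix.of fun i j => deriv (fun t => G t y i j) s

/-- The vector field `Y^k = g^ij C^k_ij - g^ik C^l_il`, for the variation `C` of the connection:
its divergence is the trace of the variation of the Ricci tensor. -/
def palatiniField (G : ℝ → EuclideanSpace ℝ (Fin n) → Matrix (Fin n) (Fin n) ℝ) (s : ℝ)
    (k : Fin n) (y : EuclideanSpace ℝ (Fin n)) : ℝ :=
  (∑ i, ∑ j, (G s y)⁻¹ i j * christoffelVar G s k i j y) -
    ∑ i, (G s y)⁻¹ i k * ∑ l, christoffelVar G s l i l y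

/-- The gradient `g^kl α_l` of a one-form `α`. -/
def sharp (A : Matrix (Fin n) (Fin n) ℝ) (α : Fin n → ℝ) (k : Fin n) : ℝ := ∑ l, A⁻¹ k l * α l

namespace IsMetricFamily

variable {Ω : Set (ℝ × EuclideanSpace ℝ (Fin n))}
  {G : ℝ → EuclideanSpace ℝ (Fin n) → Matrix (Fin n) (Fin n) ℝ}
  {φ : ℝ → EuclideanSpace ℝ (Fin n) → ℝ} {s : ℝ} {y : EuclideanSpace ℝ (Fin n)}

theorem christoffelVar_smooth (hG : IsMetricFamily Ω G) (k i j : Fin n) :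
    JointlySmoothOn Ω fun s y => christoffelVar G s k i j y :=
  (hG.christoffel_smooth k i j).deriv hG.isOpen

theorem hasDerivAt_christoffel (hG : IsMetricFamily Ω G) (hz : (s, y) ∈ Ω) (k i j : Fin n) :
    HasDerivAt (fun t => christoffel (G t) k i j y) (christoffelVar G s k i j y) s :=
  (hG.christoffel_smooth k i j).hasDerivAt hG.isOpen hz

theorem christoffelVar_symm (hG : IsMetricFamily Ω G) (hz : (s, y) ∈ Ω) (k i j : Fin n) :
    christoffelVar G s k i j y = christoffelVar G s k j i y := by
  refine Filter.EventuallyEq.deriv_eq ?_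
  filter_upwards [hG.eventually_mem_time hz] with t ht using hG.christoffel_symm ht k i j

theorem metricVar_smooth (hG : IsMetricFamily Ω G) (i j : Fin n) :
    JointlySmoothOn Ω fun s y => metricVar G s y i j := (hG.smooth i j).deriv hG.isOpen

theorem hasDerivAt_metric (hG : IsMetricFamily Ω G) (hz : (s, y) ∈ Ω) (i j : Fin n) :
    HasDerivAt (fun t => G t y i j) (metricVar G s y i j) s :=
  (hG.smooth i j).hasDerivAt hG.isOpen hz

theorem metricVar_symm (hG : IsMetricFamily Ω G) (hz : (s, y) ∈ Ω) (i j : Fin n) :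
    metricVar G s y i j = metricVar G s y j i := by
  refine Filter.EventuallyEq.deriv_eq ?_
  filter_upwards [hG.eventually_mem_time hz] with t ht using hG.symm t y ht i j

theorem palatiniField_smooth (hG : IsMetricFamily Ω G) (k : Fin n) :
    JointlySmoothOn Ω fun s y => palatiniField G s k y :=
  (JointlySmoothOn.sum fun i => JointlySmoothOn.sum fun j =>
    (hG.inv_smooth i j).mul (hG.christoffelVar_smooth k i j)).sub
  (JointlySmoothOn.sum fun i => (hG.inv_smooth i k).mul
    (JointlySmoothOn.sum fun l => hG.christoffelVar_smooth l i l))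

theorem ricci_smooth (hG : IsMetricFamily Ω G) (i j : Fin n) :
    JointlySmoothOn Ω fun s y => ricciCoord (G s) y i j :=
  (((JointlySmoothOn.sum fun k => (hG.christoffel_smooth k i j).pd hG.isOpen k).sub
    (JointlySmoothOn.sum fun k => (hG.christoffel_smooth k i k).pd hG.isOpen j)).add
    (JointlySmoothOn.sum fun k => JointlySmoothOn.sum fun l =>
      (hG.christoffel_smooth k k l).mul (hG.christoffel_smooth l i j))).sub
    (JointlySmoothOn.sum fun k => JointlySmoothOn.sum fun l =>
      (hG.christoffel_smooth k j l).mul (hG.christoffel_smooth l i k))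

theorem hasDerivAt_ricci (hG : IsMetricFamily Ω G) (hz : (s, y) ∈ Ω) (i j : Fin n) :
    HasDerivAt (fun t => ricciCoord (G t) y i j)
      ((∑ k, pd k (christoffelVar G s k i j) y) - (∑ k, pd j (christoffelVar G s k i k) y)
        + (∑ k, ∑ l, (christoffelVar G s k k l y * christoffel (G s) l i j y
          + christoffel (G s) k k l y * christoffelVar G s l i j y))
        - ∑ k, ∑ l, (christoffelVar G s k j l y * christoffel (G s) l i k y
          + christoffel (G s) k j l y * christoffelVar G s l i k y)) s :=
  (((HasDerivAt.fun_sum fun k _ => (hG.christoffel_smooth k i j).deriv_pd hG.isOpen hz k).sub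
    (HasDerivAt.fun_sum fun k _ => (hG.christoffel_smooth k i k).deriv_pd hG.isOpen hz j)).add
    (HasDerivAt.fun_sum fun k _ => HasDerivAt.fun_sum fun l _ =>
      (hG.hasDerivAt_christoffel hz k k l).mul (hG.hasDerivAt_christoffel hz l i j))).sub
    (HasDerivAt.fun_sum fun k _ => HasDerivAt.fun_sum fun l _ =>
      (hG.hasDerivAt_christoffel hz k j l).mul (hG.hasDerivAt_christoffel hz l i k))

theorem pd_palatiniField (hG : IsMetricFamily Ω G) (hz : (s, y) ∈ Ω) (k : Fin n) :
    pd k (palatiniField G s k) y =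
      (∑ i, ∑ j, (-(∑ l, (christoffel (G s) i k l y * (G s y)⁻¹ l j
          + christoffel (G s) j k l y * (G s y)⁻¹ i l)) * christoffelVar G s k i j y
            + (G s y)⁻¹ i j * pd k (christoffelVar G s k i j) y))
        - ∑ i, (-(∑ l, (christoffel (G s) i k l y * (G s y)⁻¹ l k
            + christoffel (G s) k k l y * (G s y)⁻¹ i l)) * (∑ l, christoffelVar G s l i l y)
            + (G s y)⁻¹ i k * ∑ l, pd k (christoffelVar G s l i l) y) := by
  have hinv := fun i j => (hG.inv_smooth i j).differentiableAt hG.isOpen hz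
  have hC := fun k i j => (hG.christoffelVar_smooth k i j).differentiableAt hG.isOpen hz
  have hS : ∀ i, DifferentiableAt ℝ (fun x => ∑ l, christoffelVar G s l i l x) y :=
    fun i => DifferentiableAt.fun_sum fun l _ => hC l i l
  have h3 := pd_sub (differentiableAt_sum_sum_mul hinv (hC k))
    (differentiableAt_sum_mul (fun i => hinv i k) hS) k
  rw [pd_sum_sum_mul hinv (hC k), pd_sum_mul (fun i => hinv i k) hS] at h3
  refine h3.trans ?_
  congr 1
  · exact sum_congr_two fun i j => by rw [hG.pd_inv hz]
  · refine Finset.sum_congr rfl fun i _ => ?_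
    rw [hG.pd_inv hz, pd_sum fun l _ => hC l i l]

/-- Palatini's identity: up to the divergence of `w Y`, for `w = e^{-φ} √det g`, the trace of the
variation of the Ricci tensor is `⟨dφ, Y⟩`. -/
theorem sum_inv_mul_deriv_ricci (hG : IsMetricFamily Ω G) (hφ : JointlySmoothOn Ω φ)
    (hz : (s, y) ∈ Ω) :
    densityCoord (G s y) (φ s y) *
        ∑ i, ∑ j, (G s y)⁻¹ i j * deriv (fun t => ricciCoord (G t) y i j) s =
      (∑ k, pd k (fun x => densityCoord (G s x) (φ s x) * palatiniField G s k x) y)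
        + densityCoord (G s y) (φ s y) * ∑ k, pd k (φ s) y * palatiniField G s k y := by
  have h1 := hG.sum_pd_density_mul hφ hz fun k =>
    (hG.palatiniField_smooth k).differentiableAt hG.isOpen hz
  have h2 := palatini_contraction (fun i j => (G s y)⁻¹ i j)
    (fun k i j => christoffel (G s) k i j y)
    (fun k i j => christoffelVar G s k i j y)
    (fun m k i j => pd m (christoffelVar G s k i j) y)
    (hG.christoffel_symm hz) (hG.christoffelVar_symm hz)
  have h3 : ∀ i j, deriv (fun t => ricciCoord (G t) y i j) s = _ := fun i j =>
    (hG.hasDerivAt_ricci hz i j).deriv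
  rw [h1, ← mul_add, ← Finset.sum_add_distrib]
  congr 1
  simp only [h3, sub_add_cancel, hG.pd_palatiniField hz]
  exact h2

/-- The weighted divergence of a one-form `α` is `tr ∇α - ⟨dφ, α⟩`. -/
theorem sum_pd_density_mul_sharp (hG : IsMetricFamily Ω G) (hφ : JointlySmoothOn Ω φ)
    (hz : (s, y) ∈ Ω) {α : Fin n → EuclideanSpace ℝ (Fin n) → ℝ}
    (hα : ∀ k, DifferentiableAt ℝ (α k) y) :
    ∑ k, pd k (fun x => densityCoord (G s x) (φ s x) * sharp (G s x) (fun l => α l x) k) y =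
      densityCoord (G s y) (φ s y) *
        ((∑ k, ∑ l, (G s y)⁻¹ k l * (pd k (α l) y - ∑ m, christoffel (G s) m k l y * α m y))
          - ∑ k, ∑ l, (G s y)⁻¹ k l * pd k (φ s) y * α l y) := by
  have hinv := fun i j => (hG.inv_smooth i j).differentiableAt hG.isOpen hz
  rw [hG.sum_pd_density_mul hφ hz (V := fun k x => sharp (G s x) (fun l => α l x) k) fun k =>
    differentiableAt_sum_mul (fun l => hinv k l) hα]
  congr 1
  have h1 : ∀ k, pd k (fun x => sharp (G s x) (fun l => α l x) k) y =
      ∑ l, (-(∑ m, (christoffel (G s) k k m y * (G s y)⁻¹ m l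
          + christoffel (G s) l k m y * (G s y)⁻¹ k m)) * α l y
          + (G s y)⁻¹ k l * pd k (α l) y) := by
    intro k
    refine (pd_sum_mul (fun l => hinv k l) hα k).trans ?_
    exact Finset.sum_congr rfl fun l _ => by rw [hG.pd_inv hz]
  have b1 : ∑ k, ∑ l, ∑ m, christoffel (G s) k k m y * (G s y)⁻¹ m l * α l y =
      ∑ k, ∑ l, ∑ m, christoffel (G s) m m k y * ((G s y)⁻¹ k l * α l y) :=
    sum_reindex_three (fun (k, l, m) => (m, l, k)) (fun (k, l, m) => (m, l, k)) (fun _ => rfl)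
      (fun _ => rfl) fun _ _ _ => by dsimp only; ring
  have b2 : ∑ k, ∑ l, ∑ m, christoffel (G s) l k m y * (G s y)⁻¹ k m * α l y =
      ∑ k, ∑ l, ∑ m, (G s y)⁻¹ k l * (christoffel (G s) m k l y * α m y) :=
    sum_reindex_three (fun (k, l, m) => (k, m, l)) (fun (k, l, m) => (k, m, l)) (fun _ => rfl)
      (fun _ => rfl) fun _ _ _ => by dsimp only; ring
  simp only [h1]
  simp only [sharp, mul_sub, add_mul, neg_mul, neg_add, Finset.sum_add_distrib,
    Finset.sum_sub_distrib, Finset.sum_neg_distrib, Finset.mul_sum, Finset.sum_mul]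
    at b1 b2 ⊢
  have b3 : ∑ k, ∑ l, pd k (φ s) y * ((G s y)⁻¹ k l * α l y) =
      ∑ k, ∑ l, (G s y)⁻¹ k l * pd k (φ s) y * α l y :=
    Finset.sum_congr rfl fun k _ => Finset.sum_congr rfl fun l _ => by ring
  linear_combination -b1 - b2 - b3

end IsMetricFamily

end Variation

/-! ### The first variation of the energy density -/

section FirstVariation

variable {n : ℕ}

theorem innerCoord_eq_sum {A : Matrix (Fin n) (Fin n) ℝ} (hA : ∀ i j, A⁻¹ i j = A⁻¹ j i)
    (T U : Matrix (Fin n) (Fin n) ℝ) :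
    innerCoord A T U = ∑ i, ∑ j, (A⁻¹ * U * A⁻¹) i j * T i j := by
  unfold innerCoord
  refine sum_congr_two fun i j => ?_
  rw [Matrix.mul_assoc]
  simp only [Matrix.mul_apply, Finset.sum_mul, Finset.mul_sum]
  exact sum_congr_two fun a b => by rw [hA b j]; ring

theorem innerCoord_add (A T T' U : Matrix (Fin n) (Fin n) ℝ) :
    innerCoord A (T + T') U = innerCoord A T U + innerCoord A T' U := by
  simp [innerCoord, mul_add, add_mul, Finset.sum_add_distrib]

theorem innerCoord_smul (c : ℝ) (A T U : Matrix (Fin n) (Fin n) ℝ) :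
    innerCoord A (c • T) U = c * innerCoord A T U := by
  simp only [innerCoord, Finset.mul_sum, Matrix.smul_apply, smul_eq_mul]
  exact sum_congr_two fun i j => sum_congr_two fun a b => by ring

theorem innerCoord_sub (A T T' U : Matrix (Fin n) (Fin n) ℝ) :
    innerCoord A (T - T') U = innerCoord A T U - innerCoord A T' U := by
  simp [innerCoord, mul_sub, sub_mul, Finset.sum_sub_distrib]

/-- Contraction with the metric is the trace: `⟨g, U⟩ = tr_g U`. -/
theorem innerCoord_self {A : Matrix (Fin n) (Fin n) ℝ} (hA : ∀ i j, A⁻¹ i j = A⁻¹ j i)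
    (hA' : ∀ i j, A i j = A j i) (h0 : A.det ≠ 0) (U : Matrix (Fin n) (Fin n) ℝ) :
    innerCoord A A U = traceCoord A U := by
  have hu := isUnit_iff_ne_zero.2 h0
  have h1 : ∀ B : Matrix (Fin n) (Fin n) ℝ, ∑ i, ∑ j, B i j * A i j = (B * A).trace := by
    intro B
    simp only [Matrix.trace, Matrix.diag_apply, Matrix.mul_apply]
    exact sum_congr_two fun i j => by rw [hA' i j]
  rw [innerCoord_eq_sum hA, h1, Matrix.mul_assoc, Matrix.nonsing_inv_mul _ hu, Matrix.mul_one]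
  simp only [Matrix.trace, Matrix.diag_apply, Matrix.mul_apply, traceCoord]
  rw [Finset.sum_comm]
  exact sum_congr_two fun i j => by rw [hA]

theorem traceCoord_add (A T T' : Matrix (Fin n) (Fin n) ℝ) :
    traceCoord A (T + T') = traceCoord A T + traceCoord A T' := by
  simp [traceCoord, mul_add, Finset.sum_add_distrib]

theorem traceCoord_sub (A T T' : Matrix (Fin n) (Fin n) ℝ) :
    traceCoord A (T - T') = traceCoord A T - traceCoord A T' := by
  simp [traceCoord, mul_sub, Finset.sum_sub_distrib]

theorem traceCoord_smul (c : ℝ) (A T : Matrix (Fin n) (Fin n) ℝ) :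
    traceCoord A (c • T) = c * traceCoord A T := by
  simp only [traceCoord, Finset.mul_sum, Matrix.smul_apply, smul_eq_mul]
  exact sum_congr_two fun i j => by ring

theorem sum_mul_sharp {A : Matrix (Fin n) (Fin n) ℝ} (h0 : A.det ≠ 0) (α : Fin n → ℝ)
    (k : Fin n) : ∑ m, A k m * sharp A α m = α k := by
  have : A.mulVec (A⁻¹.mulVec α) = α := by
    rw [Matrix.mulVec_mulVec, Matrix.mul_nonsing_inv _ (isUnit_iff_ne_zero.2 h0),
      Matrix.one_mulVec]
  exact congrFun this k

/-- The matrix of `df ⊗ df` in coordinates. -/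
def diffSqCoord (f : EuclideanSpace ℝ (Fin n) → ℝ) (y : EuclideanSpace ℝ (Fin n)) :
    Matrix (Fin n) (Fin n) ℝ :=
  Matrix.of fun i j => pd i f y * pd j f y

/-- The one-form `i_{∇φ} h - (tr h) dφ`, for `h = ∂g/∂s`. -/
def contractionForm (G : ℝ → EuclideanSpace ℝ (Fin n) → Matrix (Fin n) (Fin n) ℝ)
    (φ : ℝ → EuclideanSpace ℝ (Fin n) → ℝ) (s : ℝ) (l : Fin n) (y : EuclideanSpace ℝ (Fin n)) :
    ℝ :=
  (∑ a, metricVar G s y l a * sharp (G s y) (fun b => pd b (φ s) y) a) -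
    traceCoord (G s y) (metricVar G s y) * pd l (φ s) y

namespace IsMetricFamily

variable {Ω : Set (ℝ × EuclideanSpace ℝ (Fin n))}
  {G : ℝ → EuclideanSpace ℝ (Fin n) → Matrix (Fin n) (Fin n) ℝ}
  {φ : ℝ → EuclideanSpace ℝ (Fin n) → ℝ} {s : ℝ} {y : EuclideanSpace ℝ (Fin n)}

theorem traceCoord_smooth (hG : IsMetricFamily Ω G)
    {T : ℝ → EuclideanSpace ℝ (Fin n) → Matrix (Fin n) (Fin n) ℝ}
    (hT : ∀ i j, JointlySmoothOn Ω fun s y => T s y i j) :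
    JointlySmoothOn Ω fun s y => traceCoord (G s y) (T s y) :=
  JointlySmoothOn.sum fun i => JointlySmoothOn.sum fun j => (hG.inv_smooth i j).mul (hT i j)

theorem sharp_smooth (hG : IsMetricFamily Ω G) {α : Fin n → ℝ → EuclideanSpace ℝ (Fin n) → ℝ}
    (hα : ∀ i, JointlySmoothOn Ω (α i)) (k : Fin n) :
    JointlySmoothOn Ω fun s y => sharp (G s y) (fun l => α l s y) k :=
  JointlySmoothOn.sum fun l => (hG.inv_smooth k l).mul (hα l)

theorem contractionForm_smooth (hG : IsMetricFamily Ω G) (hφ : JointlySmoothOn Ω φ) (l : Fin n) :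
    JointlySmoothOn Ω fun s y => contractionForm G φ s l y :=
  (JointlySmoothOn.sum fun a => (hG.metricVar_smooth l a).mul
    (hG.sharp_smooth (α := fun b s y => WeightedMeasure.pd b (φ s) y)
      (fun b => hφ.pd hG.isOpen b) a)).sub
    ((hG.traceCoord_smooth hG.metricVar_smooth).mul (hφ.pd hG.isOpen l))

/-- The variation of the connection, with its upper index lowered. -/
theorem sum_mul_christoffelVar (hG : IsMetricFamily Ω G) (hz : (s, y) ∈ Ω) (m i j : Fin n) :
    ∑ k, G s y m k * christoffelVar G s k i j y =
      (1 / 2) * (pd i (fun x => metricVar G s x j m) y + pd j (fun x => metricVar G s x i m) y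
        - pd m (fun x => metricVar G s x i j) y)
      - ∑ k, metricVar G s y m k * christoffel (G s) k i j y := by
  have h1 : HasDerivAt (fun t => ∑ k, G t y m k * christoffel (G t) k i j y)
      (∑ k, (metricVar G s y m k * christoffel (G s) k i j y
        + G s y m k * christoffelVar G s k i j y)) s :=
    HasDerivAt.fun_sum fun k _ => (hG.hasDerivAt_metric hz m k).mul
      (hG.hasDerivAt_christoffel hz k i j)
  have h2 : HasDerivAt (fun t => ∑ k, G t y m k * christoffel (G t) k i j y)
      ((1 / 2) * (pd i (fun x => metricVar G s x j m) y + pd j (fun x => metricVar G s x i m) y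
        - pd m (fun x => metricVar G s x i j) y)) s := by
    refine HasDerivAt.congr_of_eventuallyEq ?_ ((hG.eventually_mem_time hz).mono fun t ht =>
      hG.sum_mul_christoffel ht m i j)
    exact ((((hG.smooth j m).deriv_pd hG.isOpen hz i).add
      ((hG.smooth i m).deriv_pd hG.isOpen hz j)).sub
      ((hG.smooth i j).deriv_pd hG.isOpen hz m)).const_mul _
  have h3 := h1.unique h2
  rw [Finset.sum_add_distrib] at h3
  linarith

/-- The variation of `e^{-φ} dvol` is `((1/2) tr h - ψ) e^{-φ} dvol`. -/
theorem hasDerivAt_density (hG : IsMetricFamily Ω G) (hφ : JointlySmoothOn Ω φ)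
    (hz : (s, y) ∈ Ω) :
    HasDerivAt (fun t => densityCoord (G t y) (φ t y)) (densityCoord (G s y) (φ s y) *
      ((1 / 2) * traceCoord (G s y) (metricVar G s y) - deriv (fun t => φ t y) s)) s := by
  refine (hasDerivAt_densityCoord (hG.hasDerivAt_metric hz)
    (hφ.hasDerivAt hG.isOpen hz) (hG.det_pos s y hz)).congr_deriv ?_
  congr 3
  exact sum_congr_two fun i j => by rw [hG.metricVar_symm hz]

theorem density_pos (hG : IsMetricFamily Ω G) (hz : (s, y) ∈ Ω) (t : ℝ) :
    0 < densityCoord (G s y) t :=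
  mul_pos (Real.sqrt_pos.2 (hG.det_pos s y hz)) (Real.exp_pos _)

/-- The trace of the variation of the connection is `C^l_lk = (1/2) ∂_k tr h`; it is the
variation of `∂_k log √det g`. -/
theorem sum_christoffelVar (hG : IsMetricFamily Ω G) (hz : (s, y) ∈ Ω) (k : Fin n) :
    ∑ l, christoffelVar G s l l k y =
      (1 / 2) * pd k (fun x => traceCoord (G s x) (metricVar G s x)) y := by
  have h0 : JointlySmoothOn Ω (fun (_ : ℝ) (_ : EuclideanSpace ℝ (Fin n)) => (0 : ℝ)) :=
    JointlySmoothOn.const 0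
  have hw := hG.density_smooth h0
  have hτ := (hG.traceCoord_smooth hG.metricVar_smooth).differentiableAt hG.isOpen hz
  have h1 := hw.deriv_pd hG.isOpen hz k
  have h2 : HasDerivAt (fun t => pd k (fun x => densityCoord (G t x) 0) y)
      (densityCoord (G s y) 0 * ((1 / 2) * traceCoord (G s y) (metricVar G s y))
          * (∑ l, christoffel (G s) l l k y)
        + densityCoord (G s y) 0 * ∑ l, christoffelVar G s l l k y) s := by
    refine HasDerivAt.congr_of_eventuallyEq (f := fun t => densityCoord (G t y) 0 *
      ∑ l, christoffel (G t) l l k y) ?_ ((hG.eventually_mem_time hz).mono fun t ht => ?_)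
    · refine (((hG.hasDerivAt_density h0 hz)).mul
        (HasDerivAt.fun_sum fun l _ => hG.hasDerivAt_christoffel hz l l k)).congr_deriv ?_
      simp
    · simpa [pd_const] using hG.pd_density h0 ht k
  have h3 : pd k (fun x => deriv (fun t => densityCoord (G t x) 0) s) y =
      densityCoord (G s y) 0 * (∑ l, christoffel (G s) l l k y) *
        ((1 / 2) * traceCoord (G s y) (metricVar G s y)) + densityCoord (G s y) 0 *
        ((1 / 2) * pd k (fun x => traceCoord (G s x) (metricVar G s x)) y) := by
    rw [pd_congr (g := fun x => densityCoord (G s x) 0 *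
      ((1 / 2) * traceCoord (G s x) (metricVar G s x)))
      ((hG.eventually_mem hz).mono fun x hx => by
        simpa using (hG.hasDerivAt_density h0 hx).deriv)]
    rw [pd_mul (hw.differentiableAt hG.isOpen hz) (hτ.const_mul _), hG.pd_density h0 hz,
      pd_mul (by fun_prop) hτ, pd_const, pd_const]
    ring
  have h4 := h1.unique h2
  rw [h3] at h4
  have hpos := hG.density_pos hz 0
  have h5 : densityCoord (G s y) 0 * (∑ l, christoffelVar G s l l k y -
      (1 / 2) * pd k (fun x => traceCoord (G s x) (metricVar G s x)) y) = 0 := by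
    linear_combination -h4
  linarith [(mul_eq_zero.1 h5).resolve_left hpos.ne']

/-- The derivative of `tr h`, with the derivatives of the inverse metric expressed through the
Christoffel symbols. -/
theorem pd_trace (hG : IsMetricFamily Ω G) (hz : (s, y) ∈ Ω) (m : Fin n) :
    pd m (fun x => traceCoord (G s x) (metricVar G s x)) y =
      (∑ i, ∑ j, (G s y)⁻¹ i j * pd m (fun x => metricVar G s x i j) y) -
        2 * ∑ i, ∑ j, ∑ b, christoffel (G s) i m b y * (G s y)⁻¹ b j * metricVar G s y i j := by
  have hinv := fun i j => (hG.inv_smooth i j).differentiableAt hG.isOpen hz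
  have hh := fun i j => (hG.metricVar_smooth i j).differentiableAt hG.isOpen hz
  refine (pd_sum_sum_mul hinv hh m).trans ?_
  have b1 : ∑ i, ∑ j, ∑ b, christoffel (G s) j m b y * (G s y)⁻¹ i b * metricVar G s y i j =
      ∑ i, ∑ j, ∑ b, christoffel (G s) i m b y * (G s y)⁻¹ b j * metricVar G s y i j :=
    sum_reindex_three (fun (i, j, b) => (j, i, b)) (fun (i, j, b) => (j, i, b)) (fun _ => rfl)
      (fun _ => rfl) fun i j b => by
        dsimp only; rw [hG.inv_symm hz i b, hG.metricVar_symm hz i j]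
  simp only [hG.pd_inv hz, add_mul, neg_mul, neg_add, Finset.sum_add_distrib,
    Finset.sum_neg_distrib, Finset.sum_mul]
  linear_combination -b1

/-- The covariant derivative of the gradient of `φ`. -/
theorem pd_sharp (hG : IsMetricFamily Ω G) (hφ : JointlySmoothOn Ω φ) (hz : (s, y) ∈ Ω)
    (k a : Fin n) :
    pd k (fun x => sharp (G s x) (fun b => pd b (φ s) x) a) y =
      (∑ b, (G s y)⁻¹ a b * hessianCoord (G s) (φ s) y k b) -
        ∑ l, christoffel (G s) a k l y * sharp (G s y) (fun b => pd b (φ s) y) l := by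
  have hinv := fun i j => (hG.inv_smooth i j).differentiableAt hG.isOpen hz
  have hp := fun i => (hφ.pd hG.isOpen i).differentiableAt hG.isOpen hz
  refine (pd_sum_mul (fun b => hinv a b) hp k).trans ?_
  have b1 : ∑ b, ∑ l, christoffel (G s) b k l y * (G s y)⁻¹ a l * pd b (φ s) y =
      ∑ b, ∑ m, (G s y)⁻¹ a b * (christoffel (G s) m k b y * pd m (φ s) y) := by
    rw [Finset.sum_comm]
    exact sum_congr_two fun i j => by ring
  have b2 : ∑ b, ∑ l, christoffel (G s) a k l y * (G s y)⁻¹ l b * pd b (φ s) y =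
      ∑ l, ∑ b, christoffel (G s) a k l y * ((G s y)⁻¹ l b * pd b (φ s) y) := by
    rw [Finset.sum_comm]
    exact sum_congr_two fun i j => by ring
  simp only [hG.pd_inv hz, hessianCoord, sharp, Matrix.of_apply, mul_sub, add_mul, neg_mul,
    neg_add, Finset.sum_add_distrib, Finset.sum_sub_distrib, Finset.sum_neg_distrib,
    Finset.sum_mul, Finset.mul_sum]
  linear_combination -b1 - b2

end IsMetricFamily

end FirstVariation

section SecondContraction

variable {ι : Type*} [Fintype ι]

/-- The pointwise identity behind the second integration by parts. Here `g` is the inverse of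
the metric `A`, `h` the variation of the metric with derivatives `dh`, `f` the gradient of `φ`,
`p = dφ`, `q` the second partial derivatives and `H` the Hessian of `φ`, `τ = tr h` with
derivatives `t`, `C` the variation of the connection `Γ`. The left-hand side is `⟨dφ, Y⟩` for
the vector field `Y^k = g^ij C^k_ij - g^ik C^l_il`; the first line of the right-hand side is the
weighted divergence of `ζ = i_f h - τ p`. -/
theorem gradient_contraction {g A h q H : ι → ι → ℝ} {Γ C dh : ι → ι → ι → ℝ} {f p t : ι → ℝ}
    {τ : ℝ} (hg : ∀ i j, g i j = g j i) (hh : ∀ i j, h i j = h j i)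
    (hΓ : ∀ k i j, Γ k i j = Γ k j i)
    (hp : ∀ k, p k = ∑ m, f m * A m k) (hf : ∀ k, f k = ∑ l, g k l * p l)
    (hC : ∀ m i j, ∑ k, A m k * C k i j =
      (1 / 2) * (dh i j m + dh j i m - dh m i j) - ∑ k, h m k * Γ k i j)
    (ht : ∀ m, t m = (∑ i, ∑ j, g i j * dh m i j) - 2 * ∑ i, ∑ j, ∑ b, Γ i m b * g b j * h i j)
    (htC : ∀ i, ∑ l, C l i l = (1 / 2) * t i) (hH : ∀ k l, H k l = q k l - ∑ m, Γ m k l * p m) :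
    ∑ k, p k * ((∑ i, ∑ j, g i j * C k i j) - ∑ i, g i k * ∑ l, C l i l) =
      (∑ k, ∑ l, g k l * (((∑ a, (dh k l a * f a
            + h l a * ((∑ b, g a b * H k b) - ∑ c, Γ a k c * f c))) - (t k * p l + τ * q k l))
          - ∑ m, Γ m k l * ((∑ a, h m a * f a) - τ * p m)))
        - (∑ k, ∑ l, g k l * p k * ((∑ a, h l a * f a) - τ * p l))
      - (∑ k, ∑ l, ∑ a, ∑ b, g k l * (h l a * (g a b * H k b)))
      + (∑ l, ∑ a, h l a * f a * f l)
      + τ * ((∑ k, ∑ l, g k l * H k l) - ∑ k, ∑ l, g k l * (p k * p l)) := by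
  have s1 : ∑ k, p k * ∑ i, ∑ j, g i j * C k i j =
      ∑ i, ∑ j, ∑ m, g i j * f m *
        ((1 / 2) * (dh i j m + dh j i m - dh m i j) - ∑ k, h m k * Γ k i j) := by
    simp only [← hC]
    simp only [hp, Finset.mul_sum, Finset.sum_mul]
    exact sum_reindex_four (fun (k, i, j, m) => (i, j, m, k)) (fun (i, j, m, k) => (k, i, j, m))
      (fun _ => rfl) (fun _ => rfl) fun k i j m => by dsimp only; ring
  have s2 : ∑ k, p k * ∑ i, g i k * ∑ l, C l i l = (1 / 2) * ∑ i, f i * t i := by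
    simp only [htC, hf, Finset.mul_sum, Finset.sum_mul]
    rw [Finset.sum_comm]
    exact sum_congr_two fun i j => by ring
  have s3 : ∑ i, ∑ j, ∑ m, g i j * f m * dh j i m = ∑ i, ∑ j, ∑ m, g i j * f m * dh i j m :=
    sum_reindex_three (fun (i, j, m) => (j, i, m)) (fun (i, j, m) => (j, i, m))
      (fun _ => rfl) (fun _ => rfl) fun i j m => by dsimp only; rw [hg i j]
  have s4 : ∑ m, f m * t m = (∑ i, ∑ j, ∑ m, g i j * f m * dh m i j) -
      2 * ∑ i, ∑ j, ∑ m, ∑ b, g i j * f m * (Γ b i m * h b j) := by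
    simp only [ht, mul_sub, Finset.sum_sub_distrib, Finset.mul_sum]
    congr 1
    · exact sum_reindex_three (fun (m, i, j) => (i, j, m)) (fun (i, j, m) => (m, i, j))
        (fun _ => rfl) (fun _ => rfl) fun m i j => by dsimp only; ring
    · exact sum_reindex_four (fun (m, i, j, b) => (b, j, m, i)) (fun (b, j, m, i) => (m, i, j, b))
        (fun _ => rfl) (fun _ => rfl) fun m i j b => by dsimp only; rw [hΓ i m b]; ring
  have r1 : ∑ k, ∑ l, ∑ a, g k l * (dh k l a * f a) = ∑ i, ∑ j, ∑ m, g i j * f m * dh i j m :=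
    Finset.sum_congr rfl fun k _ => sum_congr_two fun l a => by ring
  have r2 : ∑ k, ∑ l, ∑ a, ∑ c, g k l * (h l a * (Γ a k c * f c)) =
      ∑ i, ∑ j, ∑ m, ∑ b, g i j * f m * (Γ b i m * h b j) :=
    sum_reindex_four (fun (k, l, a, c) => (k, l, c, a)) (fun (k, l, c, a) => (k, l, a, c))
      (fun _ => rfl) (fun _ => rfl) fun k l a c => by dsimp only; rw [hh l a]; ring
  have r3 : ∑ k, ∑ l, g k l * (t k * p l) = ∑ m, f m * t m := by
    simp only [hf, Finset.sum_mul]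
    exact sum_congr_two fun i j => by ring
  have r4 : ∑ k, ∑ l, ∑ m, ∑ a, g k l * (Γ m k l * (h m a * f a)) =
      ∑ i, ∑ j, ∑ m, ∑ k, g i j * f m * (h m k * Γ k i j) :=
    sum_reindex_four (fun (k, l, m, a) => (k, l, a, m)) (fun (k, l, a, m) => (k, l, m, a))
      (fun _ => rfl) (fun _ => rfl) fun k l m a => by dsimp only; rw [hh m a]; ring
  have r5 : ∑ k, ∑ l, ∑ a, g k l * p k * (h l a * f a) = ∑ l, ∑ a, h l a * f a * f l := by
    have : ∀ l a, h l a * f a * f l = ∑ k, g k l * p k * (h l a * f a) := by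
      intro l a
      conv_lhs => rw [hf l, Finset.mul_sum]
      exact Finset.sum_congr rfl fun k _ => by rw [hg l k]; ring
    simp only [this]
    exact sum_reindex_three (fun (k, l, a) => (l, a, k)) (fun (l, a, k) => (k, l, a))
      (fun _ => rfl) (fun _ => rfl) fun _ _ _ => rfl
  have s5 : ∑ i, ∑ j, ∑ m, g i j * f m *
        ((1 / 2) * (dh i j m + dh j i m - dh m i j) - ∑ k, h m k * Γ k i j) =
      (1 / 2) * ((∑ i, ∑ j, ∑ m, g i j * f m * dh i j m)
        + (∑ i, ∑ j, ∑ m, g i j * f m * dh j i m) - ∑ i, ∑ j, ∑ m, g i j * f m * dh m i j)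
      - ∑ i, ∑ j, ∑ m, ∑ k, g i j * f m * (h m k * Γ k i j) := by
    simp only [Finset.mul_sum, ← Finset.sum_add_distrib, ← Finset.sum_sub_distrib]
    refine Finset.sum_congr rfl fun i _ => sum_congr_two fun j m => ?_
    rw [← Finset.mul_sum]
    ring
  have r6 : ∑ k, ∑ l, g k l * H k l =
      (∑ k, ∑ l, g k l * q k l) - ∑ k, ∑ l, ∑ m, g k l * (Γ m k l * p m) := by
    simp only [hH, mul_sub, Finset.sum_sub_distrib, Finset.mul_sum]
  have r7 : ∑ k, ∑ l, g k l * (τ * q k l) = τ * ∑ k, ∑ l, g k l * q k l := by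
    simp only [Finset.mul_sum]
    exact sum_congr_two fun i j => by ring
  have r8 : ∑ k, ∑ l, ∑ m, g k l * (Γ m k l * (τ * p m)) =
      τ * ∑ k, ∑ l, ∑ m, g k l * (Γ m k l * p m) := by
    simp only [Finset.mul_sum]
    exact Finset.sum_congr rfl fun _ _ => sum_congr_two fun i j => by ring
  have r9 : ∑ k, ∑ l, g k l * p k * (τ * p l) = τ * ∑ k, ∑ l, g k l * (p k * p l) := by
    simp only [Finset.mul_sum]
    exact sum_congr_two fun i j => by ring
  rw [s5, s3] at s1
  rw [show ∑ k, p k * ((∑ i, ∑ j, g i j * C k i j) - ∑ i, g i k * ∑ l, C l i l) =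
    (∑ k, p k * ∑ i, ∑ j, g i j * C k i j) - ∑ k, p k * ∑ i, g i k * ∑ l, C l i l by
    simp only [mul_sub, Finset.sum_sub_distrib], s1, s2, r6]
  have e1 : ∑ k, ∑ l, g k l * (((∑ a, (dh k l a * f a
        + h l a * ((∑ b, g a b * H k b) - ∑ c, Γ a k c * f c))) - (t k * p l + τ * q k l))
          - ∑ m, Γ m k l * ((∑ a, h m a * f a) - τ * p m)) =
      (∑ k, ∑ l, ∑ a, g k l * (dh k l a * f a))
      + ((∑ k, ∑ l, ∑ a, ∑ b, g k l * (h l a * (g a b * H k b)))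
        - ∑ k, ∑ l, ∑ a, ∑ c, g k l * (h l a * (Γ a k c * f c)))
      - ((∑ k, ∑ l, g k l * (t k * p l)) + ∑ k, ∑ l, g k l * (τ * q k l))
      - ((∑ k, ∑ l, ∑ m, ∑ a, g k l * (Γ m k l * (h m a * f a)))
        - ∑ k, ∑ l, ∑ m, g k l * (Γ m k l * (τ * p m))) := by
    simp only [mul_add, mul_sub, Finset.sum_add_distrib, Finset.sum_sub_distrib, Finset.mul_sum]
  have e2 : ∑ k, ∑ l, g k l * p k * ((∑ a, h l a * f a) - τ * p l) =
      (∑ k, ∑ l, ∑ a, g k l * p k * (h l a * f a)) - ∑ k, ∑ l, g k l * p k * (τ * p l) := by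
    simp only [mul_sub, Finset.sum_sub_distrib, Finset.mul_sum]
  rw [e1, e2]
  rw [r1, r2, r3, r4, r5, r7, r8, r9]
  linear_combination (1 / 2) * s4

end SecondContraction

section FirstVariation

variable {n : ℕ}

/-- The weighted scalar curvature `R + 2Δφ - (1 + κ)|∇φ|²` in coordinates. -/
def weightedScalarCoord (κ : ℝ) (G : EuclideanSpace ℝ (Fin n) → Matrix (Fin n) (Fin n) ℝ)
    (f : EuclideanSpace ℝ (Fin n) → ℝ) (y : EuclideanSpace ℝ (Fin n)) : ℝ :=
  traceCoord (G y) (ricciCoord G y) + 2 * traceCoord (G y) (hessianCoord G f y)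
    - (1 + κ) * traceCoord (G y) (diffSqCoord f y)

/-- The weighted Laplacian `Δ_φ φ` in coordinates. -/
def weightedLaplacianCoord (G : EuclideanSpace ℝ (Fin n) → Matrix (Fin n) (Fin n) ℝ)
    (f : EuclideanSpace ℝ (Fin n) → ℝ) (y : EuclideanSpace ℝ (Fin n)) : ℝ :=
  traceCoord (G y) (hessianCoord G f y) - traceCoord (G y) (diffSqCoord f y)

/-- The Bakry-Émery Ricci tensor `Ric + ∇²φ - κ dφ ⊗ dφ` in coordinates. -/
def bakryEmeryCoord (κ : ℝ) (G : EuclideanSpace ℝ (Fin n) → Matrix (Fin n) (Fin n) ℝ)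
    (f : EuclideanSpace ℝ (Fin n) → ℝ) (y : EuclideanSpace ℝ (Fin n)) :
    Matrix (Fin n) (Fin n) ℝ :=
  ricciCoord G y + hessianCoord G f y - κ • diffSqCoord f y

/-- The Euler-Lagrange integrand of the functional `∫ (R_φ + P(φ)) e^{-φ} dvol`, paired with
a variation `(h, ψ)`; here `p` and `p'` are the values of `P(φ)` and `P'(φ)`. -/
def eulerCoord (κ p p' : ℝ) (G : EuclideanSpace ℝ (Fin n) → Matrix (Fin n) (Fin n) ℝ)
    (f : EuclideanSpace ℝ (Fin n) → ℝ) (h : Matrix (Fin n) (Fin n) ℝ) (ψ : ℝ)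
    (y : EuclideanSpace ℝ (Fin n)) : ℝ :=
  -innerCoord (G y) (bakryEmeryCoord κ G f y - (κ * weightedLaplacianCoord G f y) • G y) h
    - (weightedScalarCoord κ G f y - 2 * κ * weightedLaplacianCoord G f y + p)
      * (ψ - (1 / 2) * traceCoord (G y) h) + p' * ψ

/-- The gradient `g^kl ∂_l φ`. -/
def gradCoord (G : ℝ → EuclideanSpace ℝ (Fin n) → Matrix (Fin n) (Fin n) ℝ)
    (φ : ℝ → EuclideanSpace ℝ (Fin n) → ℝ) (s : ℝ) (k : Fin n) (y : EuclideanSpace ℝ (Fin n)) :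
    ℝ := sharp (G s y) (fun l => pd l (φ s) y) k

/-- The vector density whose divergence is the difference between the variation of the energy
density and the Euler-Lagrange integrand. -/
def fluxDensity (κ : ℝ) (G : ℝ → EuclideanSpace ℝ (Fin n) → Matrix (Fin n) (Fin n) ℝ)
    (φ : ℝ → EuclideanSpace ℝ (Fin n) → ℝ) (s : ℝ) (k : Fin n) (y : EuclideanSpace ℝ (Fin n)) :
    ℝ :=
  densityCoord (G s y) (φ s y) * (palatiniField G s k y
    + sharp (G s y) (fun l => contractionForm G φ s l y) k
    + 2 * (1 - κ) * sharp (G s y) (fun l => deriv (fun t => φ t y) s * pd l (φ s) y) k)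
  + 2 * deriv (fun t => densityCoord (G t y) (φ t y) * gradCoord G φ t k y) s

namespace IsMetricFamily

variable {Ω : Set (ℝ × EuclideanSpace ℝ (Fin n))}
  {G : ℝ → EuclideanSpace ℝ (Fin n) → Matrix (Fin n) (Fin n) ℝ}
  {φ : ℝ → EuclideanSpace ℝ (Fin n) → ℝ} {s : ℝ} {y : EuclideanSpace ℝ (Fin n)}

theorem gradCoord_smooth (hG : IsMetricFamily Ω G) (hφ : JointlySmoothOn Ω φ) (k : Fin n) :
    JointlySmoothOn Ω fun s y => gradCoord G φ s k y :=
  hG.sharp_smooth (α := fun l s y => WeightedMeasure.pd l (φ s) y)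
    (fun l => hφ.pd hG.isOpen l) k

theorem gradDensity_smooth (hG : IsMetricFamily Ω G) (hφ : JointlySmoothOn Ω φ) (k : Fin n) :
    JointlySmoothOn Ω fun s y => densityCoord (G s y) (φ s y) * gradCoord G φ s k y :=
  (hG.density_smooth hφ).mul (hG.gradCoord_smooth hφ k)

theorem fluxDensity_smooth (hG : IsMetricFamily Ω G) (hφ : JointlySmoothOn Ω φ) (κ : ℝ)
    (k : Fin n) : JointlySmoothOn Ω fun s y => fluxDensity κ G φ s k y :=
  ((hG.density_smooth hφ).mul (((hG.palatiniField_smooth k).add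
    (hG.sharp_smooth (α := fun l s y => contractionForm G φ s l y)
      (fun l => hG.contractionForm_smooth hφ l) k)).add ((JointlySmoothOn.const _).mul
    (hG.sharp_smooth (α := fun l s y => deriv (fun t => φ t y) s * WeightedMeasure.pd l (φ s) y)
      (fun l => (hφ.deriv hG.isOpen).mul (hφ.pd hG.isOpen l)) k)))).add
  ((JointlySmoothOn.const _).mul ((hG.gradDensity_smooth hφ k).deriv hG.isOpen))

/-- Up to the divergence of `w (i_{∇φ} h - (tr h) dφ)^♯`, the pairing `⟨dφ, Y⟩` with the
vector field of Palatini's identity equals `-⟨∇²φ - dφ ⊗ dφ, h⟩ + (Δ_φ φ) tr h`. -/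
theorem sum_pd_mul_palatiniField (hG : IsMetricFamily Ω G) (hφ : JointlySmoothOn Ω φ)
    (hz : (s, y) ∈ Ω) :
    densityCoord (G s y) (φ s y) * ∑ k, pd k (φ s) y * palatiniField G s k y =
      (∑ k, pd k (fun x => densityCoord (G s x) (φ s x) *
        sharp (G s x) (fun l => contractionForm G φ s l x) k) y)
      + densityCoord (G s y) (φ s y) *
        (-innerCoord (G s y) (hessianCoord (G s) (φ s) y) (metricVar G s y)
          + innerCoord (G s y) (diffSqCoord (φ s) y) (metricVar G s y)
          + traceCoord (G s y) (metricVar G s y) * weightedLaplacianCoord (G s) (φ s) y) := by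
  have hh := fun i j => (hG.metricVar_smooth i j).differentiableAt hG.isOpen hz
  have hp := fun i => (hφ.pd hG.isOpen i).differentiableAt hG.isOpen hz
  have hf := fun i => (hG.gradCoord_smooth hφ i).differentiableAt hG.isOpen hz
  have hτ := (hG.traceCoord_smooth hG.metricVar_smooth).differentiableAt hG.isOpen hz
  have hζ : ∀ k l, pd k (fun x => contractionForm G φ s l x) y =
      (∑ a, (pd k (fun x => metricVar G s x l a) y * gradCoord G φ s a y
        + metricVar G s y l a * ((∑ b, (G s y)⁻¹ a b * hessianCoord (G s) (φ s) y k b)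
          - ∑ c, christoffel (G s) a k c y * gradCoord G φ s c y)))
      - (pd k (fun x => traceCoord (G s x) (metricVar G s x)) y * pd l (φ s) y
        + traceCoord (G s y) (metricVar G s y) * pd k (pd l (φ s)) y) := by
    intro k l
    refine (pd_sub (differentiableAt_sum_mul (fun a => hh l a) hf) (hτ.fun_mul (hp l)) k).trans ?_
    rw [pd_sum_mul (fun a => hh l a) hf, pd_mul hτ (hp l)]
    congr 1
    refine Finset.sum_congr rfl fun a _ => ?_
    congr 2
    exact hG.pd_sharp hφ hz k a
  have hdiv := hG.sum_pd_density_mul_sharp hφ hz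
    (α := fun l x => contractionForm G φ s l x) fun l =>
      (hG.contractionForm_smooth hφ l).differentiableAt hG.isOpen hz
  have hc := gradient_contraction (g := fun i j => (G s y)⁻¹ i j) (A := fun i j => G s y i j)
    (h := fun i j => metricVar G s y i j) (q := fun k l => pd k (pd l (φ s)) y)
    (H := fun k l => hessianCoord (G s) (φ s) y k l) (Γ := fun k i j => christoffel (G s) k i j y)
    (C := fun k i j => christoffelVar G s k i j y)
    (dh := fun k i j => pd k (fun x => metricVar G s x i j) y)
    (f := fun k => gradCoord G φ s k y) (p := fun k => pd k (φ s) y)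
    (t := fun k => pd k (fun x => traceCoord (G s x) (metricVar G s x)) y)
    (τ := traceCoord (G s y) (metricVar G s y))
    (hG.inv_symm hz) (hG.metricVar_symm hz) (hG.christoffel_symm hz)
    (fun k => by
      rw [← sum_mul_sharp (hG.det_ne_zero hz) (fun k => pd k (φ s) y) k]
      exact Finset.sum_congr rfl fun m _ => by rw [hG.symm s y hz k m, mul_comm]; rfl)
    (fun k => rfl) (hG.sum_mul_christoffelVar hz) (hG.pd_trace hz)
    (fun i => by
      rw [← hG.sum_christoffelVar hz i]
      exact Finset.sum_congr rfl fun l _ => hG.christoffelVar_symm hz l i l)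
    (fun k l => rfl)
  have i1 : innerCoord (G s y) (hessianCoord (G s) (φ s) y) (metricVar G s y) =
      ∑ k, ∑ l, ∑ a, ∑ b, (G s y)⁻¹ k l * (metricVar G s y l a * ((G s y)⁻¹ a b *
        hessianCoord (G s) (φ s) y k b)) :=
    sum_reindex_four (fun (i, j, a, b) => (i, a, b, j)) (fun (i, a, b, j) => (i, j, a, b))
      (fun _ => rfl) (fun _ => rfl) fun i j a b => by
        dsimp only; rw [hG.inv_symm hz j b]; ring
  have i2 : innerCoord (G s y) (diffSqCoord (φ s) y) (metricVar G s y) =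
      ∑ l, ∑ a, metricVar G s y l a * gradCoord G φ s a y * gradCoord G φ s l y := by
    have : ∀ l a, metricVar G s y l a * gradCoord G φ s a y * gradCoord G φ s l y =
        ∑ i, ∑ j, (G s y)⁻¹ i l * (G s y)⁻¹ j a * (pd i (φ s) y * pd j (φ s) y) *
          metricVar G s y l a := by
      intro l a
      simp only [gradCoord, sharp, Finset.mul_sum, Finset.sum_mul]
      exact sum_congr_two fun i j => by rw [hG.inv_symm hz l i, hG.inv_symm hz a j]; ring
    simp only [this]
    exact sum_reindex_four (fun (i, j, a, b) => (a, b, i, j)) (fun (a, b, i, j) => (i, j, a, b))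
      (fun _ => rfl) (fun _ => rfl) fun i j a b => rfl
  rw [hdiv, ← mul_add]
  congr 1
  simp only [hζ]
  rw [i1, i2]
  refine hc.trans ?_
  simp only [weightedLaplacianCoord, traceCoord, contractionForm, diffSqCoord, Matrix.of_apply]
  simp only [gradCoord]
  ring

end IsMetricFamily

end FirstVariation

section FirstVariation

variable {n : ℕ}

namespace IsMetricFamily

variable {Ω : Set (ℝ × EuclideanSpace ℝ (Fin n))}
  {G : ℝ → EuclideanSpace ℝ (Fin n) → Matrix (Fin n) (Fin n) ℝ}
  {φ : ℝ → EuclideanSpace ℝ (Fin n) → ℝ} {s : ℝ} {y : EuclideanSpace ℝ (Fin n)}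

/-- The weighted divergence of `∇φ` is `Δ_φ φ`. -/
theorem sum_pd_density_mul_grad (hG : IsMetricFamily Ω G) (hφ : JointlySmoothOn Ω φ)
    (hz : (s, y) ∈ Ω) :
    ∑ k, pd k (fun x => densityCoord (G s x) (φ s x) * gradCoord G φ s k x) y =
      densityCoord (G s y) (φ s y) * weightedLaplacianCoord (G s) (φ s) y := by
  refine (hG.sum_pd_density_mul_sharp hφ hz (α := fun l x => pd l (φ s) x) fun l =>
    (hφ.pd hG.isOpen l).differentiableAt hG.isOpen hz).trans ?_
  simp only [weightedLaplacianCoord, traceCoord, hessianCoord, diffSqCoord, Matrix.of_apply,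
    mul_assoc]

/-- The weighted divergence of `ψ ∇φ` is `⟨∇ψ, ∇φ⟩ + ψ Δ_φ φ`. -/
theorem sum_pd_density_mul_smul_grad (hG : IsMetricFamily Ω G) (hφ : JointlySmoothOn Ω φ)
    {ψ : EuclideanSpace ℝ (Fin n) → ℝ} (hψ : DifferentiableAt ℝ ψ y) (hz : (s, y) ∈ Ω) :
    ∑ k, pd k (fun x => densityCoord (G s x) (φ s x) *
        sharp (G s x) (fun l => ψ x * pd l (φ s) x) k) y =
      densityCoord (G s y) (φ s y) *
        ((∑ i, ∑ j, (G s y)⁻¹ i j * (pd i ψ y * pd j (φ s) y))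
          + ψ y * weightedLaplacianCoord (G s) (φ s) y) := by
  have hp := fun i => (hφ.pd hG.isOpen i).differentiableAt hG.isOpen hz
  refine (hG.sum_pd_density_mul_sharp hφ hz (α := fun l x => ψ x * pd l (φ s) x) fun l =>
    hψ.fun_mul (hp l)).trans ?_
  congr 1
  have h1 : ∀ k l, pd k (fun x => ψ x * pd l (φ s) x) y - ∑ m, christoffel (G s) m k l y *
      (ψ y * pd m (φ s) y) = pd k ψ y * pd l (φ s) y + ψ y * hessianCoord (G s) (φ s) y k l := by
    intro k l
    rw [pd_mul hψ (hp l)]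
    simp only [hessianCoord, Matrix.of_apply, mul_sub, Finset.mul_sum]
    rw [add_sub_assoc]
    congr 2
    exact Finset.sum_congr rfl fun m _ => by ring
  simp only [h1, weightedLaplacianCoord, traceCoord, diffSqCoord, Matrix.of_apply, mul_add,
    mul_sub, Finset.sum_add_distrib, Finset.mul_sum]
  have h2 : ∑ i, ∑ j, (G s y)⁻¹ i j * (ψ y * hessianCoord (G s) (φ s) y i j) =
      ∑ i, ∑ j, ψ y * ((G s y)⁻¹ i j * hessianCoord (G s) (φ s) y i j) :=
    sum_congr_two fun i j => by ring
  have h3 : ∑ i, ∑ j, (G s y)⁻¹ i j * pd i (φ s) y * (ψ y * pd j (φ s) y) =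
      ∑ i, ∑ j, ψ y * ((G s y)⁻¹ i j * (pd i (φ s) y * pd j (φ s) y)) :=
    sum_congr_two fun i j => by ring
  rw [h2, h3]
  ring

theorem sum_pd_fluxDensity (hG : IsMetricFamily Ω G) (hφ : JointlySmoothOn Ω φ) (κ : ℝ)
    (hz : (s, y) ∈ Ω) :
    ∑ k, pd k (fluxDensity κ G φ s k) y =
      (∑ k, pd k (fun x => densityCoord (G s x) (φ s x) * palatiniField G s k x) y)
      + (∑ k, pd k (fun x => densityCoord (G s x) (φ s x) *
          sharp (G s x) (fun l => contractionForm G φ s l x) k) y)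
      + 2 * (1 - κ) * (∑ k, pd k (fun x => densityCoord (G s x) (φ s x) *
          sharp (G s x) (fun l => deriv (fun t => φ t x) s * pd l (φ s) x) k) y)
      + 2 * ∑ k, pd k (fun x => deriv (fun t => densityCoord (G t x) (φ t x) *
          gradCoord G φ t k x) s) y := by
  rw [Finset.mul_sum, Finset.mul_sum, ← Finset.sum_add_distrib, ← Finset.sum_add_distrib,
    ← Finset.sum_add_distrib]
  refine Finset.sum_congr rfl fun k _ => ?_
  have hw := (hG.density_smooth hφ).differentiableAt hG.isOpen hz
  have h1 := hw.fun_mul ((hG.palatiniField_smooth k).differentiableAt hG.isOpen hz)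
  have h2 := hw.fun_mul ((hG.sharp_smooth (α := fun l s y => contractionForm G φ s l y)
      (fun l => hG.contractionForm_smooth hφ l) k).differentiableAt hG.isOpen hz)
  have h3 := hw.fun_mul ((hG.sharp_smooth
      (α := fun l s y => deriv (fun t => φ t y) s * WeightedMeasure.pd l (φ s) y)
      (fun l => (hφ.deriv hG.isOpen).mul (hφ.pd hG.isOpen l)) k).differentiableAt hG.isOpen hz)
  have h4 := ((hG.gradDensity_smooth hφ k).deriv hG.isOpen).differentiableAt hG.isOpen hz
  have e : fluxDensity κ G φ s k = fun x =>
      densityCoord (G s x) (φ s x) * palatiniField G s k x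
      + densityCoord (G s x) (φ s x) * sharp (G s x) (fun l => contractionForm G φ s l x) k
      + (2 * (1 - κ)) * (densityCoord (G s x) (φ s x) *
          sharp (G s x) (fun l => deriv (fun t => φ t x) s * pd l (φ s) x) k)
      + 2 * deriv (fun t => densityCoord (G t x) (φ t x) * gradCoord G φ t k x) s := by
    funext x
    simp only [fluxDensity]
    ring
  rw [e, pd_add ((h1.fun_add h2).fun_add (h3.const_mul _)) (h4.const_mul _),
    pd_add (h1.fun_add h2) (h3.const_mul _), pd_add h1 h2, pd_mul (by fun_prop) h3,
    pd_mul (by fun_prop) h4, pd_const, pd_const]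
  ring

/-- The derivative of the trace of a family of tensors. -/
theorem hasDerivAt_traceCoord (hG : IsMetricFamily Ω G) (hz : (s, y) ∈ Ω)
    {T : ℝ → Matrix (Fin n) (Fin n) ℝ} {T' : Matrix (Fin n) (Fin n) ℝ}
    (hT : ∀ i j, HasDerivAt (fun t => T t i j) (T' i j) s) :
    HasDerivAt (fun t => traceCoord (G t y) (T t))
      (-innerCoord (G s y) (T s) (metricVar G s y) + traceCoord (G s y) T') s := by
  have h1 : HasDerivAt (fun t => traceCoord (G t y) (T t)) (∑ i, ∑ j,
      (-((G s y)⁻¹ * metricVar G s y * (G s y)⁻¹) i j * T s i j + (G s y)⁻¹ i j * T' i j)) s :=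
    HasDerivAt.fun_sum fun i _ => HasDerivAt.fun_sum fun j _ =>
      (hasDerivAt_matrix_inv (hG.hasDerivAt_metric hz) (hG.det_ne_zero hz) i j).mul (hT i j)
  refine h1.congr_deriv ?_
  rw [innerCoord_eq_sum (hG.inv_symm hz)]
  simp only [neg_mul, Finset.sum_add_distrib, Finset.sum_neg_distrib, traceCoord]

/-- The first variation of the energy density in coordinates: the Euler-Lagrange integrand plus
a divergence. -/
theorem hasDerivAt_energyDensity (hG : IsMetricFamily Ω G) (hφ : JointlySmoothOn Ω φ) (κ : ℝ)
    {P : ℝ → ℝ} (hP : ContDiff ℝ ∞ P) (hz : (s, y) ∈ Ω) :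
    HasDerivAt (fun t => densityCoord (G t y) (φ t y) *
        (weightedScalarCoord κ (G t) (φ t) y + P (φ t y)))
      (densityCoord (G s y) (φ s y) * eulerCoord κ (P (φ s y)) (deriv P (φ s y)) (G s) (φ s)
        (metricVar G s y) (deriv (fun t => φ t y) s) y
        + ∑ k, pd k (fluxDensity κ G φ s k) y) s := by
  set w := densityCoord (G s y) (φ s y) with hw
  set h := metricVar G s y with hh
  set ψ := deriv (fun t => φ t y) s with hψ
  have hψd := (hφ.deriv hG.isOpen).differentiableAt hG.isOpen hz
  have hpt : ∀ i, HasDerivAt (fun t => pd i (φ t) y)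
      (pd i (fun x => deriv (fun t => φ t x) s) y) s := fun i => hφ.deriv_pd hG.isOpen hz i
  have d1 := hG.hasDerivAt_density hφ hz
  have d2 := hG.hasDerivAt_traceCoord hz (T := fun t => ricciCoord (G t) y)
    (T' := Matrix.of fun i j => deriv (fun t => ricciCoord (G t) y i j) s)
    fun i j => (hG.ricci_smooth i j).hasDerivAt hG.isOpen hz
  have d3 := hG.hasDerivAt_traceCoord hz (T := fun t => diffSqCoord (φ t) y)
    (T' := Matrix.of fun i j => pd i (fun x => deriv (fun t => φ t x) s) y * pd j (φ s) y
      + pd i (φ s) y * pd j (fun x => deriv (fun t => φ t x) s) y)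
    fun i j => (hpt i).mul (hpt j)
  have d4 : HasDerivAt (fun t => P (φ t y)) (deriv P (φ s y) * ψ) s :=
    ((hP.differentiable (by simp)) _).hasDerivAt.comp s (hφ.hasDerivAt hG.isOpen hz)
  have d5 : HasDerivAt (fun t => ∑ k, pd k (fun x => densityCoord (G t x) (φ t x) *
      gradCoord G φ t k x) y) (∑ k, pd k (fun x => deriv (fun t => densityCoord (G t x) (φ t x) *
      gradCoord G φ t k x) s) y) s :=
    HasDerivAt.fun_sum fun k _ => (hG.gradDensity_smooth hφ k).deriv_pd hG.isOpen hz k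
  -- The second-order terms in `φ` are traded for first-order ones and a divergence.
  have hL : (fun t => densityCoord (G t y) (φ t y) *
        (weightedScalarCoord κ (G t) (φ t) y + P (φ t y))) =ᶠ[𝓝 s]
      fun t => densityCoord (G t y) (φ t y) * (traceCoord (G t y) (ricciCoord (G t) y)
        + (1 - κ) * traceCoord (G t y) (diffSqCoord (φ t) y) + P (φ t y))
        + 2 * ∑ k, pd k (fun x => densityCoord (G t x) (φ t x) * gradCoord G φ t k x) y := by
    filter_upwards [hG.eventually_mem_time hz] with t ht
    rw [hG.sum_pd_density_mul_grad hφ ht, weightedScalarCoord, weightedLaplacianCoord]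
    ring
  refine HasDerivAt.congr_of_eventuallyEq ?_ hL
  refine ((d1.mul ((d2.add (d3.const_mul (1 - κ))).add d4)).add (d5.const_mul 2)).congr_deriv ?_
  have a1 := hG.sum_inv_mul_deriv_ricci hφ hz
  have a2 := hG.sum_pd_mul_palatiniField hφ hz
  have a3 := hG.sum_pd_density_mul_smul_grad hφ hψd hz
  have a4 : traceCoord (G s y) (Matrix.of fun i j =>
      pd i (fun x => deriv (fun t => φ t x) s) y * pd j (φ s) y
      + pd i (φ s) y * pd j (fun x => deriv (fun t => φ t x) s) y) =
      2 * ∑ i, ∑ j, (G s y)⁻¹ i j * (pd i (fun x => deriv (fun t => φ t x) s) y *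
        pd j (φ s) y) := by
    simp only [traceCoord, Matrix.of_apply, mul_add, Finset.sum_add_distrib, two_mul]
    congr 1
    rw [Finset.sum_comm]
    exact sum_congr_two fun i j => by rw [hG.inv_symm hz j i]; ring
  have a5 : traceCoord (G s y) (Matrix.of fun i j => deriv (fun t => ricciCoord (G t) y i j) s) =
      ∑ i, ∑ j, (G s y)⁻¹ i j * deriv (fun t => ricciCoord (G t) y i j) s := rfl
  have a6 := innerCoord_self (hG.inv_symm hz) (hG.symm s y hz) (hG.det_ne_zero hz)
    (metricVar G s y)
  rw [a4, a5, hG.sum_pd_fluxDensity hφ κ hz]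
  simp only [eulerCoord, bakryEmeryCoord, innerCoord_sub, innerCoord_add, innerCoord_smul,
    weightedScalarCoord]
  simp only [Pi.add_apply]
  simp only [← hw, ← hh, ← hψ] at a1 a2 a3 a6 ⊢
  rw [a6]
  simp only [weightedLaplacianCoord] at a2 a3 ⊢
  linear_combination a1 + a2 - 2 * (1 - κ) * a3

end IsMetricFamily

end FirstVariation

/-! ### Change of coordinates -/

section CoordinateChange

variable {n : ℕ}

theorem fderiv_eq_sum_pd (f : EuclideanSpace ℝ (Fin n) → ℝ) (y w : EuclideanSpace ℝ (Fin n)) :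
    fderiv ℝ f y w = ∑ m, w m * pd m f y := by
  have h : w = ∑ m, w m • (EuclideanSpace.single m (1 : ℝ) : EuclideanSpace ℝ (Fin n)) := by
    ext i
    simp [Pi.single_apply]
  conv_lhs => rw [h]
  simp [pd]

theorem hasFDerivAt_sum_smul {ι F : Type*} [Fintype ι] [NormedAddCommGroup F] [NormedSpace ℝ F]
    {c : ι → EuclideanSpace ℝ (Fin n) → ℝ} {y : EuclideanSpace ℝ (Fin n)}
    (hc : ∀ i, DifferentiableAt ℝ (c i) y) (b : ι → F) :
    HasFDerivAt (fun x => ∑ i, c i x • b i) (∑ i, (fderiv ℝ (c i) y).smulRight (b i)) y :=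
  HasFDerivAt.fun_sum fun i _ => (hc i).hasFDerivAt.smul_const _

theorem hasFDerivAt_clm_apply {E F : Type*} [NormedAddCommGroup E] [NormedSpace ℝ E]
    [NormedAddCommGroup F] [NormedSpace ℝ F] {L : E → E →L[ℝ] F}
    {L' : E →L[ℝ] E →L[ℝ] F} {u : E → E} {u' : E →L[ℝ] E} {y : E}
    (hL : HasFDerivAt L L' y) (hu : HasFDerivAt u u' y) :
    ∃ D : E →L[ℝ] F, HasFDerivAt (fun x => L x (u x)) D y ∧
      ∀ w, D w = L' w (u y) + L y (u' w) := by
  refine ⟨_, hL.clm_apply hu, fun w => ?_⟩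
  simp [add_comm]
theorem hasFDerivAt_comp_apply {E F : Type*} [NormedAddCommGroup E] [NormedSpace ℝ E]
    [NormedAddCommGroup F] [NormedSpace ℝ F] {f : E → F} {f' : E →L[ℝ] F} {g : E → E}
    {g' : E →L[ℝ] E} {y : E} (hf : HasFDerivAt f f' (g y)) (hg : HasFDerivAt g g' y) :
    ∃ D : E →L[ℝ] F, HasFDerivAt (fun x => f (g x)) D y ∧ ∀ w, D w = f' (g' w) :=
  ⟨_, hf.comp y hg, fun _ => rfl⟩

theorem hasFDerivAt_bilin_apply {E F : Type*} [NormedAddCommGroup E] [NormedSpace ℝ E]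
    [NormedAddCommGroup F] [NormedSpace ℝ F] {L : E → E →L[ℝ] E →L[ℝ] F}
    {L' : E →L[ℝ] E →L[ℝ] E →L[ℝ] F} {u v : E → E} {u' v' : E →L[ℝ] E} {y : E}
    (hL : HasFDerivAt L L' y) (hu : HasFDerivAt u u' y) (hv : HasFDerivAt v v' y) :
    ∃ D : E →L[ℝ] F, HasFDerivAt (fun x => L x (u x) (v x)) D y ∧
      ∀ w, D w = L' w (u y) (v y) + L y (u' w) (v y) + L y (u y) (v' w) := by
  obtain ⟨D₁, h1, h1'⟩ := hasFDerivAt_clm_apply (F := E →L[ℝ] F) hL hu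
  obtain ⟨D₂, h2, h2'⟩ := hasFDerivAt_clm_apply h1 hv
  refine ⟨D₂, h2, fun w => ?_⟩
  rw [h2', h1', add_apply]

theorem hasFDerivAt_bilin_comp_apply {E F : Type*} [NormedAddCommGroup E] [NormedSpace ℝ E]
    [NormedAddCommGroup F] [NormedSpace ℝ F] {L : E → E →L[ℝ] E →L[ℝ] F}
    {L' : E →L[ℝ] E →L[ℝ] E →L[ℝ] F} {g u v : E → E} {g' u' v' : E →L[ℝ] E} {y : E}
    (hL : HasFDerivAt L L' (g y)) (hg : HasFDerivAt g g' y) (hu : HasFDerivAt u u' y)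
    (hv : HasFDerivAt v v' y) :
    ∃ D : E →L[ℝ] F, HasFDerivAt (fun x => L (g x) (u x) (v x)) D y ∧
      ∀ w, D w = L' (g' w) (u y) (v y) + L (g y) (u' w) (v y) + L (g y) (u y) (v' w) := by
  obtain ⟨D₁, h1, h1'⟩ := hasFDerivAt_comp_apply (F := E →L[ℝ] E →L[ℝ] F) (f := L) (f' := L') hL hg
  obtain ⟨D₂, h2, h2'⟩ := hasFDerivAt_bilin_apply h1 hu hv
  exact ⟨D₂, h2, fun w => by rw [h2', h1']⟩

/-- The bilinear form with a given matrix. -/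
def bilinForm (A : Matrix (Fin n) (Fin n) ℝ) :
    EuclideanSpace ℝ (Fin n) →L[ℝ] EuclideanSpace ℝ (Fin n) →L[ℝ] ℝ :=
  ∑ p : Fin n × Fin n, A p.1 p.2 •
    (EuclideanSpace.proj p.1 : EuclideanSpace ℝ (Fin n) →L[ℝ] ℝ).smulRight
      (EuclideanSpace.proj p.2 : EuclideanSpace ℝ (Fin n) →L[ℝ] ℝ)

theorem bilinForm_apply (A : Matrix (Fin n) (Fin n) ℝ) (u v : EuclideanSpace ℝ (Fin n)) :
    bilinForm A u v = ∑ i, ∑ j, A i j * u i * v j := by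
  simp [bilinForm, mul_assoc, Fintype.sum_prod_type]

/-- The bilinear map with given components. -/
def bilinMap (c : Fin n → Fin n → Fin n → ℝ) :
    EuclideanSpace ℝ (Fin n) →L[ℝ] EuclideanSpace ℝ (Fin n) →L[ℝ] EuclideanSpace ℝ (Fin n) :=
  ∑ p : Fin n × Fin n × Fin n, c p.1 p.2.1 p.2.2 •
    (EuclideanSpace.proj p.2.1 : EuclideanSpace ℝ (Fin n) →L[ℝ] ℝ).smulRight
      ((EuclideanSpace.proj p.2.2 : EuclideanSpace ℝ (Fin n) →L[ℝ] ℝ).smulRight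
        (EuclideanSpace.single p.1 (1 : ℝ) : EuclideanSpace ℝ (Fin n)))

theorem bilinMap_apply (c : Fin n → Fin n → Fin n → ℝ) (u v : EuclideanSpace ℝ (Fin n))
    (k : Fin n) : bilinMap c u v k = ∑ i, ∑ j, c k i j * u i * v j := by
  simp only [bilinMap, sum_apply, smul_apply,
    ContinuousLinearMap.smulRight_apply, WithLp.ofLp_sum,
    Finset.sum_apply, PiLp.smul_apply, smul_eq_mul, PiLp.single_apply, PiLp.proj_apply,
    Fintype.sum_prod_type]
  rw [Finset.sum_eq_single k]
  · simp [mul_assoc]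
  · intro b _ hb
    simp [hb.symm]
  · simp

theorem hasFDerivAt_bilinForm {A : EuclideanSpace ℝ (Fin n) → Matrix (Fin n) (Fin n) ℝ}
    {y : EuclideanSpace ℝ (Fin n)} (hA : ∀ i j, DifferentiableAt ℝ (fun x => A x i j) y) :
    ∃ A' : EuclideanSpace ℝ (Fin n) →L[ℝ] EuclideanSpace ℝ (Fin n) →L[ℝ]
        EuclideanSpace ℝ (Fin n) →L[ℝ] ℝ,
      HasFDerivAt (fun x => bilinForm (A x)) A' y ∧
      ∀ w, A' w = bilinForm (Matrix.of fun i j => fderiv ℝ (fun x => A x i j) y w) := by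
  have h := hasFDerivAt_sum_smul
    (F := EuclideanSpace ℝ (Fin n) →L[ℝ] EuclideanSpace ℝ (Fin n) →L[ℝ] ℝ)
    (c := fun (p : Fin n × Fin n) x => A x p.1 p.2)
    (fun p => hA p.1 p.2) fun p =>
      (EuclideanSpace.proj p.1 : EuclideanSpace ℝ (Fin n) →L[ℝ] ℝ).smulRight
        (EuclideanSpace.proj p.2 : EuclideanSpace ℝ (Fin n) →L[ℝ] ℝ)
  exact ⟨_, h, fun w => by simp [bilinForm]⟩

theorem hasFDerivAt_bilinMap {c : Fin n → Fin n → Fin n → EuclideanSpace ℝ (Fin n) → ℝ}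
    {y : EuclideanSpace ℝ (Fin n)} (hc : ∀ k i j, DifferentiableAt ℝ (c k i j) y) :
    ∃ c' : EuclideanSpace ℝ (Fin n) →L[ℝ] EuclideanSpace ℝ (Fin n) →L[ℝ]
        EuclideanSpace ℝ (Fin n) →L[ℝ] EuclideanSpace ℝ (Fin n),
      HasFDerivAt (fun x => bilinMap fun k i j => c k i j x) c' y ∧
      ∀ w, c' w = bilinMap (fun k i j => fderiv ℝ (c k i j) y w) := by
  have h := hasFDerivAt_sum_smul
    (F := EuclideanSpace ℝ (Fin n) →L[ℝ] EuclideanSpace ℝ (Fin n) →L[ℝ] EuclideanSpace ℝ (Fin n))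
    (c := fun (p : Fin n × Fin n × Fin n) x => c p.1 p.2.1 p.2.2 x)
    (fun p => hc p.1 p.2.1 p.2.2) fun p =>
      (EuclideanSpace.proj p.2.1 : EuclideanSpace ℝ (Fin n) →L[ℝ] ℝ).smulRight
      ((EuclideanSpace.proj p.2.2 : EuclideanSpace ℝ (Fin n) →L[ℝ] ℝ).smulRight
        (EuclideanSpace.single p.1 (1 : ℝ) : EuclideanSpace ℝ (Fin n)))
  exact ⟨_, h, fun w => by simp [bilinMap]⟩

/-- The matrix of a linear map. -/
def matrixOf (A : EuclideanSpace ℝ (Fin n) →L[ℝ] EuclideanSpace ℝ (Fin n)) :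
    Matrix (Fin n) (Fin n) ℝ :=
  Matrix.of fun k i => A (EuclideanSpace.single i 1) k

theorem apply_eq_sum (A : EuclideanSpace ℝ (Fin n) →L[ℝ] EuclideanSpace ℝ (Fin n))
    (u : EuclideanSpace ℝ (Fin n)) (k : Fin n) :
    A u k = ∑ i, matrixOf A k i * u i := by
  have h : u = ∑ m, u m • (EuclideanSpace.single m (1 : ℝ) : EuclideanSpace ℝ (Fin n)) := by
    ext i
    simp [Pi.single_apply]
  conv_lhs => rw [h]
  simp [matrixOf, mul_comm]

theorem bilinForm_congr (A : Matrix (Fin n) (Fin n) ℝ)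
    (B : EuclideanSpace ℝ (Fin n) →L[ℝ] EuclideanSpace ℝ (Fin n)) (u v : EuclideanSpace ℝ (Fin n)) :
    bilinForm ((matrixOf B).transpose * A * matrixOf B) u v = bilinForm A (B u) (B v) := by
  simp only [bilinForm_apply, apply_eq_sum B, Matrix.mul_apply, Matrix.transpose_apply,
    Finset.sum_mul, Finset.mul_sum]
  exact sum_reindex_four (fun (i, j, b, a) => (a, b, j, i)) (fun (a, b, j, i) => (i, j, b, a))
    (fun _ => rfl) (fun _ => rfl) fun i j b a => by dsimp only; ring

theorem bilinForm_injective {A B : Matrix (Fin n) (Fin n) ℝ}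
    (h : ∀ u v, bilinForm A u v = bilinForm B u v) : A = B := by
  ext i j
  have := h (EuclideanSpace.single i 1) (EuclideanSpace.single j 1)
  simpa [bilinForm_apply, Pi.single_apply] using this

theorem bilinForm_nondegenerate {A : Matrix (Fin n) (Fin n) ℝ} (hA : A.det ≠ 0)
    {u u' : EuclideanSpace ℝ (Fin n)}
    (h : ∀ v, bilinForm A u v = bilinForm A u' v) : u = u' := by
  have h1 : Matrix.vecMul u.ofLp A = Matrix.vecMul u'.ofLp A := by
    ext j
    have := h (EuclideanSpace.single j 1)
    simpa [bilinForm_apply, Pi.single_apply, Matrix.vecMul, dotProduct, mul_comm] using this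
  have h2 := Matrix.vecMul_injective_of_isUnit ((Matrix.isUnit_iff_isUnit_det A).2
    (isUnit_iff_ne_zero.2 hA)) h1
  ext i
  exact congrFun h2 i

/-- The Levi-Civita connection form `Γ(u, v)^k = Γ^k_ij u^i v^j`. -/
def connectionForm (G : EuclideanSpace ℝ (Fin n) → Matrix (Fin n) (Fin n) ℝ)
    (y : EuclideanSpace ℝ (Fin n)) :
    EuclideanSpace ℝ (Fin n) →L[ℝ] EuclideanSpace ℝ (Fin n) →L[ℝ] EuclideanSpace ℝ (Fin n) :=
  bilinMap fun k i j => christoffel G k i j y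

/-- A smooth change of coordinates `Φ` on an open set `U`, which takes the metric `G' s` to the
metric `G s`. -/
structure IsCoordChange (U : Set (EuclideanSpace ℝ (Fin n)))
    (Φ : EuclideanSpace ℝ (Fin n) → EuclideanSpace ℝ (Fin n)) (s : ℝ)
    (G' G : ℝ → EuclideanSpace ℝ (Fin n) → Matrix (Fin n) (Fin n) ℝ)
    (Ω' Ω : Set (ℝ × EuclideanSpace ℝ (Fin n))) : Prop where
  isOpen : IsOpen U
  smooth : ContDiffOn ℝ ∞ Φ U
  left : IsMetricFamily Ω' G'
  right : IsMetricFamily Ω G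
  mem_left : ∀ y ∈ U, (s, y) ∈ Ω'
  mem_right : ∀ y ∈ U, (s, Φ y) ∈ Ω
  metric_eq : ∀ y ∈ U, G' s y =
    (matrixOf (fderiv ℝ Φ y)).transpose * G s (Φ y) * matrixOf (fderiv ℝ Φ y)

namespace IsMetricFamily

variable {Ω : Set (ℝ × EuclideanSpace ℝ (Fin n))}
  {G : ℝ → EuclideanSpace ℝ (Fin n) → Matrix (Fin n) (Fin n) ℝ} {s : ℝ}
  {y : EuclideanSpace ℝ (Fin n)}

/-- The Koszul formula in coordinates. -/
theorem koszul (hG : IsMetricFamily Ω G) (hz : (s, y) ∈ Ω)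
    {D : EuclideanSpace ℝ (Fin n) →L[ℝ] EuclideanSpace ℝ (Fin n) →L[ℝ]
      EuclideanSpace ℝ (Fin n) →L[ℝ] ℝ}
    (hD : HasFDerivAt (fun x => bilinForm (G s x)) D y) (u v w : EuclideanSpace ℝ (Fin n)) :
    bilinForm (G s y) (connectionForm (G s) y u v) w =
      (1 / 2) * (D u v w + D v u w - D w u v) := by
  obtain ⟨D', hD', hD''⟩ := hasFDerivAt_bilinForm (A := G s) (y := y)
    fun i j => (hG.smooth i j).differentiableAt hG.isOpen hz
  rw [hD.unique hD']
  simp only [hD'', bilinForm_apply, fderiv_eq_sum_pd, Matrix.of_apply]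
  have h1 : ∑ a, ∑ b, G s y a b * (connectionForm (G s) y u v) a * w b =
      ∑ i, ∑ j, ∑ b, (∑ a, G s y b a * christoffel (G s) a i j y) * (u i * v j * w b) := by
    simp only [connectionForm, bilinMap_apply, Finset.mul_sum, Finset.sum_mul]
    exact sum_reindex_four (fun (a, b, i, j) => (i, j, b, a)) (fun (i, j, b, a) => (a, b, i, j))
      (fun _ => rfl) (fun _ => rfl) fun a b i j => by
        dsimp only; rw [hG.symm s y hz a b]; ring
  have h2 : ∀ u v w : EuclideanSpace ℝ (Fin n),
      ∑ i, ∑ j, (∑ m, u m * pd m (fun x => G s x i j) y) * v i * w j =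
      ∑ i, ∑ j, ∑ b, pd i (fun x => G s x j b) y * (u i * v j * w b) := by
    intro u v w
    simp only [Finset.sum_mul]
    exact sum_reindex_three (fun (i, j, m) => (m, i, j)) (fun (m, i, j) => (i, j, m))
      (fun _ => rfl) (fun _ => rfl) fun i j m => by dsimp only; ring
  have h3 : ∑ i, ∑ j, ∑ b, pd i (fun x => G s x j b) y * (v i * u j * w b) =
      ∑ i, ∑ j, ∑ b, pd j (fun x => G s x i b) y * (u i * v j * w b) :=
    sum_reindex_three (fun (i, j, b) => (j, i, b)) (fun (i, j, b) => (j, i, b))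
      (fun _ => rfl) (fun _ => rfl) fun i j b => by dsimp only; ring
  have h4 : ∑ i, ∑ j, ∑ b, pd i (fun x => G s x j b) y * (w i * u j * v b) =
      ∑ i, ∑ j, ∑ b, pd b (fun x => G s x i j) y * (u i * v j * w b) :=
    sum_reindex_three (fun (b, i, j) => (i, j, b)) (fun (i, j, b) => (b, i, j))
      (fun _ => rfl) (fun _ => rfl) fun i j b => by dsimp only; ring
  rw [h1, h2, h2, h2, h3, h4]
  simp only [hG.sum_mul_christoffel hz, Finset.mul_sum, ← Finset.sum_add_distrib,
    ← Finset.sum_sub_distrib]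
  exact Finset.sum_congr rfl fun i _ => sum_congr_two fun j b => by ring

end IsMetricFamily

namespace IsCoordChange

variable {U : Set (EuclideanSpace ℝ (Fin n))}
  {Φ : EuclideanSpace ℝ (Fin n) → EuclideanSpace ℝ (Fin n)} {s : ℝ}
  {G' G : ℝ → EuclideanSpace ℝ (Fin n) → Matrix (Fin n) (Fin n) ℝ}
  {Ω' Ω : Set (ℝ × EuclideanSpace ℝ (Fin n))} {y : EuclideanSpace ℝ (Fin n)}

theorem det_ne_zero (h : IsCoordChange U Φ s G' G Ω' Ω) (hy : y ∈ U) :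
    (matrixOf (fderiv ℝ Φ y)).det ≠ 0 := by
  have h1 := h.left.det_ne_zero (h.mem_left y hy)
  rw [h.metric_eq y hy, Matrix.det_mul] at h1
  exact right_ne_zero_of_mul h1

theorem surjective (h : IsCoordChange U Φ s G' G Ω' Ω) (hy : y ∈ U) (v : EuclideanSpace ℝ (Fin n)) :
    ∃ w, fderiv ℝ Φ y w = v := by
  refine ⟨WithLp.toLp 2 ((matrixOf (fderiv ℝ Φ y))⁻¹.mulVec v.ofLp), ?_⟩
  ext k
  rw [apply_eq_sum]
  have : (matrixOf (fderiv ℝ Φ y)).mulVec ((matrixOf (fderiv ℝ Φ y))⁻¹.mulVec v.ofLp) = v.ofLp := by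
    rw [Matrix.mulVec_mulVec, Matrix.mul_nonsing_inv _ (isUnit_iff_ne_zero.2 (h.det_ne_zero hy)),
      Matrix.one_mulVec]
  exact congrFun this k

theorem hasFDerivAt (h : IsCoordChange U Φ s G' G Ω' Ω) (hy : y ∈ U) :
    HasFDerivAt Φ (fderiv ℝ Φ y) y :=
  ((h.smooth.contDiffAt (h.isOpen.mem_nhds hy)).differentiableAt (by simp)).hasFDerivAt

theorem contDiffOn_fderiv (h : IsCoordChange U Φ s G' G Ω' Ω) :
    ContDiffOn ℝ ∞ (fderiv ℝ Φ) U := h.smooth.fderiv_of_isOpen h.isOpen (by simp)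

theorem hasFDerivAt_fderiv (h : IsCoordChange U Φ s G' G Ω' Ω) (hy : y ∈ U) :
    HasFDerivAt (fderiv ℝ Φ) (fderiv ℝ (fderiv ℝ Φ) y) y :=
  ((h.contDiffOn_fderiv.contDiffAt (h.isOpen.mem_nhds hy)).differentiableAt (by simp)).hasFDerivAt

theorem hasFDerivAt_fderiv_apply (h : IsCoordChange U Φ s G' G Ω' Ω) (hy : y ∈ U)
    (v : EuclideanSpace ℝ (Fin n)) :
    HasFDerivAt (fun x => fderiv ℝ Φ x v) ((fderiv ℝ (fderiv ℝ Φ) y).flip v) y := by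
  have := (h.hasFDerivAt_fderiv hy).clm_apply (hasFDerivAt_const v y)
  simpa using this

theorem hasFDerivAt_fderiv_fderiv (h : IsCoordChange U Φ s G' G Ω' Ω) (hy : y ∈ U) :
    HasFDerivAt (fderiv ℝ (fderiv ℝ Φ)) (fderiv ℝ (fderiv ℝ (fderiv ℝ Φ)) y) y :=
  (((h.contDiffOn_fderiv.fderiv_of_isOpen (m := ∞) h.isOpen (by simp)).contDiffAt
    (h.isOpen.mem_nhds hy)).differentiableAt (by simp)).hasFDerivAt

theorem second_symm (h : IsCoordChange U Φ s G' G Ω' Ω) (hy : y ∈ U)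
    (u v : EuclideanSpace ℝ (Fin n)) :
    fderiv ℝ (fderiv ℝ Φ) y u v = fderiv ℝ (fderiv ℝ Φ) y v u :=
  ((h.smooth.contDiffAt (h.isOpen.mem_nhds hy)).isSymmSndFDerivAt
    (by simpa using two_le_infty)).eq _ _

/-- The transformation law of the Levi-Civita connection. -/
theorem connectionForm_eq (h : IsCoordChange U Φ s G' G Ω' Ω) (hy : y ∈ U)
    (u v : EuclideanSpace ℝ (Fin n)) :
    fderiv ℝ Φ y (connectionForm (G' s) y u v) = fderiv ℝ (fderiv ℝ Φ) y u v +
      connectionForm (G s) (Φ y) (fderiv ℝ Φ y u) (fderiv ℝ Φ y v) := by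
  obtain ⟨D, hD, -⟩ := hasFDerivAt_bilinForm (A := G s) (y := Φ y)
    fun i j => (h.right.smooth i j).differentiableAt h.right.isOpen (h.mem_right y hy)
  obtain ⟨D', hD', -⟩ := hasFDerivAt_bilinForm (A := G' s) (y := y)
    fun i j => (h.left.smooth i j).differentiableAt h.left.isOpen (h.mem_left y hy)
  have hsymm : ∀ a b : EuclideanSpace ℝ (Fin n),
      bilinForm (G s (Φ y)) a b = bilinForm (G s (Φ y)) b a := by
    intro a b
    simp only [bilinForm_apply]
    rw [Finset.sum_comm]
    exact sum_congr_two fun i j => by rw [h.right.symm s _ (h.mem_right y hy) j i]; ring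
  -- the derivative of the relation `G' s (a, b) = G s (dΦ a, dΦ b)`
  have hm : ∀ a b w : EuclideanSpace ℝ (Fin n), D' w a b =
      D (fderiv ℝ Φ y w) (fderiv ℝ Φ y a) (fderiv ℝ Φ y b)
      + bilinForm (G s (Φ y)) (fderiv ℝ (fderiv ℝ Φ) y w a) (fderiv ℝ Φ y b)
      + bilinForm (G s (Φ y)) (fderiv ℝ Φ y a) (fderiv ℝ (fderiv ℝ Φ) y w b) := by
    intro a b w
    obtain ⟨D₁, h1, h1'⟩ := hasFDerivAt_bilin_apply hD' (hasFDerivAt_const a y)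
      (hasFDerivAt_const b y)
    obtain ⟨D₂, h2, h2'⟩ := hasFDerivAt_bilin_comp_apply hD (h.hasFDerivAt hy)
      (h.hasFDerivAt_fderiv_apply hy a) (h.hasFDerivAt_fderiv_apply hy b)
    have h3 : (fun x => bilinForm (G' s x) a b) =ᶠ[𝓝 y]
        fun x => bilinForm (G s (Φ x)) (fderiv ℝ Φ x a) (fderiv ℝ Φ x b) := by
      filter_upwards [h.isOpen.mem_nhds hy] with x hx
      rw [h.metric_eq x hx, bilinForm_congr]
    have h4 : D₁ = D₂ := h1.unique (h2.congr_of_eventuallyEq h3)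
    have h5 := h1' w
    rw [h4, h2' w] at h5
    simpa using h5.symm
  -- compare the two Koszul formulas after pairing with an arbitrary `dΦ w`
  refine bilinForm_nondegenerate (h.right.det_ne_zero (h.mem_right y hy)) fun w' => ?_
  obtain ⟨w, rfl⟩ := h.surjective hy w'
  have k1 := h.left.koszul (h.mem_left y hy) hD' u v w
  have k2 := h.right.koszul (h.mem_right y hy) hD (fderiv ℝ Φ y u) (fderiv ℝ Φ y v)
    (fderiv ℝ Φ y w)
  rw [h.metric_eq y hy, bilinForm_congr, hm, hm, hm] at k1
  rw [k1, map_add, add_apply, k2, h.second_symm hy v u, h.second_symm hy w u,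
    h.second_symm hy w v, hsymm (fderiv ℝ Φ y v), hsymm (fderiv ℝ Φ y u)]
  ring

end IsCoordChange

end CoordinateChange

section CoordinateChange

variable {n : ℕ}

/-! ### Transformation of curvature and Hessians -/

/-- The endomorphism `w ↦ R(w, u) v` for the curvature tensor of a connection with connection
form `Γ` whose derivative is `D`. -/
def curvatureEnd (D : EuclideanSpace ℝ (Fin n) →L[ℝ] EuclideanSpace ℝ (Fin n) →L[ℝ]
      EuclideanSpace ℝ (Fin n) →L[ℝ] EuclideanSpace ℝ (Fin n))
    (Γ : EuclideanSpace ℝ (Fin n) →L[ℝ] EuclideanSpace ℝ (Fin n) →L[ℝ] EuclideanSpace ℝ (Fin n))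
    (u v : EuclideanSpace ℝ (Fin n)) : EuclideanSpace ℝ (Fin n) →L[ℝ] EuclideanSpace ℝ (Fin n) :=
  (D.flip u).flip v - (D u).flip v + Γ.flip (Γ u v) - (Γ u).comp (Γ.flip v)

theorem curvatureEnd_apply (D : EuclideanSpace ℝ (Fin n) →L[ℝ] EuclideanSpace ℝ (Fin n) →L[ℝ]
      EuclideanSpace ℝ (Fin n) →L[ℝ] EuclideanSpace ℝ (Fin n))
    (Γ : EuclideanSpace ℝ (Fin n) →L[ℝ] EuclideanSpace ℝ (Fin n) →L[ℝ] EuclideanSpace ℝ (Fin n))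
    (u v w : EuclideanSpace ℝ (Fin n)) :
    curvatureEnd D Γ u v w = D w u v - D u w v + Γ w (Γ u v) - Γ u (Γ w v) := rfl

theorem matrixOf_comp (A B : EuclideanSpace ℝ (Fin n) →L[ℝ] EuclideanSpace ℝ (Fin n)) :
    matrixOf (A.comp B) = matrixOf A * matrixOf B := by
  ext k i
  simp only [matrixOf, Matrix.of_apply, ContinuousLinearMap.comp_apply, Matrix.mul_apply]
  exact apply_eq_sum A _ k

/-- Similar endomorphisms have the same trace. -/
theorem trace_eq_of_conj {A T' T : EuclideanSpace ℝ (Fin n) →L[ℝ] EuclideanSpace ℝ (Fin n)}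
    (hA : (matrixOf A).det ≠ 0) (h : ∀ w, A (T' w) = T (A w)) :
    (matrixOf T').trace = (matrixOf T).trace := by
  have h1 : matrixOf A * matrixOf T' = matrixOf T * matrixOf A := by
    rw [← matrixOf_comp, ← matrixOf_comp]
    congr 1
    ext w
    simp [h]
  have hu := isUnit_iff_ne_zero.2 hA
  have h2 : matrixOf T' = (matrixOf A)⁻¹ * (matrixOf T * matrixOf A) := by
    rw [← h1, ← Matrix.mul_assoc, Matrix.nonsing_inv_mul _ hu, Matrix.one_mul]
  rw [h2, Matrix.trace_mul_comm, Matrix.mul_assoc, Matrix.mul_nonsing_inv _ hu, Matrix.mul_one]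

namespace IsMetricFamily

variable {Ω : Set (ℝ × EuclideanSpace ℝ (Fin n))}
  {G : ℝ → EuclideanSpace ℝ (Fin n) → Matrix (Fin n) (Fin n) ℝ} {s : ℝ}
  {y : EuclideanSpace ℝ (Fin n)}

theorem hasFDerivAt_connectionForm (hG : IsMetricFamily Ω G) (hz : (s, y) ∈ Ω) :
    ∃ D : EuclideanSpace ℝ (Fin n) →L[ℝ] EuclideanSpace ℝ (Fin n) →L[ℝ]
        EuclideanSpace ℝ (Fin n) →L[ℝ] EuclideanSpace ℝ (Fin n),
      HasFDerivAt (connectionForm (G s)) D y ∧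
      ∀ w, D w = bilinMap (fun k i j => fderiv ℝ (christoffel (G s) k i j) y w) :=
  hasFDerivAt_bilinMap (c := christoffel (G s)) fun k i j =>
    (hG.christoffel_smooth k i j).differentiableAt hG.isOpen hz

/-- The Ricci tensor is the contraction of the curvature tensor. -/
theorem bilinForm_ricciCoord (hG : IsMetricFamily Ω G) (hz : (s, y) ∈ Ω)
    {D : EuclideanSpace ℝ (Fin n) →L[ℝ] EuclideanSpace ℝ (Fin n) →L[ℝ]
        EuclideanSpace ℝ (Fin n) →L[ℝ] EuclideanSpace ℝ (Fin n)}
    (hD : HasFDerivAt (connectionForm (G s)) D y) (u v : EuclideanSpace ℝ (Fin n)) :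
    bilinForm (ricciCoord (G s) y) u v =
      (matrixOf (curvatureEnd D (connectionForm (G s) y) v u)).trace := by
  obtain ⟨D', hD', hD''⟩ := hG.hasFDerivAt_connectionForm hz
  rw [HasFDerivAt.unique hD hD']
  have hs : ∀ k i j, pd k (christoffel (G s) k i j) y = pd k (christoffel (G s) k j i) y := by
    intro k i j
    refine pd_congr ?_ k
    filter_upwards [hG.eventually_mem hz] with x hx using hG.christoffel_symm hx k i j
  have e1 : ∀ k, (D' (EuclideanSpace.single k 1) v u) k =
      ∑ i, ∑ j, pd k (christoffel (G s) k i j) y * u i * v j := by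
    intro k
    rw [hD'', bilinMap_apply, Finset.sum_comm]
    refine sum_congr_two fun i j => ?_
    rw [hs k i j, pd]
    ring
  have e2 : ∀ k, (D' v (EuclideanSpace.single k 1) u) k =
      ∑ i, ∑ j, pd j (christoffel (G s) k i k) y * u i * v j := by
    intro k
    rw [hD'', bilinMap_apply, Finset.sum_eq_single k (by intro b _ hb; simp [hb]) (by simp)]
    refine Finset.sum_congr rfl fun i _ => ?_
    have : christoffel (G s) k k i =ᶠ[𝓝 y] christoffel (G s) k i k := by
      filter_upwards [hG.eventually_mem hz] with x hx using hG.christoffel_symm hx k k i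
    rw [this.fderiv_eq, fderiv_eq_sum_pd]
    simp only [PiLp.single_apply, if_true, mul_one, Finset.sum_mul]
    exact Finset.sum_congr rfl fun j _ => by ring
  have e3 : ∀ k, (connectionForm (G s) y (EuclideanSpace.single k 1)
        (connectionForm (G s) y v u)) k =
      ∑ i, ∑ j, (∑ l, christoffel (G s) k k l y * christoffel (G s) l i j y) * u i * v j := by
    intro k
    rw [connectionForm, bilinMap_apply, Finset.sum_eq_single k (by intro b _ hb; simp [hb])
      (by simp)]
    simp only [PiLp.single_apply, if_true, mul_one, bilinMap_apply, Finset.mul_sum, Finset.sum_mul]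
    exact sum_reindex_three (fun (l, j, i) => (i, j, l)) (fun (i, j, l) => (l, j, i))
      (fun _ => rfl) (fun _ => rfl) fun l j i => by
        dsimp only; rw [hG.christoffel_symm hz l j i]; ring
  have e4 : ∀ k, (connectionForm (G s) y v
        (connectionForm (G s) y (EuclideanSpace.single k 1) u)) k =
      ∑ i, ∑ j, (∑ l, christoffel (G s) k j l y * christoffel (G s) l i k y) * u i * v j := by
    intro k
    have : ∀ l, connectionForm (G s) y (EuclideanSpace.single k 1) u l =
        ∑ i, christoffel (G s) l i k y * u i := by
      intro l
      rw [connectionForm, bilinMap_apply, Finset.sum_eq_single k (by intro b _ hb; simp [hb])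
        (by simp)]
      exact Finset.sum_congr rfl fun i _ => by
        rw [hG.christoffel_symm hz l i k]; simp
    rw [connectionForm, bilinMap_apply]
    simp only [connectionForm] at this
    simp only [this, Finset.mul_sum, Finset.sum_mul]
    exact sum_reindex_three (fun (j, l, i) => (i, j, l)) (fun (i, j, l) => (j, l, i))
      (fun _ => rfl) (fun _ => rfl) fun l j i => by dsimp only; ring
  simp only [Matrix.trace, Matrix.diag, matrixOf, Matrix.of_apply, curvatureEnd_apply,
    PiLp.add_apply, PiLp.sub_apply, e1, e2, e3, e4, bilinForm_apply, ricciCoord,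
    ← Finset.sum_add_distrib, ← Finset.sum_sub_distrib]
  simp only [Finset.sum_mul]
  exact sum_reindex_three (fun (i, j, k) => (k, i, j)) (fun (k, i, j) => (i, j, k))
      (fun _ => rfl) (fun _ => rfl) fun i j k => by
        dsimp only; simp only [sub_mul, add_mul, Finset.sum_mul]

theorem bilin_apply_eq_sum (B : EuclideanSpace ℝ (Fin n) →L[ℝ] EuclideanSpace ℝ (Fin n) →L[ℝ] ℝ)
    (u v : EuclideanSpace ℝ (Fin n)) :
    B u v = ∑ i, ∑ j, B (EuclideanSpace.single i 1) (EuclideanSpace.single j 1) * u i * v j := by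
  have hu : ∀ u : EuclideanSpace ℝ (Fin n),
      u = ∑ m, u m • (EuclideanSpace.single m (1 : ℝ) : EuclideanSpace ℝ (Fin n)) := by
    intro u
    ext i
    simp [Pi.single_apply]
  have h1 : B u v = ∑ i, u i * B (EuclideanSpace.single i 1) v := by
    conv_lhs => rw [hu u]
    simp [sum_apply]
  have h2 : ∀ w, B w v = ∑ j, v j * B w (EuclideanSpace.single j 1) := by
    intro w
    conv_lhs => rw [hu v]
    simp
  rw [h1]
  simp only [h2, Finset.mul_sum]
  exact sum_congr_two fun i j => by ring

theorem bilinForm_hessianCoord {A : EuclideanSpace ℝ (Fin n) → Matrix (Fin n) (Fin n) ℝ}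
    {f : EuclideanSpace ℝ (Fin n) → ℝ} (hf : ContDiffAt ℝ ∞ f y)
    (u v : EuclideanSpace ℝ (Fin n)) :
    bilinForm (hessianCoord A f y) u v =
      fderiv ℝ (fderiv ℝ f) y u v - fderiv ℝ f y (connectionForm A y u v) := by
  have hd : DifferentiableAt ℝ (fderiv ℝ f) y :=
    (hf.fderiv_right (m := ∞) (by simp)).differentiableAt (by simp)
  have e1 : ∀ i j, pd i (pd j f) y =
      fderiv ℝ (fderiv ℝ f) y (EuclideanSpace.single i 1) (EuclideanSpace.single j 1) := by
    intro i j
    obtain ⟨D, h1, h2⟩ := hasFDerivAt_clm_apply (F := ℝ) hd.hasFDerivAt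
      (hasFDerivAt_const (EuclideanSpace.single j (1 : ℝ) : EuclideanSpace ℝ (Fin n)) y)
    have h3 : pd i (pd j f) y = D (EuclideanSpace.single i 1) := by
      rw [← h1.fderiv]
      rfl
    rw [h3, h2, zero_apply, map_zero, add_zero]
  have e2 : fderiv ℝ (fderiv ℝ f) y u v = ∑ i, ∑ j, pd i (pd j f) y * u i * v j := by
    rw [bilin_apply_eq_sum]
    exact sum_congr_two fun i j => by rw [e1]
  rw [e2, fderiv_eq_sum_pd]
  simp only [bilinForm_apply, hessianCoord, Matrix.of_apply, connectionForm, bilinMap_apply,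
    sub_mul, Finset.sum_sub_distrib, Finset.sum_mul]
  rw [sub_right_inj]
  exact sum_reindex_three (fun (i, j, k) => (k, i, j)) (fun (k, i, j) => (i, j, k))
      (fun _ => rfl) (fun _ => rfl) fun i j k => by dsimp only; ring

end IsMetricFamily

namespace IsCoordChange

variable {U : Set (EuclideanSpace ℝ (Fin n))}
  {Φ : EuclideanSpace ℝ (Fin n) → EuclideanSpace ℝ (Fin n)} {s : ℝ}
  {G' G : ℝ → EuclideanSpace ℝ (Fin n) → Matrix (Fin n) (Fin n) ℝ}
  {Ω' Ω : Set (ℝ × EuclideanSpace ℝ (Fin n))} {y : EuclideanSpace ℝ (Fin n)}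

theorem third_symm (h : IsCoordChange U Φ s G' G Ω' Ω) (hy : y ∈ U)
    (u v w : EuclideanSpace ℝ (Fin n)) :
    fderiv ℝ (fderiv ℝ (fderiv ℝ Φ)) y u v w = fderiv ℝ (fderiv ℝ (fderiv ℝ Φ)) y v u w := by
  have := ((h.contDiffOn_fderiv.contDiffAt (h.isOpen.mem_nhds hy)).isSymmSndFDerivAt
    (by simpa using two_le_infty)).eq u v
  rw [this]

/-- The transformation law of the derivative of the connection form. -/
theorem deriv_connectionForm_eq (h : IsCoordChange U Φ s G' G Ω' Ω) (hy : y ∈ U)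
    {D' D : EuclideanSpace ℝ (Fin n) →L[ℝ] EuclideanSpace ℝ (Fin n) →L[ℝ]
        EuclideanSpace ℝ (Fin n) →L[ℝ] EuclideanSpace ℝ (Fin n)}
    (hD' : HasFDerivAt (connectionForm (G' s)) D' y)
    (hD : HasFDerivAt (connectionForm (G s)) D (Φ y)) (u v w : EuclideanSpace ℝ (Fin n)) :
    fderiv ℝ (fderiv ℝ Φ) y w (connectionForm (G' s) y u v) + fderiv ℝ Φ y (D' w u v) =
      fderiv ℝ (fderiv ℝ (fderiv ℝ Φ)) y w u v
      + (D (fderiv ℝ Φ y w) (fderiv ℝ Φ y u) (fderiv ℝ Φ y v)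
        + connectionForm (G s) (Φ y) (fderiv ℝ (fderiv ℝ Φ) y w u) (fderiv ℝ Φ y v)
        + connectionForm (G s) (Φ y) (fderiv ℝ Φ y u) (fderiv ℝ (fderiv ℝ Φ) y w v)) := by
  obtain ⟨D₁, h1, h1'⟩ := hasFDerivAt_bilin_apply hD' (hasFDerivAt_const u y)
    (hasFDerivAt_const v y)
  obtain ⟨D₂, h2, h2'⟩ := hasFDerivAt_clm_apply (h.hasFDerivAt_fderiv hy) h1
  obtain ⟨D₃, h3, h3'⟩ := hasFDerivAt_bilin_comp_apply hD (h.hasFDerivAt hy)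
      (h.hasFDerivAt_fderiv_apply hy u) (h.hasFDerivAt_fderiv_apply hy v)
  obtain ⟨D₄, h4, h4'⟩ := hasFDerivAt_bilin_apply (h.hasFDerivAt_fderiv_fderiv hy)
    (hasFDerivAt_const u y) (hasFDerivAt_const v y)
  have h5 := h4.add h3
  have h6 := h2.unique (h5.congr_of_eventuallyEq (by
    filter_upwards [h.isOpen.mem_nhds hy] with x hx
    exact h.connectionForm_eq hx u v))
  have h7 := h2' w
  rw [h6, add_apply, h4', h3', h1'] at h7
  simpa using h7.symm

/-- The curvature is a tensor: the third derivatives of the coordinate change cancel by symmetry,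
the second derivatives against the inhomogeneous term in the transformation of the connection. -/
theorem curvatureEnd_eq (h : IsCoordChange U Φ s G' G Ω' Ω) (hy : y ∈ U)
    {D' D : EuclideanSpace ℝ (Fin n) →L[ℝ] EuclideanSpace ℝ (Fin n) →L[ℝ]
        EuclideanSpace ℝ (Fin n) →L[ℝ] EuclideanSpace ℝ (Fin n)}
    (hD' : HasFDerivAt (connectionForm (G' s)) D' y)
    (hD : HasFDerivAt (connectionForm (G s)) D (Φ y)) (u v w : EuclideanSpace ℝ (Fin n)) :
    fderiv ℝ Φ y (curvatureEnd D' (connectionForm (G' s) y) u v w) =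
      curvatureEnd D (connectionForm (G s) (Φ y)) (fderiv ℝ Φ y u) (fderiv ℝ Φ y v)
        (fderiv ℝ Φ y w) := by
  have k1 := h.deriv_connectionForm_eq hy hD' hD u v w
  have k2 := h.deriv_connectionForm_eq hy hD' hD w v u
  have k3 := h.connectionForm_eq hy w (connectionForm (G' s) y u v)
  have k4 := h.connectionForm_eq hy u (connectionForm (G' s) y w v)
  rw [h.connectionForm_eq hy u v, map_add] at k3
  rw [h.connectionForm_eq hy w v, map_add] at k4
  rw [h.third_symm hy u w v, h.second_symm hy u w] at k2
  rw [← eq_sub_iff_add_eq'] at k1 k2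
  rw [curvatureEnd_apply, curvatureEnd_apply, map_sub, map_add, map_sub, k1, k2, k3, k4]
  abel

theorem ricciCoord_eq (h : IsCoordChange U Φ s G' G Ω' Ω) (hy : y ∈ U) :
    ricciCoord (G' s) y = (matrixOf (fderiv ℝ Φ y)).transpose * ricciCoord (G s) (Φ y) *
      matrixOf (fderiv ℝ Φ y) := by
  obtain ⟨D', hD', -⟩ := h.left.hasFDerivAt_connectionForm (h.mem_left y hy)
  obtain ⟨D, hD, -⟩ := h.right.hasFDerivAt_connectionForm (h.mem_right y hy)
  refine bilinForm_injective fun u v => ?_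
  rw [bilinForm_congr, h.left.bilinForm_ricciCoord (h.mem_left y hy) hD',
    h.right.bilinForm_ricciCoord (h.mem_right y hy) hD]
  exact trace_eq_of_conj (h.det_ne_zero hy) fun w => h.curvatureEnd_eq hy hD' hD v u w

theorem fderiv_eq (h : IsCoordChange U Φ s G' G Ω' Ω) (hy : y ∈ U)
    {f' f : EuclideanSpace ℝ (Fin n) → ℝ} (hf : DifferentiableAt ℝ f (Φ y))
    (hff : f' =ᶠ[𝓝 y] f ∘ Φ) (v : EuclideanSpace ℝ (Fin n)) :
    fderiv ℝ f' y v = fderiv ℝ f (Φ y) (fderiv ℝ Φ y v) := by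
  rw [hff.fderiv_eq, (hf.hasFDerivAt.comp y (h.hasFDerivAt hy)).fderiv]
  rfl

theorem pd_eq (h : IsCoordChange U Φ s G' G Ω' Ω) (hy : y ∈ U)
    {f' f : EuclideanSpace ℝ (Fin n) → ℝ} (hf : DifferentiableAt ℝ f (Φ y))
    (hff : f' =ᶠ[𝓝 y] f ∘ Φ) (i : Fin n) :
    pd i f' y = ∑ k, matrixOf (fderiv ℝ Φ y) k i * pd k f (Φ y) := by
  rw [pd, h.fderiv_eq hy hf hff, fderiv_eq_sum_pd]
  rfl

theorem hessianCoord_eq (h : IsCoordChange U Φ s G' G Ω' Ω) (hy : y ∈ U)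
    {f' f : EuclideanSpace ℝ (Fin n) → ℝ} (hf : ContDiffAt ℝ ∞ f (Φ y))
    (hff : f' =ᶠ[𝓝 y] f ∘ Φ) :
    hessianCoord (G' s) f' y = (matrixOf (fderiv ℝ Φ y)).transpose *
      hessianCoord (G s) f (Φ y) * matrixOf (fderiv ℝ Φ y) := by
  have hΦ := h.smooth.contDiffAt (h.isOpen.mem_nhds hy)
  have hf' : ContDiffAt ℝ ∞ f' y := (hf.comp y hΦ).congr_of_eventuallyEq hff
  have hd' : DifferentiableAt ℝ (fderiv ℝ f') y :=
    (hf'.fderiv_right (m := ∞) (by simp)).differentiableAt (by simp)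
  have hd : DifferentiableAt ℝ (fderiv ℝ f) (Φ y) :=
    (hf.fderiv_right (m := ∞) (by simp)).differentiableAt (by simp)
  refine bilinForm_injective fun u v => ?_
  rw [bilinForm_congr, IsMetricFamily.bilinForm_hessianCoord hf',
    IsMetricFamily.bilinForm_hessianCoord hf]
  obtain ⟨D₁, h1, h1'⟩ := hasFDerivAt_clm_apply hd'.hasFDerivAt (hasFDerivAt_const v y)
  obtain ⟨D₂, h2, h2'⟩ := hasFDerivAt_comp_apply (F := EuclideanSpace ℝ (Fin n) →L[ℝ] ℝ)
    hd.hasFDerivAt (h.hasFDerivAt hy)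
  obtain ⟨D₃, h3, h3'⟩ := hasFDerivAt_clm_apply h2 (h.hasFDerivAt_fderiv_apply hy v)
  have hev : ∀ᶠ x in 𝓝 y, ContDiffAt ℝ 1 f (Φ x) :=
    (h.hasFDerivAt hy).continuousAt.eventually
      ((hf.of_le (by simp)).eventually (by simp))
  have h4 := h1.unique (h3.congr_of_eventuallyEq (by
    filter_upwards [h.isOpen.mem_nhds hy, hev, eventually_eventually_nhds.2 hff] with x hx hx' hx''
    exact h.fderiv_eq hx (hx'.differentiableAt (by simp)) hx'' v))
  have h5 := h1' u
  rw [h4, h3', h2'] at h5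
  simp only [zero_apply, map_zero, add_zero] at h5
  rw [← h5, h.fderiv_eq hy (hf.differentiableAt (by simp)) hff, h.connectionForm_eq hy, map_add]
  simp only [ContinuousLinearMap.flip_apply]
  ring

theorem diffSqCoord_eq (h : IsCoordChange U Φ s G' G Ω' Ω) (hy : y ∈ U)
    {f' f : EuclideanSpace ℝ (Fin n) → ℝ} (hf : DifferentiableAt ℝ f (Φ y))
    (hff : f' =ᶠ[𝓝 y] f ∘ Φ) :
    diffSqCoord f' y = (matrixOf (fderiv ℝ Φ y)).transpose *
      diffSqCoord f (Φ y) * matrixOf (fderiv ℝ Φ y) := by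
  ext i j
  simp only [diffSqCoord, Matrix.of_apply, h.pd_eq hy hf hff, Matrix.mul_apply,
    Matrix.transpose_apply, Finset.sum_mul, Finset.mul_sum]
  exact sum_congr_two fun k l => by ring

end IsCoordChange

end CoordinateChange

section CoordinateChange

variable {n : ℕ}

/-! ### Invariance of contractions -/

theorem mul_inv_congr_mul {A J : Matrix (Fin n) (Fin n) ℝ} (hJ : J.det ≠ 0) :
    J * (J.transpose * A * J)⁻¹ * J.transpose = A⁻¹ := by
  have h1 := isUnit_iff_ne_zero.2 hJ
  have h2 : IsUnit J.transpose.det := by rwa [Matrix.det_transpose]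
  rw [Matrix.mul_inv_rev, Matrix.mul_inv_rev, ← Matrix.mul_assoc, Matrix.mul_nonsing_inv _ h1,
    Matrix.one_mul, Matrix.mul_assoc, Matrix.nonsing_inv_mul _ h2, Matrix.mul_one]

theorem sum_mul_sum_congr (J B : Matrix (Fin n) (Fin n) ℝ) (C : Fin n → Fin n → ℝ) :
    ∑ i, ∑ j, B i j * ∑ a, ∑ b, C a b * J a i * J b j =
      ∑ a, ∑ b, (J * B * J.transpose) a b * C a b := by
  simp only [Matrix.mul_apply, Matrix.transpose_apply, Finset.mul_sum, Finset.sum_mul]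
  exact sum_reindex_four (fun (i, j, a, b) => (a, b, j, i)) (fun (a, b, j, i) => (i, j, a, b))
    (fun _ => rfl) (fun _ => rfl) fun i j a b => by dsimp only; ring

theorem sum_congr_mul (J T : Matrix (Fin n) (Fin n) ℝ) (x : Fin n → ℝ) (l : Fin n) :
    ∑ a, (J.transpose * T * J) l a * x a = ∑ b, J b l * ∑ c, T b c * ∑ a, J c a * x a := by
  simp only [Matrix.mul_apply, Matrix.transpose_apply, Finset.mul_sum, Finset.sum_mul]
  exact sum_reindex_three (fun (a, c, b) => (b, c, a)) (fun (b, c, a) => (a, c, b))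
    (fun _ => rfl) (fun _ => rfl) fun i j a => by dsimp only; ring

theorem traceCoord_congr {A J : Matrix (Fin n) (Fin n) ℝ} (hJ : J.det ≠ 0)
    (T : Matrix (Fin n) (Fin n) ℝ) :
    traceCoord (J.transpose * A * J) (J.transpose * T * J) = traceCoord A T := by
  unfold traceCoord
  rw [← mul_inv_congr_mul (A := A) hJ]
  refine Eq.trans ?_ (sum_mul_sum_congr J _ fun i j => T i j)
  refine sum_congr_two fun i j => congrArg _ ?_
  simp only [Matrix.mul_apply, Matrix.transpose_apply, Finset.sum_mul]
  rw [Finset.sum_comm]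
  exact sum_congr_two fun a b => by ring

theorem innerCoord_eq_traceCoord (A T V : Matrix (Fin n) (Fin n) ℝ) :
    innerCoord A T V = traceCoord A (T * A⁻¹ * V.transpose) := by
  simp only [innerCoord, traceCoord, Matrix.mul_apply, Matrix.transpose_apply, Finset.mul_sum,
    Finset.sum_mul]
  exact sum_reindex_four (fun (i, j, a, b) => (i, a, b, j)) (fun (i, a, b, j) => (i, j, a, b))
    (fun _ => rfl) (fun _ => rfl) fun i j a b => by dsimp only; ring

theorem innerCoord_congr {A J : Matrix (Fin n) (Fin n) ℝ} (hJ : J.det ≠ 0)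
    (T V : Matrix (Fin n) (Fin n) ℝ) :
    innerCoord (J.transpose * A * J) (J.transpose * T * J) (J.transpose * V * J) =
      innerCoord A T V := by
  rw [innerCoord_eq_traceCoord, innerCoord_eq_traceCoord, ← traceCoord_congr (A := A) hJ,
    ← mul_inv_congr_mul (A := A) hJ]
  simp only [Matrix.transpose_mul, Matrix.transpose_transpose, Matrix.mul_assoc]

theorem densityCoord_congr (A J : Matrix (Fin n) (Fin n) ℝ) (t : ℝ) :
    densityCoord (J.transpose * A * J) t = |J.det| * densityCoord A t := by
  have : (J.transpose * A * J).det = J.det ^ 2 * A.det := by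
    rw [Matrix.det_mul, Matrix.det_mul, Matrix.det_transpose]
    ring
  rw [densityCoord, this, Real.sqrt_mul (sq_nonneg _), Real.sqrt_sq_eq_abs, densityCoord, mul_assoc]

theorem sum_mul_sharp_congr {A J : Matrix (Fin n) (Fin n) ℝ} (hJ : J.det ≠ 0) {α' α : Fin n → ℝ}
    (hα : ∀ l, α' l = ∑ a, J a l * α a) (k : Fin n) :
    ∑ l, J k l * sharp (J.transpose * A * J) α' l = sharp A α k := by
  have h1 := mul_inv_congr_mul (A := A) hJ
  unfold sharp
  generalize (J.transpose * A * J)⁻¹ = B at h1 ⊢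
  rw [← h1]
  simp only [hα, Matrix.mul_apply, Matrix.transpose_apply, Finset.mul_sum, Finset.sum_mul]
  exact sum_reindex_three (fun (l, b, a) => (a, b, l)) (fun (a, b, l) => (l, b, a))
    (fun _ => rfl) (fun _ => rfl) fun l b a => by dsimp only; ring

namespace IsMetricFamily

variable {Ω : Set (ℝ × EuclideanSpace ℝ (Fin n))}
  {G : ℝ → EuclideanSpace ℝ (Fin n) → Matrix (Fin n) (Fin n) ℝ} {s : ℝ}
  {y : EuclideanSpace ℝ (Fin n)}

theorem hasDerivAt_connectionForm_apply (hG : IsMetricFamily Ω G) (hz : (s, y) ∈ Ω)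
    (u v : EuclideanSpace ℝ (Fin n)) (k : Fin n) :
    HasDerivAt (fun t => connectionForm (G t) y u v k)
      (bilinMap (fun k i j => christoffelVar G s k i j y) u v k) s := by
  simp only [connectionForm, bilinMap_apply]
  exact HasDerivAt.fun_sum fun i _ => HasDerivAt.fun_sum fun j _ =>
    ((hG.hasDerivAt_christoffel hz k i j).mul_const _).mul_const _

end IsMetricFamily

namespace IsCoordChange

variable {U : Set (EuclideanSpace ℝ (Fin n))}
  {Φ : EuclideanSpace ℝ (Fin n) → EuclideanSpace ℝ (Fin n)} {s : ℝ}
  {G' G : ℝ → EuclideanSpace ℝ (Fin n) → Matrix (Fin n) (Fin n) ℝ}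
  {φ' φ : ℝ → EuclideanSpace ℝ (Fin n) → ℝ}
  {Ω' Ω : Set (ℝ × EuclideanSpace ℝ (Fin n))} {y : EuclideanSpace ℝ (Fin n)}

theorem weightedScalarCoord_eq (h : IsCoordChange U Φ s G' G Ω' Ω) (hy : y ∈ U) (κ : ℝ)
    {f' f : EuclideanSpace ℝ (Fin n) → ℝ} (hf : ContDiffAt ℝ ∞ f (Φ y))
    (hff : f' =ᶠ[𝓝 y] f ∘ Φ) :
    weightedScalarCoord κ (G' s) f' y = weightedScalarCoord κ (G s) f (Φ y) := by
  rw [weightedScalarCoord, h.metric_eq y hy, h.ricciCoord_eq hy, h.hessianCoord_eq hy hf hff,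
    h.diffSqCoord_eq hy (hf.differentiableAt (by simp)) hff,
    traceCoord_congr (h.det_ne_zero hy), traceCoord_congr (h.det_ne_zero hy),
    traceCoord_congr (h.det_ne_zero hy), weightedScalarCoord]

theorem weightedLaplacianCoord_eq (h : IsCoordChange U Φ s G' G Ω' Ω) (hy : y ∈ U)
    {f' f : EuclideanSpace ℝ (Fin n) → ℝ} (hf : ContDiffAt ℝ ∞ f (Φ y))
    (hff : f' =ᶠ[𝓝 y] f ∘ Φ) :
    weightedLaplacianCoord (G' s) f' y = weightedLaplacianCoord (G s) f (Φ y) := by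
  rw [weightedLaplacianCoord, h.metric_eq y hy, h.hessianCoord_eq hy hf hff,
    h.diffSqCoord_eq hy (hf.differentiableAt (by simp)) hff,
    traceCoord_congr (h.det_ne_zero hy), traceCoord_congr (h.det_ne_zero hy),
    weightedLaplacianCoord]

theorem bakryEmeryCoord_eq (h : IsCoordChange U Φ s G' G Ω' Ω) (hy : y ∈ U) (κ : ℝ)
    {f' f : EuclideanSpace ℝ (Fin n) → ℝ} (hf : ContDiffAt ℝ ∞ f (Φ y))
    (hff : f' =ᶠ[𝓝 y] f ∘ Φ) :
    bakryEmeryCoord κ (G' s) f' y = (matrixOf (fderiv ℝ Φ y)).transpose *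
      bakryEmeryCoord κ (G s) f (Φ y) * matrixOf (fderiv ℝ Φ y) := by
  rw [bakryEmeryCoord, h.ricciCoord_eq hy, h.hessianCoord_eq hy hf hff,
    h.diffSqCoord_eq hy (hf.differentiableAt (by simp)) hff, bakryEmeryCoord]
  simp only [Matrix.mul_add, Matrix.add_mul, Matrix.mul_sub, Matrix.sub_mul, Matrix.mul_smul,
    Matrix.smul_mul]

theorem metricVar_eq (h : ∀ᶠ t in 𝓝 s, IsCoordChange U Φ t G' G Ω' Ω) (hy : y ∈ U) :
    metricVar G' s y = (matrixOf (fderiv ℝ Φ y)).transpose * metricVar G s (Φ y) *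
      matrixOf (fderiv ℝ Φ y) := by
  have hs := h.self_of_nhds
  ext i j
  have h1 := hs.left.hasDerivAt_metric (hs.mem_left y hy) i j
  have h2 : HasDerivAt (fun t => ((matrixOf (fderiv ℝ Φ y)).transpose * G t (Φ y) *
      matrixOf (fderiv ℝ Φ y)) i j) (((matrixOf (fderiv ℝ Φ y)).transpose *
        metricVar G s (Φ y) * matrixOf (fderiv ℝ Φ y)) i j) s := by
    simp only [Matrix.mul_apply]
    exact HasDerivAt.fun_sum fun k _ => (HasDerivAt.fun_sum fun l _ =>
      (hs.right.hasDerivAt_metric (hs.mem_right y hy) l k).const_mul _).mul_const _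
  refine h1.unique (h2.congr_of_eventuallyEq ?_)
  filter_upwards [h] with t ht
  rw [ht.metric_eq y hy]

/-- The variation of the connection is a tensor. -/
theorem sum_mul_christoffelVar_eq (h : ∀ᶠ t in 𝓝 s, IsCoordChange U Φ t G' G Ω' Ω) (hy : y ∈ U)
    (k i j : Fin n) :
    ∑ l, matrixOf (fderiv ℝ Φ y) k l * christoffelVar G' s l i j y =
      ∑ a, ∑ b, christoffelVar G s k a b (Φ y) * matrixOf (fderiv ℝ Φ y) a i *
        matrixOf (fderiv ℝ Φ y) b j := by
  have hs := h.self_of_nhds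
  set u : EuclideanSpace ℝ (Fin n) := EuclideanSpace.single i 1
  set v : EuclideanSpace ℝ (Fin n) := EuclideanSpace.single j 1
  have h1 : HasDerivAt (fun t => fderiv ℝ Φ y (connectionForm (G' t) y u v) k)
      (∑ l, matrixOf (fderiv ℝ Φ y) k l *
        bilinMap (fun k i j => christoffelVar G' s k i j y) u v l) s := by
    simp only [apply_eq_sum (fderiv ℝ Φ y)]
    exact HasDerivAt.fun_sum fun l _ =>
      (hs.left.hasDerivAt_connectionForm_apply (hs.mem_left y hy) u v l).const_mul _
  have h2 := (hs.right.hasDerivAt_connectionForm_apply (hs.mem_right y hy) (fderiv ℝ Φ y u)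
    (fderiv ℝ Φ y v) k).const_add (fderiv ℝ (fderiv ℝ Φ) y u v k)
  have h3 := h1.unique (h2.congr_of_eventuallyEq (by
    filter_upwards [h] with t ht
    rw [ht.connectionForm_eq hy]
    rfl))
  have h4 : ∀ l, bilinMap (fun k i j => christoffelVar G' s k i j y) u v l =
      christoffelVar G' s l i j y := by
    intro l
    simp [bilinMap_apply, u, v]
  rw [bilinMap_apply] at h3
  simp only [h4] at h3
  exact h3

/-- The trace of the variation of the connection is a one-form. -/
theorem sum_christoffelVar_eq (h : ∀ᶠ t in 𝓝 s, IsCoordChange U Φ t G' G Ω' Ω) (hy : y ∈ U)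
    (i : Fin n) : ∑ l, christoffelVar G' s l i l y =
      ∑ a, matrixOf (fderiv ℝ Φ y) a i * ∑ l, christoffelVar G s l a l (Φ y) := by
  set J := matrixOf (fderiv ℝ Φ y) with hJ
  have hu := isUnit_iff_ne_zero.2 (h.self_of_nhds.det_ne_zero hy)
  have h1 : J * (Matrix.of fun l j => christoffelVar G' s l i j y) =
      (Matrix.of fun k b => ∑ a, christoffelVar G s k a b (Φ y) * J a i) * J := by
    ext k j
    rw [Matrix.mul_apply, Matrix.mul_apply]
    simp only [Matrix.of_apply, Finset.sum_mul]
    rw [sum_mul_christoffelVar_eq h hy, Finset.sum_comm]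
  have h2 : (Matrix.of fun l j => christoffelVar G' s l i j y) =
      J⁻¹ * ((Matrix.of fun k b => ∑ a, christoffelVar G s k a b (Φ y) * J a i) * J) := by
    rw [← h1, ← Matrix.mul_assoc, Matrix.nonsing_inv_mul _ hu, Matrix.one_mul]
  have h3 := congrArg Matrix.trace h2
  rw [Matrix.trace_mul_comm, Matrix.mul_assoc, Matrix.mul_nonsing_inv _ hu, Matrix.mul_one] at h3
  simp only [Matrix.trace, Matrix.diag, Matrix.of_apply] at h3
  rw [h3, Finset.sum_comm]
  refine Finset.sum_congr rfl fun a _ => ?_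
  rw [Finset.mul_sum]
  exact Finset.sum_congr rfl fun l _ => mul_comm _ _

/-- The Palatini field transforms as a vector field. -/
theorem palatiniField_eq (h : ∀ᶠ t in 𝓝 s, IsCoordChange U Φ t G' G Ω' Ω) (hy : y ∈ U)
    (k : Fin n) : ∑ l, matrixOf (fderiv ℝ Φ y) k l * palatiniField G' s l y =
      palatiniField G s k (Φ y) := by
  have hs := h.self_of_nhds
  have hsymm : ∀ (Ω : Set (ℝ × EuclideanSpace ℝ (Fin n)))
      (G : ℝ → EuclideanSpace ℝ (Fin n) → Matrix (Fin n) (Fin n) ℝ)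
      (y : EuclideanSpace ℝ (Fin n)), IsMetricFamily Ω G → (s, y) ∈ Ω → ∀ k,
      palatiniField G s k y = (∑ i, ∑ j, (G s y)⁻¹ i j * christoffelVar G s k i j y) -
        sharp (G s y) (fun i => ∑ l, christoffelVar G s l i l y) k := by
    intro Ω G y hG hz k
    rw [palatiniField, sharp]
    simp only [hG.inv_symm hz k]
  simp only [hsymm Ω' G' y hs.left (hs.mem_left y hy), hsymm Ω G _ hs.right (hs.mem_right y hy),
    mul_sub, Finset.sum_sub_distrib]
  set J := matrixOf (fderiv ℝ Φ y) with hJ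
  rw [hs.metric_eq y hy, ← hJ]
  refine congrArg₂ (fun a b : ℝ => a - b) ?_ ?_
  · rw [← mul_inv_congr_mul (A := G s (Φ y)) (hs.det_ne_zero hy), ← hJ]
    set B := (J.transpose * G s (Φ y) * J)⁻¹
    have h1 : ∑ l, J k l * ∑ i, ∑ j, B i j * christoffelVar G' s l i j y =
        ∑ i, ∑ j, B i j * ∑ l, J k l * christoffelVar G' s l i j y := by
      simp only [Finset.mul_sum]
      exact sum_reindex_three (fun (l, i, j) => (i, j, l)) (fun (i, j, l) => (l, i, j))
        (fun _ => rfl) (fun _ => rfl) fun l i j => by dsimp only; ring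
    refine h1.trans (Eq.trans ?_ (sum_mul_sum_congr J B fun a b => christoffelVar G s k a b (Φ y)))
    exact sum_congr_two fun i j => congrArg _ (sum_mul_christoffelVar_eq h hy k i j)
  · exact sum_mul_sharp_congr (hs.det_ne_zero hy) (sum_christoffelVar_eq h hy) k

theorem gradCoord_eq (h : IsCoordChange U Φ s G' G Ω' Ω) (hy : y ∈ U)
    (hφ : DifferentiableAt ℝ (φ s) (Φ y)) (hff : φ' s =ᶠ[𝓝 y] φ s ∘ Φ) (k : Fin n) :
    ∑ l, matrixOf (fderiv ℝ Φ y) k l * gradCoord G' φ' s l y = gradCoord G φ s k (Φ y) := by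
  unfold gradCoord
  rw [h.metric_eq y hy]
  exact sum_mul_sharp_congr (h.det_ne_zero hy) (h.pd_eq hy hφ hff) k

theorem contractionForm_eq (h : ∀ᶠ t in 𝓝 s, IsCoordChange U Φ t G' G Ω' Ω) (hy : y ∈ U)
    (hφ : DifferentiableAt ℝ (φ s) (Φ y)) (hff : φ' s =ᶠ[𝓝 y] φ s ∘ Φ) (l : Fin n) :
    contractionForm G' φ' s l y =
      ∑ a, matrixOf (fderiv ℝ Φ y) a l * contractionForm G φ s a (Φ y) := by
  have hs := h.self_of_nhds
  have hg := fun k => hs.gradCoord_eq hy hφ hff k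
  simp only [gradCoord] at hg
  simp only [contractionForm, ← hg, hs.pd_eq hy hφ hff]
  rw [metricVar_eq h hy, hs.metric_eq y hy, traceCoord_congr (hs.det_ne_zero hy),
    ← hs.metric_eq y hy]
  set J := matrixOf (fderiv ℝ Φ y) with hJ
  simp only [mul_sub, Finset.sum_sub_distrib]
  refine congrArg₂ (fun a b : ℝ => a - b) ?_ ?_
  · exact sum_congr_mul J _ _ l
  · rw [Finset.mul_sum]
    exact Finset.sum_congr rfl fun a _ => by ring

/-- The flux density is a vector density. -/
theorem fluxDensity_eq (h : ∀ᶠ t in 𝓝 s, IsCoordChange U Φ t G' G Ω' Ω)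
    (hφ' : JointlySmoothOn Ω' φ') (hφ : JointlySmoothOn Ω φ)
    (hff : ∀ᶠ t in 𝓝 s, ∀ x ∈ U, φ' t x = φ t (Φ x)) (hy : y ∈ U) (κ : ℝ) (k : Fin n) :
    ∑ l, matrixOf (fderiv ℝ Φ y) k l * fluxDensity κ G' φ' s l y =
      |(matrixOf (fderiv ℝ Φ y)).det| * fluxDensity κ G φ s k (Φ y) := by
  have hs := h.self_of_nhds
  have hev : ∀ᶠ t in 𝓝 s, φ' t =ᶠ[𝓝 y] φ t ∘ Φ := by
    filter_upwards [hff] with t ht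
    filter_upwards [hs.isOpen.mem_nhds hy] with x hx using ht x hx
  have hd := hφ.differentiableAt hs.right.isOpen (hs.mem_right y hy)
  have hψ : deriv (fun t => φ' t y) s = deriv (fun t => φ t (Φ y)) s := by
    refine Filter.EventuallyEq.deriv_eq ?_
    filter_upwards [hff] with t ht using ht y hy
  have hw : ∀ᶠ t in 𝓝 s, densityCoord (G' t y) (φ' t y) =
      |(matrixOf (fderiv ℝ Φ y)).det| * densityCoord (G t (Φ y)) (φ t (Φ y)) := by
    filter_upwards [h, hff] with t ht ht'
    rw [ht.metric_eq y hy, densityCoord_congr, ht' y hy]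
  have hg : ∀ᶠ t in 𝓝 s, ∑ l, matrixOf (fderiv ℝ Φ y) k l *
      (densityCoord (G' t y) (φ' t y) * gradCoord G' φ' t l y) =
      |(matrixOf (fderiv ℝ Φ y)).det| *
        (densityCoord (G t (Φ y)) (φ t (Φ y)) * gradCoord G φ t k (Φ y)) := by
    filter_upwards [h, hev, hw] with t ht ht' htw
    rw [htw, ← mul_assoc, ← ht.gradCoord_eq hy
      (hφ.differentiableAt ht.right.isOpen (ht.mem_right y hy)) ht', Finset.mul_sum]
    exact Finset.sum_congr rfl fun l _ => by ring
  have hA : HasDerivAt (fun t => ∑ l, matrixOf (fderiv ℝ Φ y) k l *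
      (densityCoord (G' t y) (φ' t y) * gradCoord G' φ' t l y))
      (∑ l, matrixOf (fderiv ℝ Φ y) k l *
        deriv (fun t => densityCoord (G' t y) (φ' t y) * gradCoord G' φ' t l y) s) s :=
    HasDerivAt.fun_sum fun l _ => ((hs.left.gradDensity_smooth hφ' l).hasDerivAt hs.left.isOpen
      (hs.mem_left y hy)).const_mul _
  have hB := ((hs.right.gradDensity_smooth hφ k).hasDerivAt hs.right.isOpen
      (hs.mem_right y hy)).const_mul |(matrixOf (fderiv ℝ Φ y)).det|
  have hC := hA.unique (hB.congr_of_eventuallyEq hg)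
  have h1 := palatiniField_eq h hy k
  have h2 : ∑ l, matrixOf (fderiv ℝ Φ y) k l *
      sharp (G' s y) (fun a => contractionForm G' φ' s a y) l =
      sharp (G s (Φ y)) (fun a => contractionForm G φ s a (Φ y)) k := by
    rw [hs.metric_eq y hy]
    exact sum_mul_sharp_congr (hs.det_ne_zero hy)
      (contractionForm_eq h hy hd hev.self_of_nhds) k
  have h3 : ∑ l, matrixOf (fderiv ℝ Φ y) k l *
      sharp (G' s y) (fun a => deriv (fun t => φ' t y) s * pd a (φ' s) y) l =
      sharp (G s (Φ y)) (fun a => deriv (fun t => φ t (Φ y)) s * pd a (φ s) (Φ y)) k := by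
    rw [hs.metric_eq y hy]
    refine sum_mul_sharp_congr (hs.det_ne_zero hy) (fun l => ?_) k
    rw [hψ, hs.pd_eq hy hd hev.self_of_nhds, Finset.mul_sum]
    exact Finset.sum_congr rfl fun a _ => by ring
  have h4 : ∑ l, matrixOf (fderiv ℝ Φ y) k l * fluxDensity κ G' φ' s l y =
      densityCoord (G' s y) (φ' s y) *
        (∑ l, matrixOf (fderiv ℝ Φ y) k l * palatiniField G' s l y +
        ∑ l, matrixOf (fderiv ℝ Φ y) k l *
          sharp (G' s y) (fun a => contractionForm G' φ' s a y) l +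
        2 * (1 - κ) * ∑ l, matrixOf (fderiv ℝ Φ y) k l *
          sharp (G' s y) (fun a => deriv (fun t => φ' t y) s * pd a (φ' s) y) l) +
        2 * ∑ l, matrixOf (fderiv ℝ Φ y) k l *
          deriv (fun t => densityCoord (G' t y) (φ' t y) * gradCoord G' φ' t l y) s := by
    simp only [Finset.mul_sum, ← Finset.sum_add_distrib]
    exact Finset.sum_congr rfl fun l _ => by rw [fluxDensity]; ring
  rw [h4, h1, h2, h3, hC, hw.self_of_nhds, fluxDensity]
  ring

end IsCoordChange

end CoordinateChange

/-! ### Tensor fields and functions in the charts of a manifold -/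

section Charts

variable {n : ℕ} {M : Type*} [TopologicalSpace M] [ChartedSpace (EuclideanSpace ℝ (Fin n)) M]
  [IsManifold (𝓡 n) ∞ M]

/-- The derivative of the inverse of the chart centred at `a`, the tangent space being identified
with the model space. -/
def chartDeriv (a : M) (y : EuclideanSpace ℝ (Fin n)) :
    EuclideanSpace ℝ (Fin n) →L[ℝ] EuclideanSpace ℝ (Fin n) :=
  mfderiv 𝓘(ℝ, EuclideanSpace ℝ (Fin n)) (𝓡 n) (extChartAt (𝓡 n) a).symm y

/-- The change of coordinates from the chart centred at `a` to the chart centred at `b`. -/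
def chartChange (a b : M) (y : EuclideanSpace ℝ (Fin n)) : EuclideanSpace ℝ (Fin n) :=
  extChartAt (𝓡 n) b ((extChartAt (𝓡 n) a).symm y)

/-- The overlap of two charts, in the coordinates of the first. -/
def chartOverlap (a b : M) : Set (EuclideanSpace ℝ (Fin n)) :=
  (extChartAt (𝓡 n) a).target ∩ (extChartAt (𝓡 n) a).symm ⁻¹' (extChartAt (𝓡 n) b).source

omit [IsManifold (𝓡 n) ∞ M] in
theorem isOpen_chartOverlap (a b : M) :
    IsOpen (chartOverlap a b : Set (EuclideanSpace ℝ (Fin n))) :=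
  (continuousOn_extChartAt_symm a).isOpen_inter_preimage (isOpen_extChartAt_target a)
    (isOpen_extChartAt_source b)

theorem contDiffOn_chartChange (a b : M) :
    ContDiffOn ℝ ∞ (chartChange a b) (chartOverlap a b : Set (EuclideanSpace ℝ (Fin n))) :=
  contDiffOn_ext_coord_change (I := 𝓡 n) (n := ∞) b a

omit [IsManifold (𝓡 n) ∞ M] in
theorem chartChange_mem {a b : M} {y : EuclideanSpace ℝ (Fin n)} (hy : y ∈ chartOverlap a b) :
    chartChange a b y ∈ (extChartAt (𝓡 n) b).target :=
  (extChartAt (𝓡 n) b).map_source hy.2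

omit [IsManifold (𝓡 n) ∞ M] in
theorem symm_chartChange {a b : M} {y : EuclideanSpace ℝ (Fin n)} (hy : y ∈ chartOverlap a b) :
    (extChartAt (𝓡 n) b).symm (chartChange a b y) = (extChartAt (𝓡 n) a).symm y :=
  (extChartAt (𝓡 n) b).left_inv hy.2

omit [IsManifold (𝓡 n) ∞ M] in
theorem funCoord_chartChange (f : M → ℝ) {a b : M} {y : EuclideanSpace ℝ (Fin n)}
    (hy : y ∈ chartOverlap a b) : funCoord f b (chartChange a b y) = funCoord f a y := by
  rw [funCoord, symm_chartChange hy, funCoord]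

theorem mdifferentiableAt_chart_symm (a : M) {y : EuclideanSpace ℝ (Fin n)}
    (hy : y ∈ (extChartAt (𝓡 n) a).target) :
    MDifferentiableAt 𝓘(ℝ, EuclideanSpace ℝ (Fin n)) (𝓡 n) (extChartAt (𝓡 n) a).symm y :=
  ((contMDiffOn_extChartAt_symm (n := ∞) a).contMDiffAt
    ((isOpen_extChartAt_target a).mem_nhds hy)).mdifferentiableAt (by simp)

theorem chartDeriv_eq {a b : M} {y : EuclideanSpace ℝ (Fin n)} (hy : y ∈ chartOverlap a b)
    (v : EuclideanSpace ℝ (Fin n)) :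
    chartDeriv a y v = chartDeriv b (chartChange a b y) (fderiv ℝ (chartChange a b) y v) := by
  have h1 : (extChartAt (𝓡 n) a).symm =ᶠ[𝓝 y]
      (extChartAt (𝓡 n) b).symm ∘ chartChange a b := by
    filter_upwards [(isOpen_chartOverlap a b).mem_nhds hy] with x hx
    exact (symm_chartChange hx).symm
  have h2 : MDifferentiableAt 𝓘(ℝ, EuclideanSpace ℝ (Fin n)) 𝓘(ℝ, EuclideanSpace ℝ (Fin n))
      (chartChange a b) y :=
    (((contDiffOn_chartChange a b).contDiffAt
      ((isOpen_chartOverlap a b).mem_nhds hy)).differentiableAt (by simp)).mdifferentiableAt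
  have h3 := ((mdifferentiableAt_chart_symm b (chartChange_mem hy)).hasMFDerivAt.comp y
    h2.hasMFDerivAt).congr_of_eventuallyEq h1
  unfold chartDeriv
  rw [h3.mfderiv, mfderiv_eq_fderiv]
  rfl

omit [IsManifold (𝓡 n) ∞ M] in
theorem tensor_apply_congr
    (T : ∀ x : M, TangentSpace (𝓡 n) x →L[ℝ] TangentSpace (𝓡 n) x →L[ℝ] ℝ) {x x' : M}
    (h : x = x') (u v : EuclideanSpace ℝ (Fin n)) : T x u v = T x' u v := by
  subst h
  rfl

omit [IsManifold (𝓡 n) ∞ M] in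
theorem bilinForm_tensorCoord
    (T : ∀ x : M, TangentSpace (𝓡 n) x →L[ℝ] TangentSpace (𝓡 n) x →L[ℝ] ℝ) (a : M)
    (y u v : EuclideanSpace ℝ (Fin n)) :
    bilinForm (tensorCoord T a y) u v =
      T ((extChartAt (𝓡 n) a).symm y) (chartDeriv a y u) (chartDeriv a y v) := by
  let B : EuclideanSpace ℝ (Fin n) →L[ℝ] EuclideanSpace ℝ (Fin n) →L[ℝ] ℝ :=
    T ((extChartAt (𝓡 n) a).symm y)
  have hu : ∀ u : EuclideanSpace ℝ (Fin n),
      u = ∑ m, u m • (EuclideanSpace.single m (1 : ℝ) : EuclideanSpace ℝ (Fin n)) := by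
    intro u
    ext i
    simp [Pi.single_apply]
  have h1 : ∀ u v, B (chartDeriv a y u) (chartDeriv a y v) = ∑ i, ∑ j,
      B (chartDeriv a y (EuclideanSpace.single i 1)) (chartDeriv a y (EuclideanSpace.single j 1))
        * u i * v j := by
    intro u v
    have e1 : B (chartDeriv a y u) (chartDeriv a y v) = ∑ i, u i *
        B (chartDeriv a y (EuclideanSpace.single i 1)) (chartDeriv a y v) := by
      conv_lhs => rw [hu u]
      simp [sum_apply]
    have e2 : ∀ w, B w (chartDeriv a y v) = ∑ j, v j *
        B w (chartDeriv a y (EuclideanSpace.single j 1)) := by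
      intro w
      conv_lhs => rw [hu v]
      simp
    rw [e1]
    simp only [e2, Finset.mul_sum]
    exact sum_congr_two fun i j => by ring
  rw [bilinForm_apply]
  exact (h1 u v).symm

/-- The transformation law of `(0,2)`-tensors. -/
theorem tensorCoord_eq
    (T : ∀ x : M, TangentSpace (𝓡 n) x →L[ℝ] TangentSpace (𝓡 n) x →L[ℝ] ℝ) {a b : M}
    {y : EuclideanSpace ℝ (Fin n)} (hy : y ∈ chartOverlap a b) :
    tensorCoord T a y = (matrixOf (fderiv ℝ (chartChange a b) y)).transpose *
      tensorCoord T b (chartChange a b y) * matrixOf (fderiv ℝ (chartChange a b) y) := by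
  refine bilinForm_injective fun u v => ?_
  rw [bilinForm_congr, bilinForm_tensorCoord, bilinForm_tensorCoord, chartDeriv_eq hy,
    chartDeriv_eq hy]
  exact tensor_apply_congr T (symm_chartChange hy).symm _ _

theorem chartDeriv_self (p : M) (v : EuclideanSpace ℝ (Fin n)) :
    chartDeriv p (extChartAt (𝓡 n) p p) v = v := by
  have := mfderivWithin_range_extChartAt_symm (I := 𝓡 n) (x := p)
  rw [ModelWithCorners.Boundaryless.range_eq_univ, mfderivWithin_univ] at this
  unfold chartDeriv
  rw [this]
  rfl

theorem tensorAt_apply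
    (T : ∀ x : M, TangentSpace (𝓡 n) x →L[ℝ] TangentSpace (𝓡 n) x →L[ℝ] ℝ) (p : M)
    (u v : EuclideanSpace ℝ (Fin n)) : bilinForm (tensorAt T p) u v = T p u v := by
  rw [tensorAt, bilinForm_tensorCoord, chartDeriv_self, chartDeriv_self]
  exact tensor_apply_congr T (extChartAt_to_inv p) _ _

/-- The trivialization of the bundle of `(0,2)`-tensors given by a chart. -/
theorem trivialization_apply {a x : M} (hx : x ∈ (extChartAt (𝓡 n) a).source)
    (A : TangentSpace (𝓡 n) x →L[ℝ] TangentSpace (𝓡 n) x →L[ℝ] ℝ)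
    (T : ∀ x : M, TangentSpace (𝓡 n) x →L[ℝ] TangentSpace (𝓡 n) x →L[ℝ] ℝ) (hA : A = T x) :
    (trivializationAt (EuclideanSpace ℝ (Fin n) →L[ℝ] EuclideanSpace ℝ (Fin n) →L[ℝ] ℝ)
      (fun x : M => TangentSpace (𝓡 n) x →L[ℝ] TangentSpace (𝓡 n) x →L[ℝ] ℝ) a
      (Bundle.TotalSpace.mk' (EuclideanSpace ℝ (Fin n) →L[ℝ] EuclideanSpace ℝ (Fin n) →L[ℝ] ℝ)
        x A)).2 = bilinForm (tensorCoord T a (extChartAt (𝓡 n) a x)) := by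
  subst hA
  have hx' : x ∈ (chartAt (EuclideanSpace ℝ (Fin n)) a).source := by
    rwa [← extChartAt_source (𝓡 n)]
  ext u v
  rw [hom_trivializationAt_apply, inCoordinates_apply_eq₂ (by simpa using hx') (by simpa using hx')
    (by simp), bilinForm_tensorCoord]
  have h1 : ∀ u : EuclideanSpace ℝ (Fin n),
      (trivializationAt (EuclideanSpace ℝ (Fin n)) (TangentSpace (𝓡 n)) a).symm x u =
        chartDeriv a (extChartAt (𝓡 n) a x) u := by
    intro u
    have := TangentBundle.symmL_trivializationAt (I := 𝓡 n) hx'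
    rw [ModelWithCorners.Boundaryless.range_eq_univ, mfderivWithin_univ] at this
    rw [← Bundle.Trivialization.symmL_apply (R := ℝ) _ (by simpa using hx'), this]
    rfl
  rw [h1, h1]
  have h2 : ∀ r : ℝ, (trivializationAt ℝ (fun _ : M => ℝ) a).linearMapAt ℝ x r = r := by
    intro r
    simp
  erw [h2]
  exact tensor_apply_congr T ((extChartAt (𝓡 n) a).left_inv hx).symm _ _

theorem contDiffOn_sum_smul {ι F V : Type*} [Fintype ι] [NormedAddCommGroup F] [NormedSpace ℝ F]
    [NormedAddCommGroup V] [NormedSpace ℝ V] {c : ι → F → ℝ} {D : Set F}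
    (hc : ∀ i, ContDiffOn ℝ ∞ (c i) D) (b : ι → V) :
    ContDiffOn ℝ ∞ (fun z => ∑ i, c i z • b i) D :=
  ContDiffOn.sum fun i _ => (hc i).smul contDiffOn_const

theorem contDiffOn_bilinForm {F : Type*} [NormedAddCommGroup F] [NormedSpace ℝ F]
    {A : F → Matrix (Fin n) (Fin n) ℝ} {V : Set F}
    (hA : ∀ i j, ContDiffOn ℝ ∞ (fun z => A z i j) V) :
    ContDiffOn ℝ ∞ (fun z => bilinForm (A z)) V := by
  unfold bilinForm
  exact contDiffOn_sum_smul
    (V := EuclideanSpace ℝ (Fin n) →L[ℝ] EuclideanSpace ℝ (Fin n) →L[ℝ] ℝ)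
    (c := fun (p : Fin n × Fin n) z => A z p.1 p.2) (fun p => hA p.1 p.2) _

theorem contDiffOn_of_bilinForm {F : Type*} [NormedAddCommGroup F] [NormedSpace ℝ F]
    {A : F → Matrix (Fin n) (Fin n) ℝ} {V : Set F}
    (hA : ContDiffOn ℝ ∞ (fun z => bilinForm (A z)) V) (i j : Fin n) :
    ContDiffOn ℝ ∞ (fun z => A z i j) V := by
  have h1 : ContDiffOn ℝ ∞ (fun z => bilinForm (A z)
      (EuclideanSpace.single i (1 : ℝ) : EuclideanSpace ℝ (Fin n))) V :=
    ContDiffOn.clm_apply (F := EuclideanSpace ℝ (Fin n)) (G := EuclideanSpace ℝ (Fin n) →L[ℝ] ℝ)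
      hA contDiffOn_const
  have h2 : ContDiffOn ℝ ∞ (fun z => bilinForm (A z)
      (EuclideanSpace.single i (1 : ℝ) : EuclideanSpace ℝ (Fin n))
      (EuclideanSpace.single j (1 : ℝ) : EuclideanSpace ℝ (Fin n))) V :=
    ContDiffOn.clm_apply (F := EuclideanSpace ℝ (Fin n)) (G := ℝ) h1 contDiffOn_const
  refine h2.congr fun z _ => ?_
  simp [bilinForm_apply]

theorem contMDiffOn_prod_chart_symm (O : Set ℝ) (a : M) :
    ContMDiffOn 𝓘(ℝ, ℝ × EuclideanSpace ℝ (Fin n)) (𝓘(ℝ, ℝ).prod (𝓡 n)) ∞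
      (fun z : ℝ × EuclideanSpace ℝ (Fin n) => (z.1, (extChartAt (𝓡 n) a).symm z.2))
      (O ×ˢ (extChartAt (𝓡 n) a).target) :=
  ContMDiffOn.prodMk contDiff_fst.contMDiff.contMDiffOn
    ((contMDiffOn_extChartAt_symm a).comp contDiff_snd.contMDiff.contMDiffOn fun _ hz => hz.2)

theorem contMDiffOn_prod_chart (O : Set ℝ) (a : M) :
    ContMDiffOn (𝓘(ℝ, ℝ).prod (𝓡 n)) 𝓘(ℝ, ℝ × EuclideanSpace ℝ (Fin n)) ∞
      (fun q : ℝ × M => (q.1, extChartAt (𝓡 n) a q.2))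
      (O ×ˢ (extChartAt (𝓡 n) a).source) := by
  have := (contMDiffOn_fst (s := O ×ˢ (extChartAt (𝓡 n) a).source) (n := ∞)
    (I := 𝓘(ℝ, ℝ)) (J := 𝓡 n)).prodMk_space
    ((contMDiffOn_extChartAt (x := a) (n := ∞) (I := 𝓡 n)).comp
      (contMDiffOn_snd (s := O ×ˢ (extChartAt (𝓡 n) a).source) (n := ∞)
        (I := 𝓘(ℝ, ℝ)) (J := 𝓡 n)) fun q hq => by
        rw [← extChartAt_source (𝓡 n)]; exact hq.2)
  exact this

/-- A family of sections of a vector bundle is smooth if and only if it is smooth in the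
trivializations over the charts. -/
theorem contMDiffOn_section_iff {F : Type*} [NormedAddCommGroup F] [NormedSpace ℝ F]
    (V : M → Type*) [∀ x, AddCommGroup (V x)] [∀ x, Module ℝ (V x)] [∀ x, TopologicalSpace (V x)]
    [TopologicalSpace (Bundle.TotalSpace F V)] [FiberBundle F V] [VectorBundle ℝ F V]
    [ContMDiffVectorBundle ∞ F V (𝓡 n)]
    (hV : ∀ a : M, (trivializationAt F V a).baseSet = (extChartAt (𝓡 n) a).source)
    {O : Set ℝ} (hO : IsOpen O) (T : ℝ → ∀ x : M, V x) :
    ContMDiffOn (𝓘(ℝ, ℝ).prod (𝓡 n)) ((𝓡 n).prod 𝓘(ℝ, F)) ∞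
      (fun q : ℝ × M => (Bundle.TotalSpace.mk' F q.2 (T q.1 q.2) : Bundle.TotalSpace F V))
      (O ×ˢ univ) ↔
    ∀ a, ContMDiffOn 𝓘(ℝ, ℝ × EuclideanSpace ℝ (Fin n)) 𝓘(ℝ, F) ∞
      (fun z : ℝ × EuclideanSpace ℝ (Fin n) => (trivializationAt F V a
        (Bundle.TotalSpace.mk' F ((extChartAt (𝓡 n) a).symm z.2)
          (T z.1 ((extChartAt (𝓡 n) a).symm z.2)))).2)
      (O ×ˢ (extChartAt (𝓡 n) a).target) := by
  have hsrc : ∀ a : M, MapsTo (fun q : ℝ × M =>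
        (Bundle.TotalSpace.mk' F q.2 (T q.1 q.2) : Bundle.TotalSpace F V))
      (O ×ˢ (extChartAt (𝓡 n) a).source) (trivializationAt F V a).source := by
    intro a q hq
    rw [Bundle.Trivialization.mem_source, hV]
    exact hq.2
  constructor
  · intro h a
    have h1 := ((Bundle.Trivialization.contMDiffOn_iff (e := trivializationAt F V a) (hsrc a)).1
      (h.mono (prod_mono subset_rfl (subset_univ _)))).2
    exact h1.comp (contMDiffOn_prod_chart_symm O a) fun z hz =>
      ⟨hz.1, (extChartAt (𝓡 n) a).map_target hz.2⟩
  · intro h q hq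
    set a := q.2
    have hqa : q ∈ O ×ˢ (extChartAt (𝓡 n) a).source := ⟨hq.1, mem_extChartAt_source a⟩
    have h1 := (h a).comp (contMDiffOn_prod_chart O a) fun q hq =>
      ⟨hq.1, (extChartAt (𝓡 n) a).map_source hq.2⟩
    have h2 := (Bundle.Trivialization.contMDiffOn_iff (n := ∞) (IM := 𝓘(ℝ, ℝ).prod (𝓡 n))
      (IB := 𝓡 n) (e := trivializationAt F V a) (hsrc a)).2 ⟨contMDiffOn_snd,
        h1.congr fun q hq => by
          simp only [Function.comp_apply]
          rw [(extChartAt (𝓡 n) a).left_inv hq.2]⟩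
    exact (h2.contMDiffAt ((hO.prod (isOpen_extChartAt_source a)).mem_nhds hqa)).contMDiffWithinAt

/-- A family of tensors is smooth if and only if its components in all charts are smooth. -/
theorem contMDiffOn_tensor_iff {O : Set ℝ} (hO : IsOpen O)
    (T : ℝ → ∀ x : M, TangentSpace (𝓡 n) x →L[ℝ] TangentSpace (𝓡 n) x →L[ℝ] ℝ) :
    ContMDiffOn (𝓘(ℝ, ℝ).prod (𝓡 n))
      ((𝓡 n).prod 𝓘(ℝ, EuclideanSpace ℝ (Fin n) →L[ℝ] EuclideanSpace ℝ (Fin n) →L[ℝ] ℝ)) ∞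
      (fun q : ℝ × M =>
        (Bundle.TotalSpace.mk' (EuclideanSpace ℝ (Fin n) →L[ℝ] EuclideanSpace ℝ (Fin n) →L[ℝ] ℝ)
          q.2 (T q.1 q.2) :
          Bundle.TotalSpace (EuclideanSpace ℝ (Fin n) →L[ℝ] EuclideanSpace ℝ (Fin n) →L[ℝ] ℝ)
            (fun x : M => TangentSpace (𝓡 n) x →L[ℝ] TangentSpace (𝓡 n) x →L[ℝ] ℝ)))
      (O ×ˢ univ) ↔
    ∀ a i j, JointlySmoothOn (O ×ˢ (extChartAt (𝓡 n) a).target)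
      fun s y => tensorCoord (T s) a y i j := by
  have h0 := contMDiffOn_section_iff (n := n)
    (F := EuclideanSpace ℝ (Fin n) →L[ℝ] EuclideanSpace ℝ (Fin n) →L[ℝ] ℝ)
    (V := fun x : M => TangentSpace (𝓡 n) x →L[ℝ] TangentSpace (𝓡 n) x →L[ℝ] ℝ)
    (fun a => by simp) hO T
  refine h0.trans (forall_congr' fun a => ?_)
  rw [contMDiffOn_iff_contDiffOn]
  have h1 : ∀ z ∈ O ×ˢ (extChartAt (𝓡 n) a).target, bilinForm (tensorCoord (T z.1) a z.2) =
      (trivializationAt (EuclideanSpace ℝ (Fin n) →L[ℝ] EuclideanSpace ℝ (Fin n) →L[ℝ] ℝ)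
      (fun x : M => TangentSpace (𝓡 n) x →L[ℝ] TangentSpace (𝓡 n) x →L[ℝ] ℝ) a
      (Bundle.TotalSpace.mk' (EuclideanSpace ℝ (Fin n) →L[ℝ] EuclideanSpace ℝ (Fin n) →L[ℝ] ℝ)
        ((extChartAt (𝓡 n) a).symm z.2) (T z.1 ((extChartAt (𝓡 n) a).symm z.2)))).2 := by
    intro z hz
    rw [trivialization_apply ((extChartAt (𝓡 n) a).map_target hz.2) _ (T z.1) rfl,
      (extChartAt (𝓡 n) a).right_inv hz.2]
  rw [← contDiffOn_congr h1]
  exact ⟨contDiffOn_of_bilinForm, contDiffOn_bilinForm⟩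

theorem contMDiffOn_fun_iff {O : Set ℝ} (hO : IsOpen O) (f : ℝ → M → ℝ) :
    ContMDiffOn (𝓘(ℝ, ℝ).prod (𝓡 n)) 𝓘(ℝ, ℝ) ∞ (fun q : ℝ × M => f q.1 q.2) (O ×ˢ univ) ↔
    ∀ a, JointlySmoothOn (O ×ˢ (extChartAt (𝓡 n) a).target) fun s y => funCoord (f s) a y := by
  constructor
  · intro h a
    exact contMDiffOn_iff_contDiffOn.1 (h.comp (contMDiffOn_prod_chart_symm O a) fun z hz =>
      ⟨hz.1, mem_univ _⟩)
  · intro h q hq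
    set a := q.2
    have hqa : q ∈ O ×ˢ (extChartAt (𝓡 n) a).source := ⟨hq.1, mem_extChartAt_source a⟩
    have h1 : ContMDiffOn (𝓘(ℝ, ℝ).prod (𝓡 n)) 𝓘(ℝ, ℝ) ∞
        (fun q : ℝ × M => f q.1 q.2) (O ×ˢ (extChartAt (𝓡 n) a).source) :=
      ((contMDiffOn_iff_contDiffOn.2 (h a)).comp
        (contMDiffOn_prod_chart O a) fun q hq =>
          ⟨hq.1, (extChartAt (𝓡 n) a).map_source hq.2⟩).congr fun q hq => by
          exact (congrArg (f q.1) ((extChartAt (𝓡 n) a).left_inv hq.2)).symm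
    exact (h1.contMDiffAt ((hO.prod (isOpen_extChartAt_source a)).mem_nhds hqa)).contMDiffWithinAt

end Charts

/-! ### Smooth families of metric measure spaces in charts -/

section CoordinateChange

variable {n : ℕ} {U : Set (EuclideanSpace ℝ (Fin n))}
  {Φ : EuclideanSpace ℝ (Fin n) → EuclideanSpace ℝ (Fin n)} {s : ℝ}
  {G' G : ℝ → EuclideanSpace ℝ (Fin n) → Matrix (Fin n) (Fin n) ℝ}
  {Ω' Ω : Set (ℝ × EuclideanSpace ℝ (Fin n))} {y : EuclideanSpace ℝ (Fin n)}

theorem IsCoordChange.eulerCoord_eq (h : IsCoordChange U Φ s G' G Ω' Ω) (hy : y ∈ U)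
    (κ p p' ψ : ℝ) {f' f : EuclideanSpace ℝ (Fin n) → ℝ} (hf : ContDiffAt ℝ ∞ f (Φ y))
    (hff : f' =ᶠ[𝓝 y] f ∘ Φ) (T : Matrix (Fin n) (Fin n) ℝ) :
    eulerCoord κ p p' (G' s) f' ((matrixOf (fderiv ℝ Φ y)).transpose * T *
      matrixOf (fderiv ℝ Φ y)) ψ y = eulerCoord κ p p' (G s) f T ψ (Φ y) := by
  rw [eulerCoord, h.weightedScalarCoord_eq hy κ hf hff, h.weightedLaplacianCoord_eq hy hf hff,
    h.bakryEmeryCoord_eq hy κ hf hff, h.metric_eq y hy, traceCoord_congr (h.det_ne_zero hy)]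
  have : (matrixOf (fderiv ℝ Φ y)).transpose * bakryEmeryCoord κ (G s) f (Φ y) *
        matrixOf (fderiv ℝ Φ y) - (κ * weightedLaplacianCoord (G s) f (Φ y)) •
        ((matrixOf (fderiv ℝ Φ y)).transpose * G s (Φ y) * matrixOf (fderiv ℝ Φ y)) =
      (matrixOf (fderiv ℝ Φ y)).transpose * (bakryEmeryCoord κ (G s) f (Φ y) -
        (κ * weightedLaplacianCoord (G s) f (Φ y)) • G s (Φ y)) * matrixOf (fderiv ℝ Φ y) := by
    simp only [Matrix.mul_sub, Matrix.sub_mul, Matrix.mul_smul, Matrix.smul_mul]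
  rw [this, innerCoord_congr (h.det_ne_zero hy), eulerCoord]

end CoordinateChange

section Charts

variable {n : ℕ} {M : Type*} [TopologicalSpace M] [ChartedSpace (EuclideanSpace ℝ (Fin n)) M]
  [IsManifold (𝓡 n) ∞ M] {m : EReal}

theorem chartDeriv_injective (a : M) {y : EuclideanSpace ℝ (Fin n)}
    (hy : y ∈ (extChartAt (𝓡 n) a).target) : Function.Injective (chartDeriv a y) := by
  have h := isInvertible_mfderivWithin_extChartAt_symm (I := 𝓡 n) hy
  rw [ModelWithCorners.Boundaryless.range_eq_univ, mfderivWithin_univ] at h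
  exact h.injective

theorem metricCoord_symm (g : SmoothMetric n M) (a : M) (y : EuclideanSpace ℝ (Fin n))
    (i j : Fin n) : metricCoord g a y i j = metricCoord g a y j i :=
  g.symm _ _ _

theorem metricCoord_posDef (g : SmoothMetric n M) (a : M) {y : EuclideanSpace ℝ (Fin n)}
    (hy : y ∈ (extChartAt (𝓡 n) a).target) : (metricCoord g a y).PosDef := by
  refine Matrix.PosDef.of_dotProduct_mulVec_pos ?_ fun x hx => ?_
  · ext i j
    simp [metricCoord_symm g a y j i]
  · have h1 : star x ⬝ᵥ (metricCoord g a y).mulVec x =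
        bilinForm (metricCoord g a y) (WithLp.toLp 2 x) (WithLp.toLp 2 x) := by
      simp only [bilinForm_apply, dotProduct, Matrix.mulVec, Finset.mul_sum, Pi.star_apply,
        star_trivial]
      exact sum_congr_two fun i j => by ring
    rw [h1, metricCoord, bilinForm_tensorCoord]
    refine g.pos _ _ fun h => hx ?_
    have h2 : chartDeriv a y (WithLp.toLp 2 x) = chartDeriv a y 0 := by
      rw [map_zero]; exact h
    have h3 := chartDeriv_injective a hy h2
    exact congrArg WithLp.ofLp h3

/-- Smoothness of a family of metrics and measures, for parameters in an open set, in terms of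
the components in the charts. -/
structure IsSmoothFamily (O : Set ℝ) (γ : ℝ → SMMS n M m) : Prop where
  isOpen : IsOpen O
  metric : ∀ a i j, JointlySmoothOn (O ×ˢ (extChartAt (𝓡 n) a).target)
    fun s y => metricCoord (γ s).metric a y i j
  phi : ∀ a, JointlySmoothOn (O ×ˢ (extChartAt (𝓡 n) a).target)
    fun s y => funCoord (γ s).phi a y

/-- Smoothness of a curve, stated with sections of bundles, is smoothness of its coordinates in all
charts. -/
theorem isSmoothCurve_iff (γ : ℝ → SMMS n M m) :
    SMMS.IsSmoothCurve γ ↔ ∃ ε > 0, IsSmoothFamily (Ioo (-ε) ε) γ := by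
  refine exists_congr fun ε => and_congr_right fun _ => ?_
  have h1 := contMDiffOn_tensor_iff (n := n) (M := M) (isOpen_Ioo (a := -ε) (b := ε))
    (fun s => (γ s).metric.inner)
  have h2 := contMDiffOn_fun_iff (n := n) (M := M) (isOpen_Ioo (a := -ε) (b := ε))
    (fun s => (γ s).phi)
  exact ⟨fun h => ⟨isOpen_Ioo, h1.1 h.1, h2.1 h.2⟩, fun h => ⟨h1.2 h.metric, h2.2 h.phi⟩⟩

theorem isSmoothFamily_const (S : SMMS n M m) : IsSmoothFamily univ (fun _ => S) where
  isOpen := isOpen_univ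
  metric := (contMDiffOn_tensor_iff isOpen_univ (fun _ => S.metric.inner)).1
    (S.metric.contMDiff.comp contMDiff_snd).contMDiffOn
  phi := (contMDiffOn_fun_iff isOpen_univ (fun _ => S.phi)).1
    (S.phi_smooth.comp contMDiff_snd).contMDiffOn

namespace IsSmoothFamily

variable {O : Set ℝ} {γ : ℝ → SMMS n M m}

theorem mono (hγ : IsSmoothFamily O γ) {O' : Set ℝ} (hO' : IsOpen O') (h : O' ⊆ O) :
    IsSmoothFamily O' γ :=
  ⟨hO', fun a i j => (hγ.metric a i j).mono (prod_mono h subset_rfl),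
    fun a => (hγ.phi a).mono (prod_mono h subset_rfl)⟩

theorem isMetricFamily (hγ : IsSmoothFamily O γ) (a : M) :
    IsMetricFamily (O ×ˢ (extChartAt (𝓡 n) a).target)
      (fun s => metricCoord (γ s).metric a) where
  isOpen := hγ.isOpen.prod (isOpen_extChartAt_target a)
  smooth := hγ.metric a
  symm _ y _ i j := metricCoord_symm _ a y i j
  det_pos _ _ hz := (metricCoord_posDef _ a hz.2).det_pos

theorem isCoordChange (hγ : IsSmoothFamily O γ) (a b : M) {s : ℝ} (hs : s ∈ O) :
    IsCoordChange (chartOverlap a b) (chartChange a b) s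
      (fun s => metricCoord (γ s).metric a) (fun s => metricCoord (γ s).metric b)
      (O ×ˢ (extChartAt (𝓡 n) a).target) (O ×ˢ (extChartAt (𝓡 n) b).target) where
  isOpen := isOpen_chartOverlap a b
  smooth := contDiffOn_chartChange a b
  left := hγ.isMetricFamily a
  right := hγ.isMetricFamily b
  mem_left _ hy := ⟨hs, hy.1⟩
  mem_right _ hy := ⟨hs, chartChange_mem hy⟩
  metric_eq _ hy := tensorCoord_eq _ hy

end IsSmoothFamily

omit [IsManifold (𝓡 n) ∞ M] in
theorem funCoord_eventuallyEq (f : M → ℝ) {a b : M} {y : EuclideanSpace ℝ (Fin n)}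
    (hy : y ∈ chartOverlap a b) :
    funCoord f a =ᶠ[𝓝 y] funCoord f b ∘ chartChange a b := by
  filter_upwards [(isOpen_chartOverlap a b).mem_nhds hy] with x hx
  exact (funCoord_chartChange f hx).symm

namespace SMMS

variable (S : SMMS n M m)

theorem contDiffOn_phi (a : M) :
    ContDiffOn ℝ ∞ (funCoord S.phi a) (extChartAt (𝓡 n) a).target :=
  contMDiffOn_iff_contDiffOn.1
    (S.phi_smooth.comp_contMDiffOn (contMDiffOn_extChartAt_symm a))

omit [IsManifold (𝓡 n) ∞ M] in
theorem _root_.WeightedMeasure.mem_chartOverlap_self {a : M} {y : EuclideanSpace ℝ (Fin n)}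
    (hy : y ∈ (extChartAt (𝓡 n) a).target) :
    y ∈ chartOverlap a ((extChartAt (𝓡 n) a).symm y) :=
  ⟨hy, mem_extChartAt_source (I := 𝓡 n) ((extChartAt (𝓡 n) a).symm y)⟩

variable {a : M} {y : EuclideanSpace ℝ (Fin n)}

theorem isCoordChange (b : M) : IsCoordChange (chartOverlap a b) (chartChange a b) 0
      (fun _ => metricCoord S.metric a) (fun _ => metricCoord S.metric b)
      (univ ×ˢ (extChartAt (𝓡 n) a).target) (univ ×ˢ (extChartAt (𝓡 n) b).target) :=
  (isSmoothFamily_const S).isCoordChange a b (mem_univ 0)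

/-- The weighted scalar curvature at a point is defined through the preferred chart there; it may be
computed in any chart. -/
theorem weightedScalar_eq (hy : y ∈ (extChartAt (𝓡 n) a).target) :
    S.weightedScalar ((extChartAt (𝓡 n) a).symm y) =
      weightedScalarCoord (invDim m) (metricCoord S.metric a) (funCoord S.phi a) y := by
  have hy' := mem_chartOverlap_self hy
  exact ((S.isCoordChange _).weightedScalarCoord_eq hy' (invDim m)
    ((S.contDiffOn_phi _).contDiffAt ((isOpen_extChartAt_target _).mem_nhds
      (chartChange_mem hy'))) (funCoord_eventuallyEq _ hy')).symm

theorem weightedLaplacianPhi_eq (hy : y ∈ (extChartAt (𝓡 n) a).target) :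
    S.weightedLaplacianPhi ((extChartAt (𝓡 n) a).symm y) =
      weightedLaplacianCoord (metricCoord S.metric a) (funCoord S.phi a) y := by
  have hy' := mem_chartOverlap_self hy
  exact ((S.isCoordChange _).weightedLaplacianCoord_eq hy'
    ((S.contDiffOn_phi _).contDiffAt ((isOpen_extChartAt_target _).mem_nhds
      (chartChange_mem hy'))) (funCoord_eventuallyEq _ hy')).symm

theorem bakryEmeryCoord_eq (hy : y ∈ (extChartAt (𝓡 n) a).target) :
    bakryEmeryCoord (invDim m) (metricCoord S.metric a) (funCoord S.phi a) y =
      (matrixOf (fderiv ℝ (chartChange a ((extChartAt (𝓡 n) a).symm y)) y)).transpose *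
        S.bakryEmeryRicci ((extChartAt (𝓡 n) a).symm y) *
        matrixOf (fderiv ℝ (chartChange a ((extChartAt (𝓡 n) a).symm y)) y) := by
  have hy' := mem_chartOverlap_self hy
  exact (S.isCoordChange _).bakryEmeryCoord_eq hy' (invDim m)
    ((S.contDiffOn_phi _).contDiffAt ((isOpen_extChartAt_target _).mem_nhds
      (chartChange_mem hy'))) (funCoord_eventuallyEq _ hy')

/-- The trace of a tensor may be computed in any chart. -/
theorem traceAt_eq
    (T : ∀ x : M, TangentSpace (𝓡 n) x →L[ℝ] TangentSpace (𝓡 n) x →L[ℝ] ℝ)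
    (hy : y ∈ (extChartAt (𝓡 n) a).target) :
    traceAt S.metric ((extChartAt (𝓡 n) a).symm y)
        (tensorAt T ((extChartAt (𝓡 n) a).symm y)) =
      traceCoord (metricCoord S.metric a y) (tensorCoord T a y) := by
  have hy' := mem_chartOverlap_self hy
  rw [tensorCoord_eq T hy', metricCoord, tensorCoord_eq _ hy',
    traceCoord_congr ((S.isCoordChange _).det_ne_zero hy')]
  rfl

/-- The Euler-Lagrange integrand of the functional `∫ (R_φ + P(φ)) e^{-φ} dvol` at a point. -/
def eulerAt (P : ℝ → ℝ)
    (h : ∀ x : M, TangentSpace (𝓡 n) x →L[ℝ] TangentSpace (𝓡 n) x →L[ℝ] ℝ) (ψ : M → ℝ)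
    (p : M) : ℝ :=
  eulerCoord (invDim m) (P (S.phi p)) (deriv P (S.phi p)) (metricCoord S.metric p)
    (funCoord S.phi p) (tensorAt h p) (ψ p) (extChartAt (𝓡 n) p p)

/-- The Euler-Lagrange integrand may be computed in any chart. -/
theorem eulerAt_eq (P : ℝ → ℝ)
    (h : ∀ x : M, TangentSpace (𝓡 n) x →L[ℝ] TangentSpace (𝓡 n) x →L[ℝ] ℝ) (ψ : M → ℝ)
    (hy : y ∈ (extChartAt (𝓡 n) a).target) :
    S.eulerAt P h ψ ((extChartAt (𝓡 n) a).symm y) =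
      eulerCoord (invDim m) (P (funCoord S.phi a y)) (deriv P (funCoord S.phi a y))
        (metricCoord S.metric a) (funCoord S.phi a) (tensorCoord h a y) (funCoord ψ a y) y := by
  have hy' := mem_chartOverlap_self hy
  rw [tensorCoord_eq h hy']
  exact ((S.isCoordChange _).eulerCoord_eq hy' (invDim m) _ _ _
    ((S.contDiffOn_phi _).contDiffAt ((isOpen_extChartAt_target _).mem_nhds
      (chartChange_mem hy'))) (funCoord_eventuallyEq _ hy') _).symm

end SMMS

end Charts

/-! ### Integration of compactly supported functions in a chart -/

section Integration

variable {n : ℕ} {V K : Set (EuclideanSpace ℝ (Fin n))}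

/-- Extension by zero of a function supported in a compact subset of an open set. -/
theorem contDiff_indicator {k : ℕ∞ω} {u : EuclideanSpace ℝ (Fin n) → ℝ} (hV : IsOpen V)
    (hK : IsCompact K) (hKV : K ⊆ V) (hu : ContDiffOn ℝ k u V) (h0 : ∀ y ∈ V, y ∉ K → u y = 0) :
    ContDiff ℝ k (V.indicator u) := by
  refine contDiff_iff_contDiffAt.2 fun y => ?_
  by_cases hy : y ∈ V
  · refine (hu.contDiffAt (hV.mem_nhds hy)).congr_of_eventuallyEq ?_
    filter_upwards [hV.mem_nhds hy] with x hx using indicator_of_mem hx u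
  · refine (contDiffAt_const (c := (0 : ℝ))).congr_of_eventuallyEq ?_
    filter_upwards [hK.isClosed.isOpen_compl.mem_nhds fun h => hy (hKV h)] with x hx
    by_cases hxV : x ∈ V
    · rw [indicator_of_mem hxV, h0 x hxV hx]
    · rw [indicator_of_notMem hxV]

theorem hasCompactSupport_indicator {u : EuclideanSpace ℝ (Fin n) → ℝ} (hK : IsCompact K)
    (h0 : ∀ y ∈ V, y ∉ K → u y = 0) : HasCompactSupport (V.indicator u) := by
  refine HasCompactSupport.intro hK fun x hx => ?_
  by_cases hxV : x ∈ V
  · rw [indicator_of_mem hxV, h0 x hxV hx]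
  · rw [indicator_of_notMem hxV]

theorem integrableOn_of_eq_zero {u : EuclideanSpace ℝ (Fin n) → ℝ} (hV : IsOpen V)
    (hK : IsCompact K) (hKV : K ⊆ V) (hu : ContinuousOn u V) (h0 : ∀ y ∈ V, y ∉ K → u y = 0) :
    IntegrableOn u V := by
  rw [← integrable_indicator_iff hV.measurableSet]
  have hc := (contDiff_indicator hV hK hKV (contDiffOn_zero.2 hu) h0).continuous
  exact hc.integrable_of_hasCompactSupport (hasCompactSupport_indicator hK h0)

theorem pd_eq_zero_of_eq_zero {u : EuclideanSpace ℝ (Fin n) → ℝ} (hV : IsOpen V)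
    (hK : IsCompact K) (h0 : ∀ y ∈ V, y ∉ K → u y = 0) {y : EuclideanSpace ℝ (Fin n)}
    (hy : y ∈ V) (hyK : y ∉ K) (k : Fin n) : pd k u y = 0 := by
  have : u =ᶠ[𝓝 y] fun _ => 0 := by
    filter_upwards [hV.mem_nhds hy, hK.isClosed.isOpen_compl.mem_nhds hyK] with x hx hx'
      using h0 x hx hx'
  rw [pd, this.fderiv_eq]
  simp

theorem contDiffOn_pd {u : EuclideanSpace ℝ (Fin n) → ℝ} (hV : IsOpen V)
    (hu : ContDiffOn ℝ ∞ u V) (k : Fin n) : ContDiffOn ℝ ∞ (pd k u) V :=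
  (hu.fderiv_of_isOpen hV (by simp)).clm_apply contDiffOn_const

theorem integral_pd_eq_zero {u : EuclideanSpace ℝ (Fin n) → ℝ} (hV : IsOpen V)
    (hK : IsCompact K) (hKV : K ⊆ V) (hu : ContDiffOn ℝ ∞ u V)
    (h0 : ∀ y ∈ V, y ∉ K → u y = 0) (k : Fin n) : ∫ y in V, pd k u y = 0 := by
  have h1 := contDiff_indicator hV hK hKV hu h0
  have h2 := hasCompactSupport_indicator hK h0
  have h3 : V.indicator (pd k u) = pd k (V.indicator u) := by
    ext y
    by_cases hy : y ∈ V
    · rw [indicator_of_mem hy]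
      refine pd_congr ?_ k
      filter_upwards [hV.mem_nhds hy] with x hx using (indicator_of_mem hx u).symm
    · rw [indicator_of_notMem hy]
      have : V.indicator u =ᶠ[𝓝 y] fun _ => 0 := by
        filter_upwards [hK.isClosed.isOpen_compl.mem_nhds fun h => hy (hKV h)] with x hx
        by_cases hxV : x ∈ V
        · rw [indicator_of_mem hxV, h0 x hxV hx]
        · rw [indicator_of_notMem hxV]
      rw [pd, this.fderiv_eq]
      simp
  rw [← integral_indicator hV.measurableSet, h3]
  have h4 : Continuous fun y => pd k (V.indicator u) y :=
    (h1.continuous_fderiv (by simp)).clm_apply continuous_const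
  have h5 : HasCompactSupport fun y => pd k (V.indicator u) y :=
    (h2.fderiv ℝ).comp_left (g := fun L : EuclideanSpace ℝ (Fin n) →L[ℝ] ℝ =>
      L (EuclideanSpace.single k 1)) rfl
  have h6 := integral_mul_fderiv_eq_neg_fderiv_mul_of_integrable (𝕜 := ℝ)
    (μ := (volume : Measure (EuclideanSpace ℝ (Fin n)))) (f := fun _ => (1 : ℝ))
    (g := V.indicator u) (v := EuclideanSpace.single k (1 : ℝ)) (by simp)
    (by simpa [pd] using h4.integrable_of_hasCompactSupport h5)
    (by simpa using h1.continuous.integrable_of_hasCompactSupport h2)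
    (fun _ _ => differentiableAt_const _)
    (fun y _ => h1.differentiable (by simp) y)
  simpa [pd] using h6

/-- Integration by parts against a compactly supported function. -/
theorem integral_mul_sum_pd {ρ : EuclideanSpace ℝ (Fin n) → ℝ}
    {W : Fin n → EuclideanSpace ℝ (Fin n) → ℝ} (hV : IsOpen V)
    (hK : IsCompact K) (hKV : K ⊆ V) (hρ : ContDiffOn ℝ ∞ ρ V)
    (h0 : ∀ y ∈ V, y ∉ K → ρ y = 0) (hW : ∀ k, ContDiffOn ℝ ∞ (W k) V) :
    ∫ y in V, ρ y * ∑ k, pd k (W k) y = -∫ y in V, ∑ k, pd k ρ y * W k y := by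
  have h1 : ∀ k, ∀ y ∈ V, y ∉ K → pd k ρ y * W k y = 0 := fun k y hy hyK => by
    rw [pd_eq_zero_of_eq_zero hV hK h0 hy hyK, zero_mul]
  have h2 : ∀ k, ∀ y ∈ V, y ∉ K → ρ y * pd k (W k) y = 0 := fun k y hy hyK => by
    rw [h0 y hy hyK, zero_mul]
  have i1 : ∀ k, IntegrableOn (fun y => pd k ρ y * W k y) V := fun k =>
    integrableOn_of_eq_zero hV hK hKV ((contDiffOn_pd hV hρ k).mul (hW k)).continuousOn (h1 k)
  have i2 : ∀ k, IntegrableOn (fun y => ρ y * pd k (W k) y) V := fun k =>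
    integrableOn_of_eq_zero hV hK hKV (hρ.mul (contDiffOn_pd hV (hW k) k)).continuousOn (h2 k)
  have h3 : ∀ k, ∫ y in V, (pd k ρ y * W k y + ρ y * pd k (W k) y) = 0 := by
    intro k
    rw [← integral_pd_eq_zero hV hK hKV (hρ.mul (hW k))
      (fun y hy hyK => by rw [h0 y hy hyK, zero_mul]) k]
    refine setIntegral_congr_fun hV.measurableSet fun y hy => ?_
    have := pd_mul ((hρ.contDiffAt (hV.mem_nhds hy)).differentiableAt (by simp))
      (((hW k).contDiffAt (hV.mem_nhds hy)).differentiableAt (by simp)) k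
    rw [this]
  simp only [Finset.mul_sum]
  rw [integral_finsetSum _ fun k _ => i2 k, integral_finsetSum _ fun k _ => i1 k,
    ← Finset.sum_neg_distrib]
  refine Finset.sum_congr rfl fun k _ => ?_
  have := h3 k
  rw [integral_add (i1 k) (i2 k)] at this
  linarith

/-- Differentiation under the integral sign. -/
theorem hasDerivAt_integral {O : Set ℝ} {ρ : EuclideanSpace ℝ (Fin n) → ℝ}
    {u : ℝ → EuclideanSpace ℝ (Fin n) → ℝ} (hO : IsOpen O) (hV : IsOpen V)
    (hK : IsCompact K) (hKV : K ⊆ V) (hρ : ContinuousOn ρ V) (h0 : ∀ y ∈ V, y ∉ K → ρ y = 0)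
    (hu : JointlySmoothOn (O ×ˢ V) u) {s : ℝ} (hs : s ∈ O) :
    HasDerivAt (fun t => ∫ y in V, ρ y * u t y)
      (∫ y in V, ρ y * deriv (fun t => u t y) s) s := by
  obtain ⟨δ, hδ, hδO⟩ := Metric.nhds_basis_closedBall.mem_iff.1 (hO.mem_nhds hs)
  have hd := hu.deriv (hO.prod hV)
  have hspace : ∀ {v : ℝ → EuclideanSpace ℝ (Fin n) → ℝ}, JointlySmoothOn (O ×ˢ V) v →
      ∀ t ∈ O, ContinuousOn (v t) V := fun hv t ht y hy =>
    (hv.space_contDiffAt (hO.prod hV) ⟨ht, hy⟩).continuousAt.continuousWithinAt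
  have hint : ∀ {v : ℝ → EuclideanSpace ℝ (Fin n) → ℝ}, JointlySmoothOn (O ×ˢ V) v →
      ∀ t ∈ O, IntegrableOn (fun y => ρ y * v t y) V := fun hv t ht =>
    integrableOn_of_eq_zero hV hK hKV (hρ.mul (hspace hv t ht)) fun y hy hyK => by
      rw [h0 y hy hyK, zero_mul]
  obtain ⟨C, hC⟩ := ((isCompact_closedBall s δ).prod hK).exists_bound_of_continuousOn
    ((ContDiffOn.continuousOn hd).mono (prod_mono hδO hKV))
  refine (hasDerivAt_integral_of_dominated_loc_of_deriv_le (μ := volume.restrict V)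
    (F := fun t y => ρ y * u t y) (F' := fun t y => ρ y * deriv (fun t => u t y) t)
    (s := Metric.closedBall s δ) (bound := fun y => C * |ρ y|)
    (Metric.closedBall_mem_nhds s hδ) ?_ (hint hu s hs) (hint hd s hs).aestronglyMeasurable
    ?_ ?_ ?_).2
  · filter_upwards [hO.mem_nhds hs] with t ht using (hint hu t ht).aestronglyMeasurable
  · refine (ae_restrict_iff' hV.measurableSet).2 (Filter.Eventually.of_forall fun y hy t ht => ?_)
    by_cases hyK : y ∈ K
    · rw [norm_mul, mul_comm, Real.norm_eq_abs (ρ y)]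
      exact mul_le_mul_of_nonneg_right (hC (t, y) ⟨ht, hyK⟩) (abs_nonneg _)
    · simp [h0 y hy hyK]
  · exact (integrableOn_of_eq_zero hV hK hKV hρ.abs fun y hy hyK => by
      rw [h0 y hy hyK, abs_zero]).const_mul C
  · refine (ae_restrict_iff' hV.measurableSet).2 (Filter.Eventually.of_forall fun y hy t ht => ?_)
    exact (hu.hasDerivAt (hO.prod hV) ⟨hδO ht, hy⟩).const_mul _

theorem contDiffOn_integral {O : Set ℝ} {ρ : EuclideanSpace ℝ (Fin n) → ℝ}
    {u : ℝ → EuclideanSpace ℝ (Fin n) → ℝ} (hO : IsOpen O) (hV : IsOpen V)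
    (hK : IsCompact K) (hKV : K ⊆ V) (hρ : ContinuousOn ρ V) (h0 : ∀ y ∈ V, y ∉ K → ρ y = 0)
    (hu : JointlySmoothOn (O ×ˢ V) u) :
    ContDiffOn ℝ ∞ (fun t => ∫ y in V, ρ y * u t y) O := by
  refine contDiffOn_infty.2 fun k => ?_
  induction k generalizing u with
  | zero =>
    refine contDiffOn_zero.2 fun t ht => ?_
    exact (hasDerivAt_integral hO hV hK hKV hρ h0 hu ht).continuousAt.continuousWithinAt
  | succ k ih =>
    refine (contDiffOn_succ_iff_deriv_of_isOpen hO).2 ⟨fun t ht =>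
      (hasDerivAt_integral hO hV hK hKV hρ h0 hu ht).differentiableAt.differentiableWithinAt,
      fun h => absurd h (WithTop.coe_ne_top (a := (k : ℕ∞))), ?_⟩
    refine (ih (hu.deriv (hO.prod hV))).congr fun t ht => ?_
    exact (hasDerivAt_integral hO hV hK hKV hρ h0 hu ht).deriv

theorem det_eq_det_matrixOf (A : EuclideanSpace ℝ (Fin n) →L[ℝ] EuclideanSpace ℝ (Fin n)) :
    A.det = (matrixOf A).det := by
  rw [ContinuousLinearMap.det, ← LinearMap.det_toMatrix (EuclideanSpace.basisFun (Fin n) ℝ).toBasis]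
  congr 1

theorem eq_zero_of_integral_eq_zero {u : EuclideanSpace ℝ (Fin n) → ℝ} (hV : IsOpen V)
    (hK : IsCompact K) (hKV : K ⊆ V) (hu : ContinuousOn u V) (h0 : ∀ y ∈ V, y ∉ K → u y = 0)
    (hpos : ∀ y ∈ V, 0 ≤ u y) (hint : ∫ y in V, u y = 0) {y : EuclideanSpace ℝ (Fin n)}
    (hy : y ∈ V) : u y = 0 := by
  by_contra hne
  have h1 := (contDiff_indicator hV hK hKV (contDiffOn_zero.2 hu) h0).continuous
  have h2 := h1.integral_pos_of_hasCompactSupport_nonneg_nonzero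
    (μ := (volume : Measure (EuclideanSpace ℝ (Fin n)))) (x := y)
    (hasCompactSupport_indicator hK h0) (fun x => indicator_nonneg hpos x)
    (by rwa [indicator_of_mem hy])
  rw [integral_indicator hV.measurableSet, hint] at h2
  exact lt_irrefl _ h2

end Integration

/-! ### Integration on a compact manifold -/

section Glue

variable {n : ℕ} {M : Type*} [TopologicalSpace M] [ChartedSpace (EuclideanSpace ℝ (Fin n)) M]
  [IsManifold (𝓡 n) ∞ M] [CompactSpace M] [T2Space M] {m : EReal}

/-- The support of the member with index `a` of the partition of unity, in the chart centred at
`a`. -/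
def partitionSupport (a : M) : Set (EuclideanSpace ℝ (Fin n)) :=
  extChartAt (𝓡 n) a '' tsupport (chartPartition n M a)

theorem tsupport_chartPartition_subset (a : M) :
    tsupport (chartPartition n M a) ⊆ (extChartAt (𝓡 n) a).source := by
  rw [extChartAt_source]
  exact chartPartition_isSubordinate n M a

theorem isCompact_partitionSupport (a : M) :
    IsCompact (partitionSupport a : Set (EuclideanSpace ℝ (Fin n))) :=
  (isClosed_tsupport _).isCompact.image_of_continuousOn
    ((continuousOn_extChartAt a).mono (tsupport_chartPartition_subset a))

theorem partitionSupport_subset (a : M) :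
    (partitionSupport a : Set (EuclideanSpace ℝ (Fin n))) ⊆ (extChartAt (𝓡 n) a).target := by
  rintro _ ⟨x, hx, rfl⟩
  exact (extChartAt (𝓡 n) a).map_source (tsupport_chartPartition_subset a hx)

theorem contDiffOn_partition (a b : M) :
    ContDiffOn ℝ ∞ (funCoord (chartPartition n M a) b) (extChartAt (𝓡 n) b).target :=
  contMDiffOn_iff_contDiffOn.1
    ((chartPartition n M a).contMDiff.comp_contMDiffOn (contMDiffOn_extChartAt_symm b))

theorem partition_eq_zero (a : M) : ∀ y ∈ (extChartAt (𝓡 n) a).target, y ∉ partitionSupport a →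
    funCoord (chartPartition n M a) a y = 0 := by
  intro y hy hyK
  by_contra h
  exact hyK ⟨_, subset_tsupport _ h, (extChartAt (𝓡 n) a).right_inv hy⟩

variable (n M) in
theorem finite_partition :
    {a : M | (Function.support (chartPartition n M a)).Nonempty}.Finite :=
  (chartPartition n M).locallyFinite.finite_nonempty_of_compact

variable (n M) in
/-- The finitely many indices of the nonzero members of the partition of unity. -/
def partitionIndices : Finset M := (finite_partition n M).toFinset

theorem partition_eq_zero_of_notMem {a : M} (ha : a ∉ partitionIndices n M) (p : M) :
    chartPartition n M a p = 0 := by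
  by_contra h
  exact ha ((finite_partition n M).mem_toFinset.2 ⟨p, h⟩)

theorem sum_partition (p : M) : ∑ a ∈ partitionIndices n M, chartPartition n M a p = 1 := by
  rw [← (chartPartition n M).sum_eq_one (mem_univ p)]
  refine (finsum_eq_sum_of_support_subset _ fun a ha => ?_).symm
  by_contra h
  exact ha (partition_eq_zero_of_notMem h p)

/-- The integral of a density on the manifold, given by a function `u a` in the chart centred at
`a` for each `a`. -/
def densityIntegral (u : M → EuclideanSpace ℝ (Fin n) → ℝ) : ℝ :=
  ∑ a ∈ partitionIndices n M, ∫ y in (extChartAt (𝓡 n) a).target,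
    funCoord (chartPartition n M a) a y * u a y

theorem integrableOn_partition_mul {a : M} {u : EuclideanSpace ℝ (Fin n) → ℝ}
    (hu : ContinuousOn u (extChartAt (𝓡 n) a).target) :
    IntegrableOn (fun y => funCoord (chartPartition n M a) a y * u y)
      (extChartAt (𝓡 n) a).target :=
  integrableOn_of_eq_zero (isOpen_extChartAt_target a) (isCompact_partitionSupport a)
    (partitionSupport_subset a) ((contDiffOn_partition a a).continuousOn.mul hu) fun y hy hyK => by
      rw [partition_eq_zero a y hy hyK, zero_mul]

theorem densityIntegral_congr {u v : M → EuclideanSpace ℝ (Fin n) → ℝ}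
    (h : ∀ a, ∀ y ∈ (extChartAt (𝓡 n) a).target, u a y = v a y) :
    densityIntegral u = densityIntegral v :=
  Finset.sum_congr rfl fun a _ =>
    setIntegral_congr_fun (isOpen_extChartAt_target a).measurableSet fun y hy => by
      rw [h a y hy]

theorem densityIntegral_add {u v : M → EuclideanSpace ℝ (Fin n) → ℝ}
    (hu : ∀ a, ContinuousOn (u a) (extChartAt (𝓡 n) a).target)
    (hv : ∀ a, ContinuousOn (v a) (extChartAt (𝓡 n) a).target) :
    densityIntegral (fun a y => u a y + v a y) = densityIntegral u + densityIntegral v := by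
  simp only [densityIntegral, mul_add]
  rw [← Finset.sum_add_distrib]
  exact Finset.sum_congr rfl fun a _ =>
    integral_add (integrableOn_partition_mul (hu a)) (integrableOn_partition_mul (hv a))

theorem hasDerivAt_densityIntegral {O : Set ℝ} (hO : IsOpen O)
    {u : ℝ → M → EuclideanSpace ℝ (Fin n) → ℝ}
    (hu : ∀ a, JointlySmoothOn (O ×ˢ (extChartAt (𝓡 n) a).target) fun s y => u s a y) {s : ℝ}
    (hs : s ∈ O) : HasDerivAt (fun t => densityIntegral (u t))
      (densityIntegral fun a y => deriv (fun t => u t a y) s) s :=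
  HasDerivAt.fun_sum fun a _ => hasDerivAt_integral hO (isOpen_extChartAt_target a)
    (isCompact_partitionSupport a) (partitionSupport_subset a)
    (contDiffOn_partition a a).continuousOn (partition_eq_zero a) (hu a) hs

theorem contDiffOn_densityIntegral {O : Set ℝ} (hO : IsOpen O)
    {u : ℝ → M → EuclideanSpace ℝ (Fin n) → ℝ}
    (hu : ∀ a, JointlySmoothOn (O ×ˢ (extChartAt (𝓡 n) a).target) fun s y => u s a y) :
    ContDiffOn ℝ ∞ (fun t => densityIntegral (u t)) O :=
  ContDiffOn.sum fun a _ => contDiffOn_integral hO (isOpen_extChartAt_target a)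
    (isCompact_partitionSupport a) (partitionSupport_subset a)
    (contDiffOn_partition a a).continuousOn (partition_eq_zero a) (hu a)

omit [CompactSpace M] [T2Space M] in
omit [IsManifold (𝓡 n) ∞ M] in
theorem chartChange_chartChange {a b : M} {y : EuclideanSpace ℝ (Fin n)}
    (hy : y ∈ chartOverlap a b) : chartChange b a (chartChange a b y) = y := by
  rw [chartChange, symm_chartChange hy, (extChartAt (𝓡 n) a).right_inv hy.1]

omit [CompactSpace M] [T2Space M] in
omit [IsManifold (𝓡 n) ∞ M] in
theorem chartChange_mem_chartOverlap {a b : M} {y : EuclideanSpace ℝ (Fin n)}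
    (hy : y ∈ chartOverlap a b) : chartChange a b y ∈ chartOverlap b a := by
  refine ⟨chartChange_mem hy, ?_⟩
  rw [mem_preimage, symm_chartChange hy]
  exact (extChartAt (𝓡 n) a).map_target hy.1

omit [CompactSpace M] [T2Space M] in
omit [IsManifold (𝓡 n) ∞ M] in
theorem chartChange_image (a b : M) : chartChange a b '' chartOverlap a b =
    (chartOverlap b a : Set (EuclideanSpace ℝ (Fin n))) := by
  refine Subset.antisymm ?_ fun z hz => ⟨_, chartChange_mem_chartOverlap hz,
    chartChange_chartChange hz⟩
  rintro _ ⟨y, hy, rfl⟩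
  exact chartChange_mem_chartOverlap hy

/-- The divergence theorem on a compact manifold, for a vector density. -/
theorem densityIntegral_divergence (S : SMMS n M m)
    {W : M → Fin n → EuclideanSpace ℝ (Fin n) → ℝ}
    (hW : ∀ a k, ContDiffOn ℝ ∞ (W a k) (extChartAt (𝓡 n) a).target)
    (hWW : ∀ a b, ∀ y ∈ chartOverlap a b, ∀ k,
      ∑ l, matrixOf (fderiv ℝ (chartChange a b) y) k l * W a l y =
        |(matrixOf (fderiv ℝ (chartChange a b) y)).det| * W b k (chartChange a b y)) :
    densityIntegral (fun a y => ∑ k, pd k (W a k) y) = 0 := by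
  set D : M → M → EuclideanSpace ℝ (Fin n) → ℝ := fun a b y =>
    ∑ k, pd k (funCoord (chartPartition n M a) b) y * W b k y with hD
  have hDc : ∀ a b, ContinuousOn (D a b) (extChartAt (𝓡 n) b).target := fun a b =>
    continuousOn_finsetSum _ fun k _ => ((contDiffOn_pd (isOpen_extChartAt_target b)
      (contDiffOn_partition a b) k).mul (hW b k)).continuousOn
  -- integrate by parts in each chart
  have h1 : ∀ a, ∫ y in (extChartAt (𝓡 n) a).target,
      funCoord (chartPartition n M a) a y * ∑ k, pd k (W a k) y =
      -∫ y in (extChartAt (𝓡 n) a).target, D a a y := fun a =>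
    integral_mul_sum_pd (isOpen_extChartAt_target a) (isCompact_partitionSupport a)
      (partitionSupport_subset a) (contDiffOn_partition a a) (partition_eq_zero a) (hW a)
  -- insert the partition of unity `∑ b, ρ_b = 1`
  have h2 : ∀ a, ∫ y in (extChartAt (𝓡 n) a).target, D a a y =
      ∑ b ∈ partitionIndices n M, ∫ y in (extChartAt (𝓡 n) a).target,
        funCoord (chartPartition n M b) a y * D a a y := by
    intro a
    rw [← integral_finsetSum]
    · refine setIntegral_congr_fun (isOpen_extChartAt_target a).measurableSet fun y _ => ?_
      rw [← Finset.sum_mul]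
      simp only [funCoord, sum_partition, one_mul]
    · intro b _
      refine integrableOn_of_eq_zero (isOpen_extChartAt_target a) (isCompact_partitionSupport a)
        (partitionSupport_subset a) ((contDiffOn_partition b a).continuousOn.mul (hDc a a))
        fun y hy hyK => ?_
      have : D a a y = 0 := Finset.sum_eq_zero fun k _ => by
        rw [pd_eq_zero_of_eq_zero (isOpen_extChartAt_target a) (isCompact_partitionSupport a)
          (partition_eq_zero a) hy hyK, zero_mul]
      rw [this, mul_zero]
  -- change variables from the chart at `a` to the chart at `b`
  have h3 : ∀ a b, ∫ y in (extChartAt (𝓡 n) a).target,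
        funCoord (chartPartition n M b) a y * D a a y =
      ∫ y in (extChartAt (𝓡 n) b).target, funCoord (chartPartition n M b) b y * D a b y := by
    intro a b
    have e1 : ∫ y in (extChartAt (𝓡 n) a).target,
        funCoord (chartPartition n M b) a y * D a a y =
        ∫ y in chartOverlap a b, funCoord (chartPartition n M b) a y * D a a y := by
      refine setIntegral_eq_of_subset_of_forall_sdiff_eq_zero
        (isOpen_extChartAt_target a).measurableSet (fun y hy => hy.1) fun y hy => ?_
      have : funCoord (chartPartition n M b) a y = 0 := by
        by_contra h
        exact hy.2 ⟨hy.1, tsupport_chartPartition_subset b (subset_tsupport _ h)⟩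
      rw [this, zero_mul]
    have e2 : ∫ y in (extChartAt (𝓡 n) b).target,
        funCoord (chartPartition n M b) b y * D a b y =
        ∫ y in chartOverlap b a, funCoord (chartPartition n M b) b y * D a b y := by
      refine setIntegral_eq_of_subset_of_forall_sdiff_eq_zero
        (isOpen_extChartAt_target b).measurableSet (fun y hy => hy.1) fun y hy => ?_
      have h0 : (extChartAt (𝓡 n) b).symm y ∉ tsupport (chartPartition n M a) := fun h =>
        hy.2 ⟨hy.1, tsupport_chartPartition_subset a h⟩
      have h1 : funCoord (chartPartition n M a) b =ᶠ[𝓝 y] fun _ => 0 := by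
        have hc : ContinuousAt (extChartAt (𝓡 n) b).symm y :=
          (continuousOn_extChartAt_symm b).continuousAt
            ((isOpen_extChartAt_target b).mem_nhds hy.1)
        filter_upwards [hc.eventually ((isClosed_tsupport _).isOpen_compl.mem_nhds h0)] with x hx
        exact image_eq_zero_of_notMem_tsupport (f := chartPartition n M a) hx
      have : D a b y = 0 := Finset.sum_eq_zero fun k _ => by
        rw [pd, h1.fderiv_eq]
        simp
      rw [this, mul_zero]
    rw [e1, e2, ← chartChange_image a b, integral_image_eq_integral_abs_det_fderiv_smul volume
      (isOpen_chartOverlap a b).measurableSet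
      (fun y hy => ((S.isCoordChange b).hasFDerivAt hy).hasFDerivWithinAt)
      (fun x hx y hy hxy => by
        rw [← chartChange_chartChange hx, hxy, chartChange_chartChange hy])]
    refine setIntegral_congr_fun (isOpen_chartOverlap a b).measurableSet fun y hy => ?_
    have e3 : D a a y = |(matrixOf (fderiv ℝ (chartChange a b) y)).det| *
        D a b (chartChange a b y) := by
      have hd := ((contDiffOn_partition a b).contDiffAt ((isOpen_extChartAt_target b).mem_nhds
        (chartChange_mem hy))).differentiableAt (by simp)
      simp only [hD, (S.isCoordChange b).pd_eq hy hd (funCoord_eventuallyEq _ hy),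
        Finset.sum_mul, Finset.mul_sum]
      rw [Finset.sum_comm]
      refine Finset.sum_congr rfl fun k _ => ?_
      rw [mul_left_comm, ← hWW a b y hy k, Finset.mul_sum]
      exact Finset.sum_congr rfl fun l _ => by ring
    rw [e3, det_eq_det_matrixOf, smul_eq_mul, funCoord_chartChange _ hy]
    ring
  -- in the chart at `b`, the sum over `a` vanishes since `∑ a, dρ_a = 0`
  have h4 : ∀ b, ∑ a ∈ partitionIndices n M, ∫ y in (extChartAt (𝓡 n) b).target,
      funCoord (chartPartition n M b) b y * D a b y = 0 := by
    intro b
    rw [← integral_finsetSum]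
    · refine (setIntegral_congr_fun (g := fun _ => (0 : ℝ))
        (isOpen_extChartAt_target b).measurableSet fun y hy => ?_).trans (by simp)
      dsimp only
      rw [← Finset.mul_sum, hD]
      dsimp only
      rw [Finset.sum_comm]
      have e4 : ∀ k,
          ∑ a ∈ partitionIndices n M, pd k (funCoord (chartPartition n M a) b) y = 0 := by
        intro k
        have e5 : HasFDerivAt (fun x => ∑ a ∈ partitionIndices n M,
            funCoord (chartPartition n M a) b x)
            (∑ a ∈ partitionIndices n M, fderiv ℝ (funCoord (chartPartition n M a) b) y) y :=
          HasFDerivAt.fun_sum fun a _ => (((contDiffOn_partition a b).contDiffAt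
            ((isOpen_extChartAt_target b).mem_nhds hy)).differentiableAt (by simp)).hasFDerivAt
        have e6 : (fun x : EuclideanSpace ℝ (Fin n) => ∑ a ∈ partitionIndices n M,
            funCoord (chartPartition n M a) b x) = fun _ => 1 := by
          ext x
          exact sum_partition (n := n) _
        rw [e6] at e5
        have e7 := e5.unique (hasFDerivAt_const (1 : ℝ) y)
        have e8 := congrArg (fun L => L (EuclideanSpace.single k (1 : ℝ))) e7
        simpa [sum_apply, pd] using e8
      simp only [← Finset.sum_mul, e4, zero_mul, Finset.sum_const_zero, mul_zero]
    · exact fun a _ => integrableOn_partition_mul (hDc a b)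
  have h5 : ∀ a, ∫ y in (extChartAt (𝓡 n) a).target,
      funCoord (chartPartition n M a) a y * ∑ k, pd k (W a k) y =
      -∑ b ∈ partitionIndices n M, ∫ y in (extChartAt (𝓡 n) b).target,
        funCoord (chartPartition n M b) b y * D a b y := by
    intro a
    rw [h1, h2]
    exact congrArg Neg.neg (Finset.sum_congr rfl fun b _ => h3 a b)
  rw [densityIntegral]
  simp only [h5, Finset.sum_neg_distrib]
  rw [Finset.sum_comm, Finset.sum_eq_zero fun b _ => h4 b, neg_zero]

variable [MeasurableSpace M] [BorelSpace M]

omit [BorelSpace M] in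
/-- Only finitely many members of the partition of unity contribute to the Riemannian volume. -/
theorem dvol_eq_sum (g : SmoothMetric n M) : dvol g = ∑ a ∈ partitionIndices n M,
    (((volume : Measure (EuclideanSpace ℝ (Fin n))).restrict
      (extChartAt (𝓡 n) a).target).withDensity fun y =>
        ENNReal.ofReal (chartPartition n M a ((extChartAt (𝓡 n) a).symm y) *
          Real.sqrt (metricCoord g a y).det)).map (extChartAt (𝓡 n) a).symm := by
  ext s hs
  rw [dvol, Measure.sum_apply _ hs, Measure.coe_finsetSum, Finset.sum_apply]
  refine tsum_eq_sum fun a ha => ?_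
  have : (fun y => ENNReal.ofReal (chartPartition n M a ((extChartAt (𝓡 n) a).symm y) *
          Real.sqrt (metricCoord g a y).det)) = 0 := by
    ext y
    rw [partition_eq_zero_of_notMem ha]
    simp
  rw [this, withDensity_zero]
  simp

omit [CompactSpace M] [T2Space M] [MeasurableSpace M] [BorelSpace M] in
theorem continuousOn_sqrt_det (S : SMMS n M m) (a : M) :
    ContinuousOn (fun y => Real.sqrt (metricCoord S.metric a y).det)
      (extChartAt (𝓡 n) a).target := by
  have h := isSmoothFamily_const S
  have h1 := JointlySmoothOn.det (h.metric a)
  intro y hy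
  exact (Real.continuous_sqrt.continuousAt.comp (h1.space_contDiffAt
    (h.isMetricFamily a).isOpen (s := 0) ⟨mem_univ _, hy⟩).continuousAt).continuousWithinAt

omit [IsManifold (𝓡 n) ∞ M] [CompactSpace M] [T2Space M] [MeasurableSpace M] [BorelSpace M] in
theorem continuousOn_funCoord {f : M → ℝ} (hf : Continuous f) (a : M) :
    ContinuousOn (funCoord f a) (extChartAt (𝓡 n) a).target :=
  hf.comp_continuousOn (continuousOn_extChartAt_symm a)

omit [IsManifold (𝓡 n) ∞ M] [CompactSpace M] [T2Space M] [MeasurableSpace M] [BorelSpace M] in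
theorem continuous_of_continuousOn_funCoord {f : M → ℝ}
    (hf : ∀ a, ContinuousOn (funCoord f a) (extChartAt (𝓡 n) a).target) : Continuous f := by
  refine continuous_iff_continuousAt.2 fun p => ?_
  have h1 : ContinuousAt (funCoord f p ∘ extChartAt (𝓡 n) p) p :=
    ((hf p).continuousAt (extChartAt_target_mem_nhds p)).comp (continuousAt_extChartAt p)
  refine h1.congr ?_
  filter_upwards [(isOpen_extChartAt_source (I := 𝓡 n) p).mem_nhds (mem_extChartAt_source p)]
    with x hx
  simp only [Function.comp_apply, funCoord]
  rw [(extChartAt (𝓡 n) p).left_inv hx]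

/-- The weighted integral of a continuous function, computed in the charts. -/
theorem SMMS.integral_eq (S : SMMS n M m) {f : M → ℝ} (hf : Continuous f) :
    S.integral f = densityIntegral fun a y =>
      densityCoord (metricCoord S.metric a y) (funCoord S.phi a y) * funCoord f a y := by
  have hc : Continuous fun p => f p * Real.exp (-S.phi p) :=
    hf.mul (Real.continuous_exp.comp S.phi_smooth.continuous.neg)
  rw [SMMS.integral, dvol_eq_sum, densityIntegral]
  have hmeas : ∀ a : M, AEMeasurable (extChartAt (𝓡 n) a).symm
      ((volume : Measure (EuclideanSpace ℝ (Fin n))).restrict (extChartAt (𝓡 n) a).target) :=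
    fun a => (continuousOn_extChartAt_symm a).aemeasurable
      (isOpen_extChartAt_target a).measurableSet
  have hw : ∀ a : M, ContinuousOn (fun y => chartPartition n M a ((extChartAt (𝓡 n) a).symm y) *
          Real.sqrt (metricCoord S.metric a y).det) (extChartAt (𝓡 n) a).target := fun a =>
    (contDiffOn_partition a a).continuousOn.mul (continuousOn_sqrt_det S a)
  have hwm : ∀ a : M, AEMeasurable (fun y => ENNReal.ofReal
      (chartPartition n M a ((extChartAt (𝓡 n) a).symm y) *
          Real.sqrt (metricCoord S.metric a y).det))
      ((volume : Measure (EuclideanSpace ℝ (Fin n))).restrict (extChartAt (𝓡 n) a).target) :=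
    fun a => ((hw a).aemeasurable (isOpen_extChartAt_target a).measurableSet).ennreal_ofReal
  have hmeas' := fun a => (hmeas a).mono_ac (withDensity_absolutelyContinuous
    ((volume : Measure (EuclideanSpace ℝ (Fin n))).restrict (extChartAt (𝓡 n) a).target)
    (fun y => ENNReal.ofReal (chartPartition n M a ((extChartAt (𝓡 n) a).symm y) *
          Real.sqrt (metricCoord S.metric a y).det)))
  have hval : ∀ a y, (ENNReal.ofReal (chartPartition n M a ((extChartAt (𝓡 n) a).symm y) *
          Real.sqrt (metricCoord S.metric a y).det)).toReal •
          (f ((extChartAt (𝓡 n) a).symm y) * Real.exp (-S.phi ((extChartAt (𝓡 n) a).symm y))) =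
      funCoord (chartPartition n M a) a y *
        (densityCoord (metricCoord S.metric a y) (funCoord S.phi a y) * funCoord f a y) := by
    intro a y
    rw [ENNReal.toReal_ofReal (mul_nonneg ((chartPartition n M).nonneg a _) (Real.sqrt_nonneg _))]
    simp only [funCoord, densityCoord, smul_eq_mul]
    ring
  rw [integral_finsetSum_measure]
  · refine Finset.sum_congr rfl fun a _ => ?_
    rw [integral_map (hmeas' a) hc.aestronglyMeasurable,
      integral_withDensity_eq_integral_toReal_smul₀ (hwm a) (by simp)]
    simp only [hval]
  · intro a _
    rw [integrable_map_measure hc.aestronglyMeasurable (hmeas' a),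
      integrable_withDensity_iff_integrable_smul₀' (hwm a) (by simp)]
    simp only [Function.comp_apply, hval]
    refine integrableOn_partition_mul (ContinuousOn.mul ?_ (continuousOn_funCoord hf a))
    exact (continuousOn_sqrt_det S a).mul (Real.continuous_exp.comp_continuousOn
      (continuousOn_funCoord S.phi_smooth.continuous a).neg)

/-- A nonnegative continuous function with vanishing weighted integral is zero. -/
theorem SMMS.eq_zero_of_integral_eq_zero (S : SMMS n M m) {f : M → ℝ} (hf : Continuous f)
    (hpos : ∀ p, 0 ≤ f p) (hint : S.integral f = 0) (p : M) : f p = 0 := by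
  have hd : ∀ a, ∀ y ∈ (extChartAt (𝓡 n) a).target,
      0 < densityCoord (metricCoord S.metric a y) (funCoord S.phi a y) := fun a y hy =>
    mul_pos (Real.sqrt_pos.2 (metricCoord_posDef _ a hy).det_pos) (Real.exp_pos _)
  have hnn : ∀ a, ∀ y ∈ (extChartAt (𝓡 n) a).target, 0 ≤ funCoord (chartPartition n M a) a y *
      (densityCoord (metricCoord S.metric a y) (funCoord S.phi a y) * funCoord f a y) :=
    fun a y hy => mul_nonneg ((chartPartition n M).nonneg a _)
      (mul_nonneg (hd a y hy).le (hpos _))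
  rw [S.integral_eq hf, densityIntegral, Finset.sum_eq_zero_iff_of_nonneg fun a _ =>
    setIntegral_nonneg (isOpen_extChartAt_target a).measurableSet (hnn a)] at hint
  obtain ⟨a, ha⟩ := (chartPartition n M).exists_pos_of_mem (mem_univ p)
  have hp : p ∈ (extChartAt (𝓡 n) a).source :=
    tsupport_chartPartition_subset a (subset_tsupport _ ha.ne')
  have hmem : a ∈ partitionIndices n M := by
    by_contra h
    exact ha.ne' (partition_eq_zero_of_notMem h p)
  have h1 := WeightedMeasure.eq_zero_of_integral_eq_zero (isOpen_extChartAt_target a)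
    (isCompact_partitionSupport a) (partitionSupport_subset a)
    (u := fun y => funCoord (chartPartition n M a) a y *
      (densityCoord (metricCoord S.metric a y) (funCoord S.phi a y) * funCoord f a y))
    ((contDiffOn_partition a a).continuousOn.mul (((continuousOn_sqrt_det S a).mul
      (Real.continuous_exp.comp_continuousOn
      (continuousOn_funCoord S.phi_smooth.continuous a).neg)).mul (continuousOn_funCoord hf a)))
    (fun y hy hyK => by rw [partition_eq_zero a y hy hyK, zero_mul]) (hnn a) (hint a hmem)
    ((extChartAt (𝓡 n) a).map_source hp)
  have h2 := hd a _ ((extChartAt (𝓡 n) a).map_source hp)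
  simp only [funCoord, (extChartAt (𝓡 n) a).left_inv hp] at h1 h2
  rcases mul_eq_zero.1 h1 with h3 | h3
  · exact absurd h3 ha.ne'
  · exact (mul_eq_zero.1 h3).resolve_left h2.ne'

end Glue

/-! ### The first variation of volume and energy -/

section Coordinates

variable {n : ℕ}

theorem JointlySmoothOn.contDiffOn_slice {O : Set ℝ} {U : Set (EuclideanSpace ℝ (Fin n))}
    {F : ℝ → EuclideanSpace ℝ (Fin n) → ℝ} (hF : JointlySmoothOn (O ×ˢ U) F) {s : ℝ}
    (hs : s ∈ O) : ContDiffOn ℝ ∞ (F s) U :=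
  ContDiffOn.comp hF (f := fun y => (s, y)) (contDiffOn_const.prodMk contDiffOn_id)
    fun _ hy => ⟨hs, hy⟩

theorem jointlySmoothOn_of_contDiffOn {U : Set (EuclideanSpace ℝ (Fin n))}
    {f : EuclideanSpace ℝ (Fin n) → ℝ} (hf : ContDiffOn ℝ ∞ f U) (O : Set ℝ) :
    JointlySmoothOn (O ×ˢ U) fun _ y => f y :=
  ContDiffOn.comp hf contDiffOn_snd fun _ hz => hz.2

namespace IsMetricFamily

variable {Ω : Set (ℝ × EuclideanSpace ℝ (Fin n))}
  {G : ℝ → EuclideanSpace ℝ (Fin n) → Matrix (Fin n) (Fin n) ℝ}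
  {φ : ℝ → EuclideanSpace ℝ (Fin n) → ℝ}
  {T U : ℝ → EuclideanSpace ℝ (Fin n) → Matrix (Fin n) (Fin n) ℝ}

theorem hessian_smooth (hG : IsMetricFamily Ω G) (hφ : JointlySmoothOn Ω φ) (i j : Fin n) :
    JointlySmoothOn Ω fun s y => hessianCoord (G s) (φ s) y i j :=
  ((hφ.pd hG.isOpen j).pd hG.isOpen i).sub
    (JointlySmoothOn.sum fun k => (hG.christoffel_smooth k i j).mul (hφ.pd hG.isOpen k))

theorem diffSq_smooth (hG : IsMetricFamily Ω G) (hφ : JointlySmoothOn Ω φ) (i j : Fin n) :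
    JointlySmoothOn Ω fun s y => diffSqCoord (φ s) y i j :=
  (hφ.pd hG.isOpen i).mul (hφ.pd hG.isOpen j)

theorem weightedScalar_smooth (hG : IsMetricFamily Ω G) (hφ : JointlySmoothOn Ω φ) (κ : ℝ) :
    JointlySmoothOn Ω fun s y => weightedScalarCoord κ (G s) (φ s) y :=
  ((hG.traceCoord_smooth hG.ricci_smooth).add ((JointlySmoothOn.const 2).mul
    (hG.traceCoord_smooth (hG.hessian_smooth hφ)))).sub
    ((JointlySmoothOn.const (1 + κ)).mul (hG.traceCoord_smooth (hG.diffSq_smooth hφ)))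

theorem weightedLaplacian_smooth (hG : IsMetricFamily Ω G) (hφ : JointlySmoothOn Ω φ) :
    JointlySmoothOn Ω fun s y => weightedLaplacianCoord (G s) (φ s) y :=
  (hG.traceCoord_smooth (hG.hessian_smooth hφ)).sub (hG.traceCoord_smooth (hG.diffSq_smooth hφ))

theorem bakryEmery_smooth (hG : IsMetricFamily Ω G) (hφ : JointlySmoothOn Ω φ) (κ : ℝ)
    (i j : Fin n) : JointlySmoothOn Ω fun s y => bakryEmeryCoord κ (G s) (φ s) y i j :=
  ((hG.ricci_smooth i j).add (hG.hessian_smooth hφ i j)).sub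
    ((JointlySmoothOn.const κ).mul (hG.diffSq_smooth hφ i j))

theorem innerCoord_smooth (hG : IsMetricFamily Ω G)
    (hT : ∀ i j, JointlySmoothOn Ω fun s y => T s y i j)
    (hU : ∀ i j, JointlySmoothOn Ω fun s y => U s y i j) :
    JointlySmoothOn Ω fun s y => innerCoord (G s y) (T s y) (U s y) :=
  JointlySmoothOn.sum fun i => JointlySmoothOn.sum fun j => JointlySmoothOn.sum fun a =>
    JointlySmoothOn.sum fun b =>
      (((hG.inv_smooth i a).mul (hG.inv_smooth j b)).mul (hT i j)).mul (hU a b)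

theorem eulerCoord_smooth (hG : IsMetricFamily Ω G) (hφ : JointlySmoothOn Ω φ) (κ : ℝ)
    {p p' ψ : ℝ → EuclideanSpace ℝ (Fin n) → ℝ} (hp : JointlySmoothOn Ω p)
    (hp' : JointlySmoothOn Ω p') (hT : ∀ i j, JointlySmoothOn Ω fun s y => T s y i j)
    (hψ : JointlySmoothOn Ω ψ) : JointlySmoothOn Ω fun s y =>
      eulerCoord κ (p s y) (p' s y) (G s) (φ s) (T s y) (ψ s y) y :=
  ((hG.innerCoord_smooth (T := fun s y => bakryEmeryCoord κ (G s) (φ s) y -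
      (κ * weightedLaplacianCoord (G s) (φ s) y) • G s y) (fun i j =>
      (hG.bakryEmery_smooth hφ κ i j).sub (((JointlySmoothOn.const κ).mul
        (hG.weightedLaplacian_smooth hφ)).mul (hG.smooth i j))) hT).neg.sub
    ((((hG.weightedScalar_smooth hφ κ).sub ((JointlySmoothOn.const (2 * κ)).mul
      (hG.weightedLaplacian_smooth hφ))).add hp).mul
      (hψ.sub ((JointlySmoothOn.const (1 / 2)).mul (hG.traceCoord_smooth hT))))).add
    (hp'.mul hψ)

end IsMetricFamily

end Coordinates

section Tensors

variable {n : ℕ} {M : Type*} [TopologicalSpace M] [ChartedSpace (EuclideanSpace ℝ (Fin n)) M]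
  [IsManifold (𝓡 n) ∞ M] {m : EReal}

/-- Smoothness of a `(0,2)`-tensor field, in terms of its components in the charts. -/
def IsSmoothTensor (h : ∀ x : M, TangentSpace (𝓡 n) x →L[ℝ] TangentSpace (𝓡 n) x →L[ℝ] ℝ) :
    Prop :=
  ∀ a i j, ContDiffOn ℝ ∞ (fun y => tensorCoord h a y i j) (extChartAt (𝓡 n) a).target

variable (n) in
/-- Smoothness of a function, in terms of its coordinate expressions. -/
def IsSmoothFunction (f : M → ℝ) : Prop :=
  ∀ a, ContDiffOn ℝ ∞ (funCoord (n := n) f a) (extChartAt (𝓡 n) a).target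

omit [IsManifold (𝓡 n) ∞ M] in
theorem IsSmoothFunction.continuous {f : M → ℝ} (hf : IsSmoothFunction n f) : Continuous f :=
  continuous_of_continuousOn_funCoord fun a => (hf a).continuousOn

namespace SMMS

variable (S : SMMS n M m)

theorem isMetricFamily (a : M) :
    IsMetricFamily (univ ×ˢ (extChartAt (𝓡 n) a).target) fun _ => metricCoord S.metric a :=
  (isSmoothFamily_const S).isMetricFamily a

theorem jointlySmoothOn_phi (a : M) :
    JointlySmoothOn (univ ×ˢ (extChartAt (𝓡 n) a).target) fun _ => funCoord S.phi a :=
  (isSmoothFamily_const S).phi a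

theorem isSmoothFunction_weightedScalar : IsSmoothFunction n S.weightedScalar := fun a =>
  (((S.isMetricFamily a).weightedScalar_smooth (S.jointlySmoothOn_phi a)
    (invDim m)).contDiffOn_slice (mem_univ 0)).congr fun _ hy => S.weightedScalar_eq hy

theorem isSmoothFunction_weightedLaplacianPhi : IsSmoothFunction n S.weightedLaplacianPhi :=
  fun a => (((S.isMetricFamily a).weightedLaplacian_smooth
    (S.jointlySmoothOn_phi a)).contDiffOn_slice (mem_univ 0)).congr
      fun _ hy => S.weightedLaplacianPhi_eq hy

theorem isSmoothFunction_traceAt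
    {h : ∀ x : M, TangentSpace (𝓡 n) x →L[ℝ] TangentSpace (𝓡 n) x →L[ℝ] ℝ}
    (hh : IsSmoothTensor h) :
    IsSmoothFunction n fun p => traceAt S.metric p (tensorAt h p) := fun a =>
  (((S.isMetricFamily a).traceCoord_smooth (T := fun _ => tensorCoord h a) fun i j =>
    jointlySmoothOn_of_contDiffOn (hh a i j) univ).contDiffOn_slice (mem_univ 0)).congr
      fun _ hy => S.traceAt_eq h hy

theorem isSmoothFunction_eulerAt {P : ℝ → ℝ} (hP : ContDiff ℝ ∞ P)
    {h : ∀ x : M, TangentSpace (𝓡 n) x →L[ℝ] TangentSpace (𝓡 n) x →L[ℝ] ℝ} {ψ : M → ℝ}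
    (hh : IsSmoothTensor h) (hψ : IsSmoothFunction n ψ) :
    IsSmoothFunction n (S.eulerAt P h ψ) := fun a =>
  (((S.isMetricFamily a).eulerCoord_smooth (S.jointlySmoothOn_phi a) (invDim m)
    (T := fun _ => tensorCoord h a) (ψ := fun _ => funCoord ψ a)
    ((S.jointlySmoothOn_phi a).comp hP)
    ((S.jointlySmoothOn_phi a).comp (contDiff_infty_iff_deriv.1 hP).2)
    (fun i j => jointlySmoothOn_of_contDiffOn (hh a i j) univ)
    (jointlySmoothOn_of_contDiffOn (hψ a) univ)).contDiffOn_slice (mem_univ 0)).congr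
      fun _ hy => S.eulerAt_eq P h ψ hy

end SMMS

variable {O : Set ℝ} {γ : ℝ → SMMS n M m}
  {h : ∀ x : M, TangentSpace (𝓡 n) x →L[ℝ] TangentSpace (𝓡 n) x →L[ℝ] ℝ} {ψ : M → ℝ}

theorem metricVar_eq_of_hasVelocity (hv : SMMS.HasVelocity γ h ψ) (a : M)
    (y : EuclideanSpace ℝ (Fin n)) :
    metricVar (fun s => metricCoord (γ s).metric a) 0 y = tensorCoord h a y := by
  ext i j
  exact (hv.1 _ _ _).deriv

theorem deriv_phi_of_hasVelocity (hv : SMMS.HasVelocity γ h ψ) (a : M)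
    (y : EuclideanSpace ℝ (Fin n)) :
    deriv (fun s => funCoord (γ s).phi a y) 0 = funCoord ψ a y := (hv.2 _).deriv

theorem IsSmoothFamily.isSmoothTensor (hγ : IsSmoothFamily O γ) (h0 : (0 : ℝ) ∈ O)
    (hv : SMMS.HasVelocity γ h ψ) : IsSmoothTensor h := fun a i j =>
  (((hγ.isMetricFamily a).metricVar_smooth i j).contDiffOn_slice h0).congr fun y _ => by
    rw [metricVar_eq_of_hasVelocity hv a y]

theorem IsSmoothFamily.isSmoothFunction (hγ : IsSmoothFamily O γ) (h0 : (0 : ℝ) ∈ O)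
    (hv : SMMS.HasVelocity γ h ψ) : IsSmoothFunction n ψ := fun a =>
  (((hγ.phi a).deriv (hγ.isMetricFamily a).isOpen).contDiffOn_slice h0).congr fun y _ =>
    (deriv_phi_of_hasVelocity hv a y).symm

variable [CompactSpace M] [T2Space M] [MeasurableSpace M] [BorelSpace M]

/-- The first variation of the functional `∫ (R_φ + P(φ)) e^{-φ} dvol`. -/
theorem IsSmoothFamily.hasDerivAt_integral_weightedScalar (hγ : IsSmoothFamily O γ)
    (h0 : (0 : ℝ) ∈ O) (hv : SMMS.HasVelocity γ h ψ) {P : ℝ → ℝ} (hP : ContDiff ℝ ∞ P) :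
    HasDerivAt (fun s => (γ s).integral fun p => (γ s).weightedScalar p + P ((γ s).phi p))
      ((γ 0).integral ((γ 0).eulerAt P h ψ)) 0 := by
  have h1 : ∀ s, ((γ s).integral fun p => (γ s).weightedScalar p + P ((γ s).phi p)) =
      densityIntegral fun a y =>
        densityCoord (metricCoord (γ s).metric a y) (funCoord (γ s).phi a y) *
        (weightedScalarCoord (invDim m) (metricCoord (γ s).metric a) (funCoord (γ s).phi a) y
          + P (funCoord (γ s).phi a y)) := by
    intro s
    refine ((γ s).integral_eq (f := fun p => (γ s).weightedScalar p + P ((γ s).phi p))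
      ((γ s).isSmoothFunction_weightedScalar.continuous.add
      (hP.continuous.comp (γ s).phi_smooth.continuous))).trans ?_
    refine densityIntegral_congr fun a y hy => ?_
    rw [← (γ s).weightedScalar_eq hy]
    rfl
  simp only [h1]
  refine (hasDerivAt_densityIntegral hγ.isOpen (fun a => ((hγ.isMetricFamily a).density_smooth
    (hγ.phi a)).mul (((hγ.isMetricFamily a).weightedScalar_smooth (hγ.phi a) (invDim m)).add
      ((hγ.phi a).comp hP))) h0).congr_deriv ?_
  have hh := hγ.isSmoothTensor h0 hv
  have hψ := hγ.isSmoothFunction h0 hv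
  have hE := ((γ 0).isSmoothFunction_eulerAt hP hh hψ)
  have hw : ∀ a, ContDiffOn ℝ ∞ (fun y =>
      densityCoord (metricCoord (γ 0).metric a y) (funCoord (γ 0).phi a y))
      (extChartAt (𝓡 n) a).target := fun a =>
    ((hγ.isMetricFamily a).density_smooth (hγ.phi a)).contDiffOn_slice h0
  have hW : ∀ a k, JointlySmoothOn (O ×ˢ (extChartAt (𝓡 n) a).target) fun s y =>
      fluxDensity (invDim m) (fun s => metricCoord (γ s).metric a)
        (fun s => funCoord (γ s).phi a) s k y := fun a k =>
    (hγ.isMetricFamily a).fluxDensity_smooth (hγ.phi a) (invDim m) k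
  have h2 : densityIntegral (fun a y => ∑ k, pd k (fluxDensity (invDim m)
      (fun s => metricCoord (γ s).metric a) (fun s => funCoord (γ s).phi a) 0 k) y) = 0 := by
    refine densityIntegral_divergence (γ 0) (fun a k => (hW a k).contDiffOn_slice h0) ?_
    intro a b y hy k
    refine IsCoordChange.fluxDensity_eq (U := chartOverlap a b)
      (Ω' := O ×ˢ (extChartAt (𝓡 n) a).target) (Ω := O ×ˢ (extChartAt (𝓡 n) b).target)
      ?_ (hγ.phi a) (hγ.phi b) ?_ hy (invDim m) k
    · filter_upwards [hγ.isOpen.mem_nhds h0] with t ht using hγ.isCoordChange a b ht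
    · exact Filter.Eventually.of_forall fun t x hx => (funCoord_chartChange _ hx).symm
  refine Eq.trans ?_ ((congrArg₂ (· + ·) ((γ 0).integral_eq hE.continuous).symm h2).trans
    (add_zero _))
  refine Eq.trans ?_ (densityIntegral_add ?_ ?_)
  · refine densityIntegral_congr fun a y hy => ?_
    refine ((hγ.isMetricFamily a).hasDerivAt_energyDensity (hγ.phi a) (invDim m) hP
      ⟨h0, hy⟩).deriv.trans ?_
    rw [metricVar_eq_of_hasVelocity hv, deriv_phi_of_hasVelocity hv]
    have := (γ 0).eulerAt_eq P h ψ hy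
    rw [← this]
    rfl
  · exact fun a => (hw a).continuousOn.mul (hE a).continuousOn
  · exact fun a => continuousOn_finsetSum _ fun k _ => (((hW a k).pd
      (hγ.isMetricFamily a).isOpen k).contDiffOn_slice h0).continuousOn

/-- The first variation of the weighted volume. -/
theorem IsSmoothFamily.hasDerivAt_volume (hγ : IsSmoothFamily O γ) (h0 : (0 : ℝ) ∈ O)
    (hv : SMMS.HasVelocity γ h ψ) : HasDerivAt (fun s => (γ s).integral fun _ => 1)
      ((γ 0).integral fun p => -(ψ p - (1 / 2) * traceAt (γ 0).metric p (tensorAt h p))) 0 := by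
  have h1 : ∀ s, ((γ s).integral fun _ => 1) = densityIntegral fun a y =>
      densityCoord (metricCoord (γ s).metric a y) (funCoord (γ s).phi a y) := by
    intro s
    rw [(γ s).integral_eq continuous_const]
    exact densityIntegral_congr fun a y hy => mul_one _
  simp only [h1]
  refine (hasDerivAt_densityIntegral hγ.isOpen (fun a => (hγ.isMetricFamily a).density_smooth
    (hγ.phi a)) h0).congr_deriv ?_
  have hh := hγ.isSmoothTensor h0 hv
  have hψ := hγ.isSmoothFunction h0 hv
  refine Eq.trans ?_ ((γ 0).integral_eq (f := fun p =>
    -(ψ p - (1 / 2) * traceAt (γ 0).metric p (tensorAt h p))) (hψ.continuous.sub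
    (continuous_const.mul ((γ 0).isSmoothFunction_traceAt hh).continuous)).neg).symm
  refine densityIntegral_congr fun a y hy => ?_
  refine ((hγ.isMetricFamily a).hasDerivAt_density (hγ.phi a) ⟨h0, hy⟩).deriv.trans ?_
  rw [metricVar_eq_of_hasVelocity hv, deriv_phi_of_hasVelocity hv,
    ← (γ 0).traceAt_eq h hy]
  simp only [funCoord, neg_sub]

theorem IsSmoothFamily.contDiffOn_volume (hγ : IsSmoothFamily O γ) :
    ContDiffOn ℝ ∞ (fun s => (γ s).integral fun _ => 1) O := by
  have h1 : ∀ s, ((γ s).integral fun _ => 1) = densityIntegral fun a y =>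
      densityCoord (metricCoord (γ s).metric a y) (funCoord (γ s).phi a y) := by
    intro s
    rw [(γ s).integral_eq continuous_const]
    exact densityIntegral_congr fun a y hy => mul_one _
  simp only [h1]
  exact contDiffOn_densityIntegral hγ.isOpen fun a =>
    (hγ.isMetricFamily a).density_smooth (hγ.phi a)

omit [BorelSpace M] in
theorem SMMS.integral_neg (S : SMMS n M m) (f : M → ℝ) :
    (S.integral fun p => -f p) = -S.integral f := by
  simp only [SMMS.integral, neg_mul]
  exact MeasureTheory.integral_neg _

omit [CompactSpace M] [T2Space M] [MeasurableSpace M] [BorelSpace M] in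
theorem hasVelocity_phi_eq_zero (hm : m = 0) (hv : SMMS.HasVelocity γ h ψ) : ψ = 0 := by
  ext p
  have h1 := hv.2 p
  simp only [fun s => (γ s).phi_eq_zero hm, Pi.zero_apply] at h1
  exact h1.unique (hasDerivAt_const _ _)

theorem toReal_mul_invDim (hm : m ≠ ⊤ ∧ m ≠ ⊥) (h0 : m ≠ 0) : m.toReal * invDim m = 1 := by
  lift m to ℝ using hm
  have : m ≠ 0 := by exact_mod_cast h0
  rw [invDim, ← EReal.coe_inv, EReal.toReal_coe, EReal.toReal_coe, mul_inv_cancel₀ this]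

theorem invDim_of_infinite (hm : m = ⊤ ∨ m = ⊥) : invDim m = 0 := by
  rcases hm with rfl | rfl <;> simp [invDim]

omit [CompactSpace M] [T2Space M] [MeasurableSpace M] [BorelSpace M] in
theorem innerAt_sub_smul_metricAt (g : SmoothMetric n M) (p : M) (c : ℝ)
    (T U : Matrix (Fin n) (Fin n) ℝ) :
    innerAt g p (T - c • metricAt g p) U = innerAt g p T U - c * traceAt g p U := by
  have hs : ∀ i j, metricAt g p i j = metricAt g p j i := metricCoord_symm g p _
  have hd := (metricCoord_posDef g p (mem_extChartAt_target (I := 𝓡 n) p)).det_pos.ne'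
  have hi : ∀ i j, (metricAt g p)⁻¹ i j = (metricAt g p)⁻¹ j i := fun i j => by
    have ht : (metricAt g p).transpose = metricAt g p := Matrix.ext fun a b => hs b a
    conv_lhs => rw [← Matrix.transpose_apply (metricAt g p)⁻¹ j i, Matrix.transpose_nonsing_inv,
      ht]
  rw [innerAt, innerCoord_sub, innerCoord_smul, innerCoord_self hi hs hd]
  rfl

theorem IsSmoothFamily.hasDerivAt_energy_of_finite (hγ : IsSmoothFamily O γ) (h0 : (0 : ℝ) ∈ O)
    (hv : SMMS.HasVelocity γ h ψ) (μ : ℝ) (hm : m ≠ ⊤ ∧ m ≠ ⊥) :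
    HasDerivAt (fun s => (γ s).energy μ)
      (-(γ 0).integral fun p => innerAt (γ 0).metric p ((γ 0).bakryEmeryRicci p
          - (invDim m * (γ 0).weightedLaplacianPhi p) • metricAt (γ 0).metric p
          - (μ * (γ 0).vInvSq p) • metricAt (γ 0).metric p) (tensorAt h p)
        + ((γ 0).weightedScalar p - 2 * invDim m * (γ 0).weightedLaplacianPhi p
            + (m.toReal - 2) * μ * (γ 0).vInvSq p) *
          (ψ p - (1 / 2) * traceAt (γ 0).metric p (tensorAt h p))) 0 := by
  have hP : ContDiff ℝ ∞ fun t : ℝ => m.toReal * μ * Real.exp (2 * invDim m * t) := by fun_prop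
  have hP' : ∀ t : ℝ, deriv (fun t : ℝ => m.toReal * μ * Real.exp (2 * invDim m * t)) t =
      m.toReal * μ * (Real.exp (2 * invDim m * t) * (2 * invDim m)) := fun t => by
    have h1 : HasDerivAt (fun t : ℝ => 2 * invDim m * t) (2 * invDim m) t := by
      simpa using (hasDerivAt_id t).const_mul (2 * invDim m)
    exact (h1.exp.const_mul _).deriv
  have h1 := hγ.hasDerivAt_integral_weightedScalar h0 hv hP
  have h2 : ∀ s, (γ s).energy μ = (γ s).integral fun p => (γ s).weightedScalar p +
      m.toReal * μ * Real.exp (2 * invDim m * (γ s).phi p) := fun s =>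
    if_neg (by rintro (h | h); exacts [hm.1 h, hm.2 h])
  simp only [h2]
  refine h1.congr_deriv ?_
  rw [← SMMS.integral_neg]
  refine congrArg _ (funext fun p => ?_)
  rw [innerAt_sub_smul_metricAt]
  -- `m · (1/m) = 1` unless `m = 0`, when `1/m = 0` by convention but `ψ = 0`
  have h3 : (1 - m.toReal * invDim m) * ψ p = 0 := by
    by_cases hm0 : m = 0
    · rw [hasVelocity_phi_eq_zero hm0 hv]; simp
    · rw [toReal_mul_invDim hm hm0]; simp
  have h4 : (γ 0).eulerAt (fun t : ℝ => m.toReal * μ * Real.exp (2 * invDim m * t)) h ψ p =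
      -innerAt (γ 0).metric p ((γ 0).bakryEmeryRicci p
          - (invDim m * (γ 0).weightedLaplacianPhi p) • metricAt (γ 0).metric p) (tensorAt h p)
      - ((γ 0).weightedScalar p - 2 * invDim m * (γ 0).weightedLaplacianPhi p
        + m.toReal * μ * (γ 0).vInvSq p) *
          (ψ p - (1 / 2) * traceAt (γ 0).metric p (tensorAt h p))
      + m.toReal * μ * ((γ 0).vInvSq p * (2 * invDim m)) * ψ p := by
    rw [SMMS.eulerAt, hP']
    rfl
  rw [h4]
  linear_combination (-2 * μ * (γ 0).vInvSq p) * h3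

theorem IsSmoothFamily.hasDerivAt_energy_of_infinite (hγ : IsSmoothFamily O γ)
    (h0 : (0 : ℝ) ∈ O) (hv : SMMS.HasVelocity γ h ψ) (μ : ℝ) (hm : m = ⊤ ∨ m = ⊥) :
    HasDerivAt (fun s => (γ s).energy μ)
      (-(γ 0).integral fun p => innerAt (γ 0).metric p ((γ 0).bakryEmeryRicci p
          - μ • metricAt (γ 0).metric p) (tensorAt h p)
        + ((γ 0).weightedScalar p + 2 * μ * ((γ 0).phi p - n - 1)) *
          (ψ p - (1 / 2) * traceAt (γ 0).metric p (tensorAt h p))) 0 := by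
  have hP : ContDiff ℝ ∞ fun t : ℝ => 2 * μ * (t - n) := by fun_prop
  have hP' : ∀ t : ℝ, deriv (fun t : ℝ => 2 * μ * (t - n)) t = 2 * μ := fun t => by
    simp
  have h1 := hγ.hasDerivAt_integral_weightedScalar h0 hv hP
  have h2 : ∀ s, (γ s).energy μ = (γ s).integral fun p => (γ s).weightedScalar p +
      2 * μ * ((γ s).phi p - n) := fun s => if_pos hm
  simp only [h2]
  refine h1.congr_deriv ?_
  rw [← SMMS.integral_neg]
  refine congrArg _ (funext fun p => ?_)
  have h4 : (γ 0).eulerAt (fun t : ℝ => 2 * μ * (t - n)) h ψ p =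
      -innerAt (γ 0).metric p ((γ 0).bakryEmeryRicci p
          - (invDim m * (γ 0).weightedLaplacianPhi p) • metricAt (γ 0).metric p) (tensorAt h p)
      - ((γ 0).weightedScalar p - 2 * invDim m * (γ 0).weightedLaplacianPhi p
        + 2 * μ * ((γ 0).phi p - n)) *
          (ψ p - (1 / 2) * traceAt (γ 0).metric p (tensorAt h p))
      + 2 * μ * ψ p := by
    rw [SMMS.eulerAt, hP']
    rfl
  rw [h4, innerAt_sub_smul_metricAt, innerAt_sub_smul_metricAt, invDim_of_infinite hm]
  ring

/-- The variation of a curve of unit weighted volume is tangent to the constraint. -/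
theorem IsSmoothFamily.integral_eq_zero_of_unitVolume (hγ : IsSmoothFamily O γ)
    (h0 : (0 : ℝ) ∈ O) (hv : SMMS.HasVelocity γ h ψ)
    (hu : ∀ᶠ s in 𝓝 (0 : ℝ), γ s ∈ SMMS.unitVolume n M m) :
    ((γ 0).integral fun p => ψ p - (1 / 2) * traceAt (γ 0).metric p (tensorAt h p)) = 0 := by
  have h1 := hγ.hasDerivAt_volume h0 hv
  have h2 : (fun s => (γ s).integral fun _ => 1) =ᶠ[𝓝 0] fun _ => 1 := hu
  have h3 := (h1.congr_of_eventuallyEq h2.symm).unique (hasDerivAt_const _ _)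
  rw [SMMS.integral_neg] at h3
  linarith

end Tensors

/-! ### Positivity of the inner product of tensors, and symmetry of the Ricci tensor -/

section Algebra

variable {n : ℕ} {A T : Matrix (Fin n) (Fin n) ℝ}

open scoped MatrixOrder in
theorem exists_eq_transpose_mul_self (hA : A.PosDef) :
    ∃ J : Matrix (Fin n) (Fin n) ℝ, J.det ≠ 0 ∧ A = J.transpose * J := by
  obtain ⟨J, hJ⟩ := CStarAlgebra.nonneg_iff_eq_star_mul_self.mp hA.posSemidef.nonneg
  have h1 : A = J.transpose * J := by
    rw [hJ, Matrix.star_eq_conjTranspose, Matrix.conjTranspose_eq_transpose_of_trivial]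
  refine ⟨J, fun h => hA.det_pos.ne' ?_, h1⟩
  rw [h1, Matrix.det_mul, h, mul_zero]

/-- In an orthonormal basis the inner product of tensors is a sum of squares. -/
theorem exists_innerCoord_eq_sum_sq (hA : A.PosDef) (T : Matrix (Fin n) (Fin n) ℝ) :
    ∃ J T' : Matrix (Fin n) (Fin n) ℝ, A = J.transpose * J ∧ T = J.transpose * T' * J ∧
      innerCoord A T T = ∑ i, ∑ j, T' i j ^ 2 := by
  obtain ⟨J, hJ, h1⟩ := exists_eq_transpose_mul_self hA
  have hu := isUnit_iff_ne_zero.2 hJ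
  have hu' : IsUnit J.transpose.det := by rwa [Matrix.det_transpose]
  have h2 : T = J.transpose * (J.transpose⁻¹ * T * J⁻¹) * J := by
    rw [← Matrix.mul_assoc, ← Matrix.mul_assoc, Matrix.mul_nonsing_inv _ hu', Matrix.one_mul,
      Matrix.mul_assoc, Matrix.nonsing_inv_mul _ hu, Matrix.mul_one]
  refine ⟨J, _, h1, h2, ?_⟩
  generalize J.transpose⁻¹ * T * J⁻¹ = T' at h2
  have h3 := innerCoord_congr (A := 1) hJ T' T'
  rw [Matrix.mul_one, ← h1, ← h2] at h3
  rw [h3]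
  simp [innerCoord, Matrix.one_apply, sq]

theorem innerCoord_self_nonneg (hA : A.PosDef) (T : Matrix (Fin n) (Fin n) ℝ) :
    0 ≤ innerCoord A T T := by
  obtain ⟨J, T', -, -, h⟩ := exists_innerCoord_eq_sum_sq hA T
  rw [h]
  exact Finset.sum_nonneg fun i _ => Finset.sum_nonneg fun j _ => sq_nonneg _

theorem eq_zero_of_innerCoord_self_eq_zero (hA : A.PosDef) (h0 : innerCoord A T T = 0) :
    T = 0 := by
  obtain ⟨J, T', -, h1, h⟩ := exists_innerCoord_eq_sum_sq hA T
  rw [h] at h0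
  have h0' := (Finset.sum_eq_zero_iff_of_nonneg fun i _ =>
    Finset.sum_nonneg fun j _ => sq_nonneg (T' i j)).1 h0
  have h2 : T' = 0 := by
    ext i j
    have h3 := (Finset.sum_eq_zero_iff_of_nonneg fun j _ => sq_nonneg (T' i j)).1
      (h0' i (Finset.mem_univ i)) j (Finset.mem_univ j)
    exact pow_eq_zero_iff two_ne_zero |>.1 h3
  rw [h1, h2, Matrix.mul_zero, Matrix.zero_mul]

/-- A quadratic form is bounded by the norm of its matrix with respect to an inner product. -/
theorem bilinForm_sq_le (hA : A.PosDef) (T : Matrix (Fin n) (Fin n) ℝ)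
    (v : EuclideanSpace ℝ (Fin n)) :
    bilinForm T v v ^ 2 ≤ innerCoord A T T * bilinForm A v v ^ 2 := by
  obtain ⟨J, T', h1, h2, h⟩ := exists_innerCoord_eq_sum_sq hA T
  set x : Fin n → ℝ := fun i => ∑ a, J i a * v a with hx
  have hc : ∀ B : Matrix (Fin n) (Fin n) ℝ,
      bilinForm (J.transpose * B * J) v v = ∑ i, ∑ j, B i j * (x i * x j) := by
    intro B
    rw [bilinForm_apply]
    simp only [hx, Matrix.mul_apply, Matrix.transpose_apply, Finset.mul_sum, Finset.sum_mul]
    exact sum_reindex_four (fun (a, b, j, i) => (i, j, b, a)) (fun (i, j, b, a) => (a, b, j, i))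
      (fun _ => rfl) (fun _ => rfl) fun i j a b => by dsimp only; ring
  have hA1 : bilinForm A v v = ∑ i, x i ^ 2 := by
    have := hc 1
    rw [Matrix.mul_one, ← h1] at this
    rw [this]
    simp [Matrix.one_apply, sq]
  have hT1 : bilinForm T v v = ∑ i, ∑ j, T' i j * (x i * x j) := by rw [h2, hc]
  rw [h, hA1, hT1]
  have h3 := Finset.sum_mul_sq_le_sq_mul_sq (Finset.univ : Finset (Fin n × Fin n))
    (fun p => T' p.1 p.2) (fun p => x p.1 * x p.2)
  simp only [Fintype.sum_prod_type] at h3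
  refine h3.trans (mul_le_mul_of_nonneg_left (le_of_eq ?_)
    (Finset.sum_nonneg fun i _ => Finset.sum_nonneg fun j _ => sq_nonneg _))
  simp only [mul_pow, sq (∑ i, x i ^ 2), Finset.sum_mul_sum]

theorem bilinForm_symm (hT : ∀ i j, T i j = T j i) (u v : EuclideanSpace ℝ (Fin n)) :
    bilinForm T u v = bilinForm T v u := by
  rw [bilinForm_apply, bilinForm_apply, Finset.sum_comm]
  exact sum_congr_two fun i j => by rw [hT j i]; ring

variable {Ω : Set (ℝ × EuclideanSpace ℝ (Fin n))}
  {G : ℝ → EuclideanSpace ℝ (Fin n) → Matrix (Fin n) (Fin n) ℝ}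
  {φ : ℝ → EuclideanSpace ℝ (Fin n) → ℝ} {s : ℝ} {y : EuclideanSpace ℝ (Fin n)}

/-- The one-form `Γ^k_ik` is closed, as it is the differential of `log √(det g)`. -/
theorem IsMetricFamily.pd_trace_christoffel_comm (hG : IsMetricFamily Ω G) (hz : (s, y) ∈ Ω)
    (i j : Fin n) : pd j (fun x => ∑ k, christoffel (G s) k k i x) y =
      pd i (fun x => ∑ k, christoffel (G s) k k j x) y := by
  have h0 : JointlySmoothOn Ω fun (_ : ℝ) (_ : EuclideanSpace ℝ (Fin n)) => (0 : ℝ) :=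
    JointlySmoothOn.const 0
  have hw := hG.density_smooth h0
  have hpos : ∀ x, (s, x) ∈ Ω → densityCoord (G s x) 0 ≠ 0 := fun x hx =>
    (mul_pos (Real.sqrt_pos.2 (hG.det_pos s x hx)) (Real.exp_pos _)).ne'
  have hslice : ∀ᶠ x in 𝓝 y, (s, x) ∈ Ω :=
    (Continuous.prodMk continuous_const continuous_id).continuousAt.eventually
      (hG.isOpen.mem_nhds hz)
  have hlog : ∀ x, (s, x) ∈ Ω → ∀ l, pd l (fun x => Real.log (densityCoord (G s x) 0)) x =
      ∑ k, christoffel (G s) k k l x := by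
    intro x hx l
    have h1 := (hw.differentiableAt hG.isOpen hx).hasFDerivAt.log (hpos x hx)
    have h2 := hG.pd_density h0 hx l
    rw [pd_const, sub_zero] at h2
    rw [pd, h1.fderiv]
    change (densityCoord (G s x) 0)⁻¹ * pd l (fun x => densityCoord (G s x) 0) x = _
    rw [h2, inv_mul_cancel_left₀ (hpos x hx)]
  have hcd : ContDiffAt ℝ ∞ (fun x => Real.log (densityCoord (G s x) 0)) y :=
    (hw.space_contDiffAt hG.isOpen hz).log (hpos y hz)
  have h3 : ∀ l, (fun x => ∑ k, christoffel (G s) k k l x) =ᶠ[𝓝 y]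
      pd l (fun x => Real.log (densityCoord (G s x) 0)) := fun l => by
    filter_upwards [hslice] with x hx using (hlog x hx l).symm
  rw [pd_congr (h3 i), pd_congr (h3 j), pd_comm hcd]

theorem IsMetricFamily.ricci_symm (hG : IsMetricFamily Ω G) (hz : (s, y) ∈ Ω) (i j : Fin n) :
    ricciCoord (G s) y i j = ricciCoord (G s) y j i := by
  have hslice : ∀ᶠ x in 𝓝 y, (s, x) ∈ Ω :=
    (Continuous.prodMk continuous_const continuous_id).continuousAt.eventually
      (hG.isOpen.mem_nhds hz)
  have h1 : ∀ k, pd k (christoffel (G s) k i j) y = pd k (christoffel (G s) k j i) y := fun k =>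
    pd_congr (by filter_upwards [hslice] with x hx using hG.christoffel_symm hx k i j) k
  have h2 : ∀ i j : Fin n, ∑ k, pd j (christoffel (G s) k i k) y =
      pd j (fun x => ∑ k, christoffel (G s) k k i x) y := by
    intro i j
    rw [pd_sum fun k _ => (hG.christoffel_smooth k k i).differentiableAt hG.isOpen hz]
    exact Finset.sum_congr rfl fun k _ => pd_congr
      (by filter_upwards [hslice] with x hx using hG.christoffel_symm hx k i k) j
  have h4 : ∑ k, ∑ l, christoffel (G s) k j l y * christoffel (G s) l i k y =
      ∑ k, ∑ l, christoffel (G s) k i l y * christoffel (G s) l j k y := by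
    rw [Finset.sum_comm]
    exact sum_congr_two fun k l => mul_comm _ _
  simp only [ricciCoord, Matrix.of_apply]
  rw [h2, h2, hG.pd_trace_christoffel_comm hz i j, h4]
  simp only [h1, hG.christoffel_symm hz _ i j]

theorem IsMetricFamily.hessian_symm (hG : IsMetricFamily Ω G) (hφ : JointlySmoothOn Ω φ)
    (hz : (s, y) ∈ Ω) (i j : Fin n) :
    hessianCoord (G s) (φ s) y i j = hessianCoord (G s) (φ s) y j i := by
  simp only [hessianCoord, Matrix.of_apply, hG.christoffel_symm hz _ i j]
  rw [pd_comm (hφ.space_contDiffAt hG.isOpen hz)]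

theorem IsMetricFamily.bakryEmery_symm (hG : IsMetricFamily Ω G) (hφ : JointlySmoothOn Ω φ)
    (κ : ℝ) (hz : (s, y) ∈ Ω) (i j : Fin n) :
    bakryEmeryCoord κ (G s) (φ s) y i j = bakryEmeryCoord κ (G s) (φ s) y j i := by
  simp only [bakryEmeryCoord, Matrix.add_apply, Matrix.sub_apply, Matrix.smul_apply,
    hG.ricci_symm hz i j, hG.hessian_symm hφ hz i j, diffSqCoord, Matrix.of_apply, smul_eq_mul]
  ring

end Algebra

/-! ### Tensor fields on the manifold -/

section Tensors

variable {n : ℕ} {M : Type*} [TopologicalSpace M] [ChartedSpace (EuclideanSpace ℝ (Fin n)) M]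
  [IsManifold (𝓡 n) ∞ M] {m : EReal}
  {h k : ∀ x : M, TangentSpace (𝓡 n) x →L[ℝ] TangentSpace (𝓡 n) x →L[ℝ] ℝ} {f : M → ℝ}

theorem contMDiff_iff_isSmoothFunction (f : M → ℝ) :
    ContMDiff (𝓡 n) 𝓘(ℝ, ℝ) ∞ f ↔ IsSmoothFunction n f := by
  refine ⟨fun hf a => contMDiffOn_iff_contDiffOn.1
    (hf.comp_contMDiffOn (contMDiffOn_extChartAt_symm a)), fun hf => ?_⟩
  have h1 := (contMDiffOn_fun_iff isOpen_univ fun _ => f).2 fun a =>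
    jointlySmoothOn_of_contDiffOn (hf a) univ
  have h2 : ContMDiff (𝓡 n) (𝓘(ℝ, ℝ).prod (𝓡 n)) ∞ fun x : M => ((0 : ℝ), x) :=
    contMDiff_const.prodMk contMDiff_id
  exact contMDiffOn_univ.1 (h1.comp h2.contMDiffOn fun _ _ => ⟨mem_univ _, mem_univ _⟩)

theorem IsSmoothTensor.contMDiff (hh : IsSmoothTensor h) :
    ContMDiff (𝓡 n)
      ((𝓡 n).prod 𝓘(ℝ, EuclideanSpace ℝ (Fin n) →L[ℝ] EuclideanSpace ℝ (Fin n) →L[ℝ] ℝ)) ∞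
      (fun x : M =>
        (Bundle.TotalSpace.mk' (EuclideanSpace ℝ (Fin n) →L[ℝ] EuclideanSpace ℝ (Fin n) →L[ℝ] ℝ)
          x (h x) :
          Bundle.TotalSpace (EuclideanSpace ℝ (Fin n) →L[ℝ] EuclideanSpace ℝ (Fin n) →L[ℝ] ℝ)
            (fun x : M => TangentSpace (𝓡 n) x →L[ℝ] TangentSpace (𝓡 n) x →L[ℝ] ℝ))) := by
  have h1 := (contMDiffOn_tensor_iff isOpen_univ fun _ => h).2 fun a i j =>
    jointlySmoothOn_of_contDiffOn (hh a i j) univ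
  have h2 : ContMDiff (𝓡 n) (𝓘(ℝ, ℝ).prod (𝓡 n)) ∞ fun x : M => ((0 : ℝ), x) :=
    contMDiff_const.prodMk contMDiff_id
  exact contMDiffOn_univ.1 (h1.comp h2.contMDiffOn fun _ _ => ⟨mem_univ _, mem_univ _⟩)

theorem isSmoothTensor_inner (S : SMMS n M m) : IsSmoothTensor S.metric.inner := fun a i j =>
  ((S.isMetricFamily a).smooth i j).contDiffOn_slice (mem_univ 0)

omit [IsManifold (𝓡 n) ∞ M] in
theorem IsSmoothTensor.add (hh : IsSmoothTensor h) (hk : IsSmoothTensor k) :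
    IsSmoothTensor fun x => h x + k x := fun a i j => (hh a i j).add (hk a i j)

omit [IsManifold (𝓡 n) ∞ M] in
theorem IsSmoothTensor.smul (hf : IsSmoothFunction n f) (hh : IsSmoothTensor h) :
    IsSmoothTensor fun x => f x • h x := fun a i j => (hf a).mul (hh a i j)

omit [IsManifold (𝓡 n) ∞ M] in
theorem IsSmoothTensor.sub_smul (hf : IsSmoothFunction n f) (hh : IsSmoothTensor h)
    (hk : IsSmoothTensor k) : IsSmoothTensor fun x => h x - f x • k x := fun a i j =>
  (hh a i j).sub ((hf a).mul (hk a i j))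

omit [IsManifold (𝓡 n) ∞ M] in
theorem isSmoothFunction_const (c : ℝ) : IsSmoothFunction n fun _ : M => c :=
  fun _ => contDiffOn_const

omit [IsManifold (𝓡 n) ∞ M] in
theorem tensorAt_sub_smul (c : M → ℝ) (p : M) :
    tensorAt (fun x => h x - c x • k x) p = tensorAt h p - c p • tensorAt k p := by
  ext i j
  simp only [tensorAt, tensorCoord, Matrix.of_apply, Matrix.sub_apply, Matrix.smul_apply]
  rw [extChartAt_to_inv]
  rfl

/-- The Bakry-Émery Ricci tensor as a tensor field. -/
def SMMS.bakryEmeryTensor (S : SMMS n M m) (x : M) :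
    TangentSpace (𝓡 n) x →L[ℝ] TangentSpace (𝓡 n) x →L[ℝ] ℝ :=
  (bilinForm (S.bakryEmeryRicci x) :
    EuclideanSpace ℝ (Fin n) →L[ℝ] EuclideanSpace ℝ (Fin n) →L[ℝ] ℝ)

theorem SMMS.tensorAt_bakryEmeryTensor (S : SMMS n M m) (p : M) :
    tensorAt S.bakryEmeryTensor p = S.bakryEmeryRicci p :=
  bilinForm_injective fun u v => tensorAt_apply _ _ u v

theorem SMMS.isSmoothTensor_bakryEmeryTensor (S : SMMS n M m) :
    IsSmoothTensor S.bakryEmeryTensor := fun a i j => by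
  refine (((S.isMetricFamily a).bakryEmery_smooth (S.jointlySmoothOn_phi a) (invDim m) i
    j).contDiffOn_slice (mem_univ 0)).congr fun y hy => ?_
  have hy' := mem_chartOverlap_self hy
  have h1 := tensorCoord_eq S.bakryEmeryTensor hy'
  have h2 : tensorCoord S.bakryEmeryTensor ((extChartAt (𝓡 n) a).symm y)
      (chartChange a ((extChartAt (𝓡 n) a).symm y) y) =
      S.bakryEmeryRicci ((extChartAt (𝓡 n) a).symm y) := S.tensorAt_bakryEmeryTensor _
  rw [h2, ← S.bakryEmeryCoord_eq hy] at h1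
  exact congrFun (congrFun h1 i) j

theorem SMMS.bakryEmeryTensor_symm (S : SMMS n M m) (x : M) (u v : TangentSpace (𝓡 n) x) :
    S.bakryEmeryTensor x u v = S.bakryEmeryTensor x v u :=
  bilinForm_symm (fun i j => (S.isMetricFamily x).bakryEmery_symm (S.jointlySmoothOn_phi x)
    (invDim m) (s := 0) ⟨mem_univ _, mem_extChartAt_target x⟩ i j) _ _

theorem metricAt_posDef (g : SmoothMetric n M) (p : M) : (metricAt g p).PosDef :=
  metricCoord_posDef g p (mem_extChartAt_target p)

theorem SMMS.innerAt_eq (S : SMMS n M m) {a : M} {y : EuclideanSpace ℝ (Fin n)}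
    (hy : y ∈ (extChartAt (𝓡 n) a).target) :
    innerAt S.metric ((extChartAt (𝓡 n) a).symm y) (tensorAt h ((extChartAt (𝓡 n) a).symm y))
        (tensorAt k ((extChartAt (𝓡 n) a).symm y)) =
      innerCoord (metricCoord S.metric a y) (tensorCoord h a y) (tensorCoord k a y) := by
  have hy' := mem_chartOverlap_self hy
  rw [tensorCoord_eq h hy', tensorCoord_eq k hy', metricCoord, tensorCoord_eq _ hy',
    innerCoord_congr ((S.isCoordChange _).det_ne_zero hy')]
  rfl

theorem SMMS.isSmoothFunction_innerAt (S : SMMS n M m) (hh : IsSmoothTensor h)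
    (hk : IsSmoothTensor k) :
    IsSmoothFunction n fun p => innerAt S.metric p (tensorAt h p) (tensorAt k p) := fun a =>
  (((S.isMetricFamily a).innerCoord_smooth (T := fun _ => tensorCoord h a)
    (U := fun _ => tensorCoord k a) (fun i j => jointlySmoothOn_of_contDiffOn (hh a i j) univ)
    fun i j => jointlySmoothOn_of_contDiffOn (hk a i j) univ).contDiffOn_slice
      (mem_univ 0)).congr fun _ hy => S.innerAt_eq hy

/-- A smooth tensor field on a compact manifold is bounded by a multiple of the metric. -/
theorem SMMS.exists_abs_le_mul_inner [CompactSpace M] (S : SMMS n M m) (hh : IsSmoothTensor h) :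
    ∃ C > 0, ∀ x (v : TangentSpace (𝓡 n) x), |h x v v| ≤ C * S.metric.inner x v v := by
  obtain ⟨C, hC⟩ := isCompact_univ.exists_bound_of_continuousOn
    (S.isSmoothFunction_innerAt hh hh).continuous.continuousOn
  refine ⟨|C| + 1, by positivity, fun x v => ?_⟩
  have h1 := bilinForm_sq_le (metricAt_posDef S.metric x) (tensorAt h x) v
  have h2 : bilinForm (metricAt S.metric x) v v = S.metric.inner x v v := tensorAt_apply _ _ _ _
  have h3 : 0 ≤ S.metric.inner x v v := by
    by_cases hv : v = 0
    · rw [hv, map_zero]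
    · exact (S.metric.pos x v hv).le
  have h2' : bilinForm (tensorAt h x) v v = h x v v := tensorAt_apply _ _ _ _
  rw [h2', h2] at h1
  have h4 : innerCoord (metricAt S.metric x) (tensorAt h x) (tensorAt h x) ≤ (|C| + 1) ^ 2 := by
    have h5 := (le_abs_self _).trans (hC x (mem_univ x))
    have h6 : innerCoord (metricAt S.metric x) (tensorAt h x) (tensorAt h x) ≤ C := h5
    nlinarith [le_abs_self C, abs_nonneg C]
  refine abs_le_of_sq_le_sq ?_ (by positivity)
  rw [mul_pow]
  exact h1.trans (mul_le_mul_of_nonneg_right h4 (sq_nonneg _))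

/-- A smooth symmetric tensor field that is bounded below by a positive multiple of a metric is a
metric. -/
def SmoothMetric.ofLe (g : SmoothMetric n M)
    (k : ∀ x : M, TangentSpace (𝓡 n) x →L[ℝ] TangentSpace (𝓡 n) x →L[ℝ] ℝ)
    (hk : IsSmoothTensor k) (hs : ∀ x u v, k x u v = k x v u)
    (hle : ∃ c > 0, ∀ x v, c * g.inner x v v ≤ k x v v) : SmoothMetric n M where
  inner := k
  symm := hs
  pos x v hv := by
    obtain ⟨c, hc, hle⟩ := hle
    exact (mul_pos hc (g.pos x v hv)).trans_le (hle x v)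
  isVonNBounded x := by
    obtain ⟨c, hc, hle⟩ := hle
    have h1 := (g.isVonNBounded x).image
      (((Real.sqrt c)⁻¹ • ContinuousLinearMap.id ℝ (TangentSpace (𝓡 n) x)))
    refine h1.subset fun v hv => (mem_image _ _ _).2 ⟨Real.sqrt c • v, ?_, ?_⟩
    · have h2 : g.inner x (Real.sqrt c • v) (Real.sqrt c • v) = c * g.inner x v v := by
        rw [map_smul, g.symm, map_smul, smul_eq_mul, smul_eq_mul, ← mul_assoc,
          Real.mul_self_sqrt hc.le]
      rw [mem_ofPred_eq, h2]
      exact (hle x v).trans_lt hv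
    · have h3 := (Real.sqrt_pos.2 hc).ne'
      change (Real.sqrt c)⁻¹ • Real.sqrt c • v = v
      rw [smul_smul, inv_mul_cancel₀ h3, one_smul]
  contMDiff := hk.contMDiff

end Tensors

/-! ### Curves of unit volume with prescribed velocity -/

section Curves

variable {n : ℕ} {M : Type*} [TopologicalSpace M] [ChartedSpace (EuclideanSpace ℝ (Fin n)) M]
  [IsManifold (𝓡 n) ∞ M] {m : EReal}

theorem SMMS.eq_of_inner_eq {S S' : SMMS n M m} (h1 : S.metric.inner = S'.metric.inner)
    (h2 : S.phi = S'.phi) : S = S' := by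
  obtain ⟨⟨g, _, _, _, _⟩, φ, _, _⟩ := S
  obtain ⟨⟨g', _, _, _, _⟩, φ', _, _⟩ := S'
  obtain rfl : g = g' := h1
  obtain rfl : φ = φ' := h2
  rfl

/-- The metric measure space `(e^a g, e^{-(φ + b)} dvol)`. -/
def SMMS.rescale (S : SMMS n M m) (a b : ℝ) (hb : m = 0 → b = 0) : SMMS n M m where
  metric := SmoothMetric.ofLe S.metric (fun x => Real.exp a • S.metric.inner x)
    ((isSmoothTensor_inner S).smul (isSmoothFunction_const (Real.exp a)))
    (fun x u v => congrArg (Real.exp a * ·) (S.metric.symm x u v))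
    ⟨Real.exp a, Real.exp_pos a, fun _ _ => le_rfl⟩
  phi := fun p => S.phi p + b
  phi_smooth := S.phi_smooth.add contMDiff_const
  phi_eq_zero hm := by
    ext p
    simp [S.phi_eq_zero hm, hb hm]

theorem SMMS.metricCoord_rescale (S : SMMS n M m) {a b : ℝ} (hb : m = 0 → b = 0) (c : M)
    (y : EuclideanSpace ℝ (Fin n)) :
    metricCoord (S.rescale a b hb).metric c y = Real.exp a • metricCoord S.metric c y := rfl

theorem SMMS.rescale_zero (S : SMMS n M m) {a b : ℝ} (hb : m = 0 → b = 0) (ha0 : a = 0)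
    (hb0 : b = 0) : S.rescale a b hb = S := by
  subst ha0 hb0
  refine SMMS.eq_of_inner_eq ?_ ?_
  · funext x
    change Real.exp 0 • S.metric.inner x = S.metric.inner x
    rw [Real.exp_zero, one_smul]
  · funext p
    exact add_zero _

theorem jointlySmoothOn_of_time {O : Set ℝ} {f : ℝ → ℝ} (hf : ContDiffOn ℝ ∞ f O)
    (U : Set (EuclideanSpace ℝ (Fin n))) : JointlySmoothOn (O ×ˢ U) fun s _ => f s :=
  ContDiffOn.comp hf contDiffOn_fst fun _ hz => hz.1

theorem IsSmoothFamily.rescale {O : Set ℝ} {γ : ℝ → SMMS n M m} (hγ : IsSmoothFamily O γ)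
    {a b : ℝ → ℝ} (ha : ContDiffOn ℝ ∞ a O) (hb : ContDiffOn ℝ ∞ b O)
    (hb0 : ∀ s, m = 0 → b s = 0) :
    IsSmoothFamily O fun s => (γ s).rescale (a s) (b s) (hb0 s) where
  isOpen := hγ.isOpen
  metric c i j := ((jointlySmoothOn_of_time ha _).comp Real.contDiff_exp).mul (hγ.metric c i j)
  phi c := (hγ.phi c).add (jointlySmoothOn_of_time hb _)

theorem densityCoord_smul_add (A : Matrix (Fin n) (Fin n) ℝ) (a b t : ℝ) :
    densityCoord (Real.exp a • A) (t + b) = Real.exp (n * a / 2 - b) * densityCoord A t := by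
  have h1 : Real.sqrt (Real.exp a ^ n) = Real.exp (n * a / 2) := by
    rw [← Real.exp_nat_mul, Real.exp_half]
  rw [densityCoord, densityCoord, Matrix.det_smul, Fintype.card_fin,
    Real.sqrt_mul (pow_nonneg (Real.exp_pos a).le _), h1, neg_add, Real.exp_add, Real.exp_sub,
    Real.exp_neg b]
  ring

open Classical in
/-- The metric measure space `(g + s h, φ + s ψ)`, for those `s` for which `g + s h` is a
metric. -/
def SMMS.perturb (S : SMMS n M m)
    {h : ∀ x : M, TangentSpace (𝓡 n) x →L[ℝ] TangentSpace (𝓡 n) x →L[ℝ] ℝ} {ψ : M → ℝ}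
    (hh : IsSmoothTensor h) (hs : ∀ x u v, h x u v = h x v u) (hψ : IsSmoothFunction n ψ)
    (hm : m = 0 → ψ = 0) (s : ℝ) : SMMS n M m :=
  if hle : ∃ c > 0, ∀ x v, c * S.metric.inner x v v ≤ (S.metric.inner x + s • h x) v v then
    { metric := SmoothMetric.ofLe S.metric (fun x => S.metric.inner x + s • h x)
        ((isSmoothTensor_inner S).add (hh.smul (isSmoothFunction_const s)))
        (fun x u v => congrArg₂ (fun r t : ℝ => r + s * t) (S.metric.symm x u v) (hs x u v)) hle
      phi := fun p => S.phi p + s * ψ p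
      phi_smooth := S.phi_smooth.add
        (contMDiff_const.mul ((contMDiff_iff_isSmoothFunction ψ).2 hψ))
      phi_eq_zero := fun h0 => by
        ext p
        simp [S.phi_eq_zero h0, hm h0] }
  else S

section Perturb

variable (S : SMMS n M m)
  {h : ∀ x : M, TangentSpace (𝓡 n) x →L[ℝ] TangentSpace (𝓡 n) x →L[ℝ] ℝ} {ψ : M → ℝ}
  (hh : IsSmoothTensor h) (hs : ∀ x u v, h x u v = h x v u) (hψ : IsSmoothFunction n ψ)
  (hm : m = 0 → ψ = 0)

theorem SMMS.perturb_spec [CompactSpace M] : ∃ δ > 0, ∀ s ∈ Ioo (-δ) δ,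
    (S.perturb hh hs hψ hm s).metric.inner = (fun x => S.metric.inner x + s • h x) ∧
    (S.perturb hh hs hψ hm s).phi = fun p => S.phi p + s * ψ p := by
  obtain ⟨C, hC, hle⟩ := S.exists_abs_le_mul_inner hh
  refine ⟨(2 * C)⁻¹, by positivity, fun s hs' => ?_⟩
  have h1 : ∃ c > 0, ∀ x v, c * S.metric.inner x v v ≤ (S.metric.inner x + s • h x) v v := by
    refine ⟨1 / 2, by norm_num, fun x v => ?_⟩
    change 1 / 2 * S.metric.inner x v v ≤ S.metric.inner x v v + s * h x v v
    have h2 := hle x v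
    have h3 : |s| * C ≤ 1 / 2 := by
      have h4 : |s| < (2 * C)⁻¹ := abs_lt.2 hs'
      calc |s| * C ≤ (2 * C)⁻¹ * C := by gcongr
        _ = 1 / 2 := by field_simp
    have h5 : 0 ≤ S.metric.inner x v v := by
      by_contra hneg
      have := (abs_nonneg _).trans h2
      nlinarith
    have h6 : |s * h x v v| ≤ 1 / 2 * S.metric.inner x v v := by
      rw [abs_mul]
      calc |s| * |h x v v| ≤ |s| * (C * S.metric.inner x v v) := by gcongr
        _ = |s| * C * S.metric.inner x v v := by ring
        _ ≤ 1 / 2 * S.metric.inner x v v := by gcongr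
    linarith [neg_abs_le (s * h x v v)]
  rw [SMMS.perturb, dif_pos h1]
  exact ⟨rfl, rfl⟩

theorem SMMS.exists_isSmoothFamily_perturb [CompactSpace M] :
    ∃ δ > 0, IsSmoothFamily (Ioo (-δ) δ) (S.perturb hh hs hψ hm) := by
  obtain ⟨δ, hδ, hspec⟩ := S.perturb_spec hh hs hψ hm
  have hid : ContDiffOn ℝ ∞ (fun s : ℝ => s) (Ioo (-δ) δ) := contDiffOn_id
  refine ⟨δ, hδ, isOpen_Ioo, fun a i j => ?_, fun a => ?_⟩
  · refine JointlySmoothOn.congr (F := fun s y => metricCoord S.metric a y i j +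
      s * tensorCoord h a y i j) ((jointlySmoothOn_of_contDiffOn (isSmoothTensor_inner S a i j)
        _).add ((jointlySmoothOn_of_time hid _).mul (jointlySmoothOn_of_contDiffOn (hh a i j) _)))
      fun s y hz => ?_
    rw [metricCoord, (hspec s hz.1).1]
    rfl
  · refine JointlySmoothOn.congr (F := fun s y => funCoord S.phi a y + s * funCoord ψ a y)
      ((jointlySmoothOn_of_contDiffOn (S.contDiffOn_phi a) _).add
        ((jointlySmoothOn_of_time hid _).mul (jointlySmoothOn_of_contDiffOn (hψ a) _)))
      fun s y hz => ?_
    rw [funCoord, (hspec s hz.1).2]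
    rfl

theorem SMMS.perturb_zero [CompactSpace M] : S.perturb hh hs hψ hm 0 = S := by
  obtain ⟨δ, hδ, hspec⟩ := S.perturb_spec hh hs hψ hm
  obtain ⟨h1, h2⟩ := hspec 0 ⟨neg_lt_zero.2 hδ, hδ⟩
  refine SMMS.eq_of_inner_eq (h1.trans ?_) (h2.trans ?_)
  · refine funext fun x => ContinuousLinearMap.ext fun u => ContinuousLinearMap.ext fun v => ?_
    change S.metric.inner x u v + 0 * h x u v = S.metric.inner x u v
    rw [zero_mul, add_zero]
  · funext p
    rw [zero_mul, add_zero]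

theorem SMMS.hasVelocity_perturb [CompactSpace M] :
    SMMS.HasVelocity (S.perturb hh hs hψ hm) h ψ := by
  obtain ⟨δ, hδ, hspec⟩ := S.perturb_spec hh hs hψ hm
  have hev : ∀ᶠ s in 𝓝 (0 : ℝ), s ∈ Ioo (-δ) δ := Ioo_mem_nhds (neg_lt_zero.2 hδ) hδ
  have hlin : ∀ b c : ℝ, HasDerivAt (fun s => b + s * c) c 0 := fun b c => by
    simpa using ((hasDerivAt_id (0 : ℝ)).mul_const c).const_add b
  refine ⟨fun x u w => ?_, fun x => ?_⟩
  · refine (hlin (S.metric.inner x u w) (h x u w)).congr_of_eventuallyEq ?_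
    filter_upwards [hev] with s hs'
    rw [(hspec s hs').1]
    rfl
  · refine (hlin (S.phi x) (ψ x)).congr_of_eventuallyEq ?_
    filter_upwards [hev] with s hs'
    rw [(hspec s hs').2]

end Perturb

variable [CompactSpace M] [T2Space M]

theorem densityIntegral_const_mul (c : ℝ) (u : M → EuclideanSpace ℝ (Fin n) → ℝ) :
    densityIntegral (fun a y => c * u a y) = c * densityIntegral u := by
  simp only [densityIntegral, Finset.mul_sum, ← integral_const_mul]
  exact Finset.sum_congr rfl fun a _ => by simp only [mul_left_comm]

variable [MeasurableSpace M] [BorelSpace M]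

theorem SMMS.volume_rescale (S : SMMS n M m) {a b : ℝ} (hb : m = 0 → b = 0) :
    ((S.rescale a b hb).integral fun _ => 1) =
      Real.exp (n * a / 2 - b) * S.integral fun _ => 1 := by
  rw [SMMS.integral_eq _ continuous_const, SMMS.integral_eq _ continuous_const,
    ← densityIntegral_const_mul]
  refine densityIntegral_congr fun c y _ => ?_
  rw [S.metricCoord_rescale, ← mul_assoc, ← densityCoord_smul_add]
  rfl

/-- Every variation that preserves the weighted volume to first order is the velocity of a curve
of unit weighted volume: the straight line is corrected by a factor that has vanishing derivative
at `s = 0`. For `m = 0` the metric has to be rescaled, otherwise a constant is added to `φ`. -/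
theorem SMMS.exists_isUnitVolumeCurve (S : SMMS n M m) (hS : S ∈ SMMS.unitVolume n M m)
    {h : ∀ x : M, TangentSpace (𝓡 n) x →L[ℝ] TangentSpace (𝓡 n) x →L[ℝ] ℝ} {ψ : M → ℝ}
    (hh : IsSmoothTensor h) (hs : ∀ x u v, h x u v = h x v u) (hψ : IsSmoothFunction n ψ)
    (hm : m = 0 → ψ = 0) (hn : m = 0 → n ≠ 0)
    (hint : (S.integral fun p => ψ p - (1 / 2) * traceAt S.metric p (tensorAt h p)) = 0) :
    ∃ γ : ℝ → SMMS n M m, SMMS.IsUnitVolumeCurve γ S ∧ SMMS.HasVelocity γ h ψ := by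
  -- rescaling `g` by `e ^ (α t)` and adding `β t` to `φ` multiplies the volume by
  -- `e ^ ((n α / 2 - β) t) = e ^ (-t)`; this is used with `t = log I`, `I` the volume
  obtain ⟨α, β, hαβ, hβ⟩ : ∃ α β : ℝ, n * α / 2 - β = -1 ∧ (m = 0 → β = 0) := by
    by_cases h0 : m = 0
    · have : (n : ℝ) ≠ 0 := by exact_mod_cast hn h0
      exact ⟨-2 / n, 0, by field_simp; norm_num, fun _ => rfl⟩
    · exact ⟨0, 1, by norm_num, fun h => absurd h h0⟩
  set γ₀ := S.perturb hh hs hψ hm with hγ₀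
  obtain ⟨δ, hδ, hfam⟩ := S.exists_isSmoothFamily_perturb hh hs hψ hm
  have hv := S.hasVelocity_perturb hh hs hψ hm
  have hzero : γ₀ 0 = S := S.perturb_zero hh hs hψ hm
  set I : ℝ → ℝ := fun s => (γ₀ s).integral fun _ => 1 with hI
  have h0δ : (0 : ℝ) ∈ Ioo (-δ) δ := ⟨neg_lt_zero.2 hδ, hδ⟩
  have hIsm : ContDiffOn ℝ ∞ I (Ioo (-δ) δ) := hfam.contDiffOn_volume
  have hI0 : I 0 = 1 := by
    simp only [hI, hzero]
    exact hS
  have hI' : HasDerivAt I 0 0 := by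
    have h1 := hfam.hasDerivAt_volume h0δ hv
    rw [SMMS.integral_neg, ← hγ₀, hzero, hint, neg_zero] at h1
    exact h1
  obtain ⟨ε, hε, hεδ, hpos⟩ : ∃ ε > 0, ε ≤ δ ∧ ∀ s ∈ Ioo (-ε) ε, 0 < I s := by
    have h1 : ∀ᶠ s in 𝓝 (0 : ℝ), 0 < I s :=
      hI'.continuousAt.eventually (lt_mem_nhds (by rw [hI0]; exact one_pos))
    obtain ⟨ε, hε, hball⟩ := Metric.eventually_nhds_iff_ball.1 h1
    refine ⟨min ε δ, lt_min hε hδ, min_le_right _ _, fun s hs' => hball s ?_⟩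
    rw [Real.ball_eq_Ioo, zero_sub, zero_add]
    exact ⟨(neg_le_neg (min_le_left _ _)).trans_lt hs'.1, hs'.2.trans_le (min_le_left _ _)⟩
  have hsub : Ioo (-ε) ε ⊆ Ioo (-δ) δ := Ioo_subset_Ioo (neg_le_neg hεδ) hεδ
  have hlog : ContDiffOn ℝ ∞ (fun s => Real.log (I s)) (Ioo (-ε) ε) :=
    (hIsm.mono hsub).log fun s hs' => (hpos s hs').ne'
  have hb0 : ∀ s, m = 0 → β * Real.log (I s) = 0 := fun s h0 => by rw [hβ h0, zero_mul]
  have hlog0 : Real.log (I 0) = 0 := by rw [hI0, Real.log_one]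
  have hlog' : HasDerivAt (fun s => Real.log (I s)) 0 0 := by
    simpa using hI'.log (by rw [hI0]; exact one_ne_zero)
  refine ⟨fun s => (γ₀ s).rescale (α * Real.log (I s)) (β * Real.log (I s)) (hb0 s),
    ⟨(isSmoothCurve_iff _).2 ⟨ε, hε, ?_⟩, ?_, ?_⟩, fun x u w => ?_, fun x => ?_⟩
  · exact (hfam.mono isOpen_Ioo hsub).rescale (contDiffOn_const.mul hlog)
      (contDiffOn_const.mul hlog) hb0
  · exact (SMMS.rescale_zero _ _ (by rw [hlog0, mul_zero]) (by rw [hlog0, mul_zero])).trans hzero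
  · filter_upwards [Ioo_mem_nhds (neg_lt_zero.2 hε) hε] with s hs'
    change ((γ₀ s).rescale _ _ _).integral (fun _ => 1) = 1
    rw [SMMS.volume_rescale]
    have h1 : n * (α * Real.log (I s)) / 2 - β * Real.log (I s) = -Real.log (I s) := by
      linear_combination Real.log (I s) * hαβ
    rw [h1, Real.exp_neg, Real.exp_log (hpos s hs')]
    exact inv_mul_cancel₀ (hpos s hs').ne'
  · have h1 := ((hlog'.const_mul α).exp).mul (hv.1 x u w)
    refine h1.congr_deriv ?_
    simp [hlog0]
  · have h1 := (hv.2 x).add (hlog'.const_mul β)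
    refine h1.congr_deriv ?_
    simp

end Curves

/-! ### Critical points -/

section Critical

variable {n : ℕ} {M : Type*} [TopologicalSpace M] [ChartedSpace (EuclideanSpace ℝ (Fin n)) M]
  [IsManifold (𝓡 n) ∞ M] {m : EReal}

theorem traceAt_metricAt (g : SmoothMetric n M) (p : M) : traceAt g p (metricAt g p) = n := by
  have hd := (metricAt_posDef g p).det_pos.ne'
  have hs : ∀ i j, metricAt g p i j = metricAt g p j i := metricCoord_symm g p _
  have h1 : ∀ i, ∑ j, (metricAt g p)⁻¹ i j * metricAt g p i j = 1 := fun i => by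
    refine Eq.trans (Finset.sum_congr rfl fun j _ => by rw [hs i j]) ((sum_inv_mul hd i i).trans ?_)
    rw [if_pos rfl]
  refine Eq.trans (b := ∑ _i : Fin n, (1 : ℝ)) 
    (Finset.sum_congr (s₁ := Finset.univ) rfl fun i _ => h1 i) (by simp)

/-- The weighted scalar curvature is the trace of the Bakry-Émery Ricci tensor plus `Δ_φ φ`. -/
theorem SMMS.weightedScalar_eq_traceAt (S : SMMS n M m) (p : M) :
    S.weightedScalar p = traceAt S.metric p (S.bakryEmeryRicci p) + S.weightedLaplacianPhi p := by
  have h1 : traceAt S.metric p (S.bakryEmeryRicci p) = scalarCurv S.metric p +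
      laplacian S.metric S.phi p - invDim m * gradSq S.metric S.phi p := by
    rw [traceAt, SMMS.bakryEmeryRicci, traceCoord_sub, traceCoord_add, traceCoord_smul]
    rfl
  rw [h1, SMMS.weightedScalar, SMMS.weightedLaplacianPhi]
  ring

/-- The trace of `Ric_φ = c g`, as `tr Ric_φ = R_φ - Δ_φ φ`. -/
theorem SMMS.weightedScalar_of_eq_smul (S : SMMS n M m) {p : M} {c : ℝ}
    (h : S.bakryEmeryRicci p = c • metricAt S.metric p) :
    S.weightedScalar p = n * c + S.weightedLaplacianPhi p := by
  have h1 : traceAt S.metric p (c • metricAt S.metric p) = n * c := by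
    rw [traceAt, traceCoord_smul]
    exact (congrArg (c * ·) (traceAt_metricAt S.metric p)).trans (mul_comm _ _)
  rw [S.weightedScalar_eq_traceAt, h, h1]

theorem SMMS.weightedLaplacianPhi_of_phi_eq_zero (S : SMMS n M m) (h : S.phi = 0) (p : M) :
    S.weightedLaplacianPhi p = 0 := by
  have h1 : ∀ i, pd i (funCoord (n := n) S.phi p) = fun _ => 0 := fun i => by
    funext y
    rw [h]
    exact pd_const 0 i
  have h2 : hessianAt S.metric S.phi p = 0 := by
    ext i j
    simp only [hessianAt, hessianCoord, Matrix.of_apply, h1, pd_const, mul_zero,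
      Finset.sum_const_zero, sub_zero, Matrix.zero_apply]
  have h3 : diffSqAt (n := n) S.phi p = 0 := by
    ext i j
    simp only [diffSqAt, Matrix.of_apply, h1, mul_zero, Matrix.zero_apply]
  rw [SMMS.weightedLaplacianPhi, laplacian, gradSq, h2, h3, sub_self]

variable [CompactSpace M] [T2Space M] [MeasurableSpace M] [BorelSpace M]

theorem SMMS.integral_add (S : SMMS n M m) {f k : M → ℝ} (hf : Continuous f) (hk : Continuous k) :
    (S.integral fun p => f p + k p) = S.integral f + S.integral k := by
  have hw : ∀ a : M, ContinuousOn (fun y => densityCoord (metricCoord S.metric a y)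
      (funCoord S.phi a y)) (extChartAt (𝓡 n) a).target := fun a =>
    (((S.isMetricFamily a).density_smooth (S.jointlySmoothOn_phi a)).contDiffOn_slice
      (mem_univ 0)).continuousOn
  rw [S.integral_eq hf, S.integral_eq hk, S.integral_eq (f := fun p => f p + k p) (hf.add hk)]
  refine Eq.trans ?_ (densityIntegral_add (fun a => (hw a).mul (continuousOn_funCoord hf a))
      (fun a => (hw a).mul (continuousOn_funCoord hk a)))
  exact densityIntegral_congr fun a y _ => mul_add _ _ _

omit [BorelSpace M] in
theorem SMMS.integral_const_mul (S : SMMS n M m) (c : ℝ) (f : M → ℝ) :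
    (S.integral fun p => c * f p) = c * S.integral f := by
  simp only [SMMS.integral, mul_assoc]
  exact MeasureTheory.integral_const_mul c _

omit [BorelSpace M] in
theorem SMMS.integral_const (S : SMMS n M m) (hS : S ∈ SMMS.unitVolume n M m) (c : ℝ) :
    (S.integral fun _ => c) = c := by
  have h1 := S.integral_const_mul c fun _ => 1
  have h2 : (S.integral fun _ => 1) = 1 := hS
  rw [h2] at h1
  simpa using h1

theorem SMMS.integral_sub_const (S : SMMS n M m) (hS : S ∈ SMMS.unitVolume n M m) {f : M → ℝ}
    (hf : Continuous f) (c : ℝ) : (S.integral fun p => f p - c) = S.integral f - c := by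
  simp only [sub_eq_add_neg]
  rw [S.integral_add hf continuous_const, S.integral_const hS]

/-- The first variation `∫ ⟨Ric_φ - c g, h⟩ + Q (ψ - (1/2) tr h)` vanishes for all smooth symmetric
variations that preserve the volume to first order (with `ψ = 0` if `m = 0`). -/
def SMMS.IsStationary (S : SMMS n M m) (c Q : M → ℝ) : Prop :=
  ∀ (h : ∀ x : M, TangentSpace (𝓡 n) x →L[ℝ] TangentSpace (𝓡 n) x →L[ℝ] ℝ) (ψ : M → ℝ),
    IsSmoothTensor h → (∀ x u v, h x u v = h x v u) → IsSmoothFunction n ψ →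
    (m = 0 → ψ = 0) →
    (S.integral fun p => ψ p - (1 / 2) * traceAt S.metric p (tensorAt h p)) = 0 →
    (S.integral fun p => innerAt S.metric p (S.bakryEmeryRicci p - c p • metricAt S.metric p)
        (tensorAt h p) + Q p * (ψ p - (1 / 2) * traceAt S.metric p (tensorAt h p))) = 0

theorem SMMS.IsCriticalPoint.isStationary {S : SMMS n M m} {μ : ℝ}
    (hcrit : S.IsCriticalPoint μ) (hS : S ∈ SMMS.unitVolume n M m) (hn : m = 0 → n ≠ 0)
    {c Q : M → ℝ} (hvar : ∀ (O : Set ℝ) (γ : ℝ → SMMS n M m)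
      (h : ∀ x : M, TangentSpace (𝓡 n) x →L[ℝ] TangentSpace (𝓡 n) x →L[ℝ] ℝ) (ψ : M → ℝ),
      IsSmoothFamily O γ → (0 : ℝ) ∈ O → γ 0 = S → SMMS.HasVelocity γ h ψ →
      HasDerivAt (fun s => (γ s).energy μ) (-S.integral fun p =>
        innerAt S.metric p (S.bakryEmeryRicci p - c p • metricAt S.metric p) (tensorAt h p)
        + Q p * (ψ p - (1 / 2) * traceAt S.metric p (tensorAt h p))) 0) :
    S.IsStationary c Q := by
  intro h ψ hh hs hψ hm hint
  obtain ⟨γ, hγ, hv⟩ := S.exists_isUnitVolumeCurve hS hh hs hψ hm hn hint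
  obtain ⟨ε, hε, hfam⟩ := (isSmoothCurve_iff γ).1 hγ.1
  have h1 := hvar _ γ h ψ hfam ⟨neg_lt_zero.2 hε, hε⟩ hγ.2.1 hv
  exact neg_eq_zero.1 (h1.unique (hcrit γ hγ))

variable {S : SMMS n M m} {c Q : M → ℝ}

/-- If `ψ` is unrestricted, then the variation `h = Ric_φ - c g`, `ψ - (1/2) tr h = Q - ∫ Q`
shows that `Ric_φ = c g` and that `Q` is constant. -/
theorem SMMS.IsStationary.eq_smul_and_const (hst : S.IsStationary c Q)
    (hS : S ∈ SMMS.unitVolume n M m) (hm : m ≠ 0) (hc : IsSmoothFunction n c)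
    (hQ : IsSmoothFunction n Q) :
    ∃ q : ℝ, ∀ p, S.bakryEmeryRicci p = c p • metricAt S.metric p ∧ Q p = q := by
  set q := S.integral Q with hq
  set h : ∀ x : M, TangentSpace (𝓡 n) x →L[ℝ] TangentSpace (𝓡 n) x →L[ℝ] ℝ :=
    fun x => S.bakryEmeryTensor x - c x • S.metric.inner x with hh
  have hsm : IsSmoothTensor h := S.isSmoothTensor_bakryEmeryTensor.sub_smul hc
    (isSmoothTensor_inner S)
  have hs : ∀ x u v, h x u v = h x v u := fun x u v =>
    congrArg₂ (fun r t : ℝ => r - c x * t) (S.bakryEmeryTensor_symm x u v) (S.metric.symm x u v)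
  have hT : ∀ p, tensorAt h p = S.bakryEmeryRicci p - c p • metricAt S.metric p := fun p => by
    rw [hh, tensorAt_sub_smul, S.tensorAt_bakryEmeryTensor]
    rfl
  have htr := S.isSmoothFunction_traceAt hsm
  have hη : ∀ p, Q p - q + (1 / 2) * traceAt S.metric p (tensorAt h p) -
      (1 / 2) * traceAt S.metric p (tensorAt h p) = Q p - q := fun p => by ring
  have h1 := hst h (fun p => Q p - q + (1 / 2) * traceAt S.metric p (tensorAt h p)) hsm hs
    (fun a => ((hQ a).sub contDiffOn_const).add (contDiffOn_const.mul (htr a)))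
    (fun h => absurd h hm) (by
      simp only [hη]
      rw [S.integral_sub_const hS hQ.continuous, sub_self])
  simp only [hη] at h1
  have hcont : Continuous fun p => innerAt S.metric p (tensorAt h p) (tensorAt h p) :=
    (S.isSmoothFunction_innerAt hsm hsm).continuous
  have hQc : Continuous fun p => Q p - q := hQ.continuous.sub continuous_const
  have h2 : (S.integral fun p => innerAt S.metric p (tensorAt h p) (tensorAt h p)
      + (Q p - q) ^ 2) = 0 := by
    have h3 : (S.integral fun p => -q * (Q p - q)) = 0 := by
      rw [S.integral_const_mul, S.integral_sub_const hS hQ.continuous, sub_self, mul_zero]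
    have h4 := S.integral_add (f := fun p => innerAt S.metric p (tensorAt h p) (tensorAt h p)
      + Q p * (Q p - q)) (k := fun p => -q * (Q p - q))
      (hcont.add (hQ.continuous.mul hQc)) (continuous_const.mul hQc)
    rw [h3, add_zero] at h4
    simp only [← hT] at h1
    rw [h1] at h4
    rw [← h4]
    refine congrArg _ (funext fun p => ?_)
    ring
  refine ⟨q, fun p => ?_⟩
  have h5 : innerAt S.metric p (tensorAt h p) (tensorAt h p) + (Q p - q) ^ 2 = 0 :=
    S.eq_zero_of_integral_eq_zero (hcont.add (hQc.pow 2)) (fun p =>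
      add_nonneg (innerCoord_self_nonneg (metricAt_posDef _ _) _) (sq_nonneg _)) h2 p
  have h6 : 0 ≤ innerAt S.metric p (tensorAt h p) (tensorAt h p) :=
    innerCoord_self_nonneg (metricAt_posDef _ _) _
  have h7 : innerAt S.metric p (tensorAt h p) (tensorAt h p) = 0 := by
    have := sq_nonneg (Q p - q)
    linarith
  have h8 : (Q p - q) ^ 2 = 0 := by
    linarith
  refine ⟨?_, sub_eq_zero.1 (pow_eq_zero_iff two_ne_zero |>.1 h8)⟩
  have h9 := eq_zero_of_innerCoord_self_eq_zero (metricAt_posDef S.metric p) h7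
  rw [hT] at h9
  exact sub_eq_zero.1 h9

/-- If `ψ = 0` is required, then only the tensor `Ric_φ - c g - (Q / 2) g` is determined, up to
a constant multiple of `g`. -/
theorem SMMS.IsStationary.exists_eq_smul (hst : S.IsStationary c Q)
    (hS : S ∈ SMMS.unitVolume n M m) (hn : n ≠ 0) (hc : IsSmoothFunction n c)
    (hQ : IsSmoothFunction n Q) :
    ∃ k : ℝ, ∀ p, S.bakryEmeryRicci p = (c p + (1 / 2) * Q p + k) • metricAt S.metric p := by
  set e : M → ℝ := fun p => c p + (1 / 2) * Q p with he
  have hes : IsSmoothFunction n e := fun a => (hc a).add (contDiffOn_const.mul (hQ a))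
  set h₀ : ∀ x : M, TangentSpace (𝓡 n) x →L[ℝ] TangentSpace (𝓡 n) x →L[ℝ] ℝ :=
    fun x => S.bakryEmeryTensor x - e x • S.metric.inner x with hh₀
  have hsm₀ : IsSmoothTensor h₀ := S.isSmoothTensor_bakryEmeryTensor.sub_smul hes
    (isSmoothTensor_inner S)
  have htr₀ := S.isSmoothFunction_traceAt hsm₀
  -- this `k` makes the trace of `h = Ric_φ - e g - k g` integrate to zero
  set k : ℝ := (S.integral fun p => traceAt S.metric p (tensorAt h₀ p)) / n with hk
  set h : ∀ x : M, TangentSpace (𝓡 n) x →L[ℝ] TangentSpace (𝓡 n) x →L[ℝ] ℝ :=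
    fun x => h₀ x - k • S.metric.inner x with hh
  have hsm : IsSmoothTensor h := hsm₀.sub_smul (isSmoothFunction_const k)
    (isSmoothTensor_inner S)
  have hs : ∀ x u v, h x u v = h x v u := fun x u v =>
    congrArg₂ (fun r t : ℝ => r - e x * t - k * t) (S.bakryEmeryTensor_symm x u v)
      (S.metric.symm x u v)
  have hT₀ : ∀ p, tensorAt h₀ p = S.bakryEmeryRicci p - e p • metricAt S.metric p := fun p => by
    rw [hh₀, tensorAt_sub_smul, S.tensorAt_bakryEmeryTensor]
    rfl
  have hT : ∀ p, tensorAt h p = tensorAt h₀ p - k • metricAt S.metric p := fun p =>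
    tensorAt_sub_smul (fun _ => k) p
  have htr : ∀ p, traceAt S.metric p (tensorAt h p) =
      traceAt S.metric p (tensorAt h₀ p) - k * n := fun p => by
    rw [hT, traceAt, traceCoord_sub, traceCoord_smul]
    exact congrArg (fun t => _ - k * t) (traceAt_metricAt S.metric p)
  have htr0 : (S.integral fun p => traceAt S.metric p (tensorAt h p)) = 0 := by
    have hn' : (n : ℝ) ≠ 0 := by exact_mod_cast hn
    simp only [htr]
    rw [S.integral_sub_const hS htr₀.continuous, hk, div_mul_cancel₀ _ hn', sub_self]
  have hhalf : ∀ p, (0 : ℝ) - (1 / 2) * traceAt S.metric p (tensorAt h p) =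
      -(1 / 2) * traceAt S.metric p (tensorAt h p) := fun p => by ring
  have h1 := hst h 0 hsm hs (isSmoothFunction_const 0) (fun _ => rfl) (by
    simp only [Pi.zero_apply, hhalf]
    rw [S.integral_const_mul, htr0, mul_zero])
  have hcont : Continuous fun p => innerAt S.metric p (tensorAt h p) (tensorAt h p) :=
    (S.isSmoothFunction_innerAt hsm hsm).continuous
  have htrc := (S.isSmoothFunction_traceAt hsm).continuous
  have h2 : (S.integral fun p => innerAt S.metric p (tensorAt h p) (tensorAt h p)) = 0 := by
    have h3 : (S.integral fun p => k * traceAt S.metric p (tensorAt h p)) = 0 := by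
      rw [S.integral_const_mul, htr0, mul_zero]
    have h4 := S.integral_add (f := fun p => innerAt S.metric p (tensorAt h p) (tensorAt h p))
      (k := fun p => k * traceAt S.metric p (tensorAt h p)) hcont (continuous_const.mul htrc)
    rw [h3, add_zero] at h4
    rw [← h4, ← h1]
    refine congrArg _ (funext fun p => ?_)
    have h5 : innerAt S.metric p (tensorAt h p) (tensorAt h p) =
        innerAt S.metric p (S.bakryEmeryRicci p) (tensorAt h p)
          - e p * traceAt S.metric p (tensorAt h p) - k * traceAt S.metric p (tensorAt h p) := by
      conv_lhs => rw [congrArg (innerAt S.metric p · (tensorAt h p)) (hT p)]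
      rw [innerAt_sub_smul_metricAt, hT₀, innerAt_sub_smul_metricAt]
    rw [h5, innerAt_sub_smul_metricAt, he, Pi.zero_apply]
    ring
  refine ⟨k, fun p => ?_⟩
  have h5 := S.eq_zero_of_integral_eq_zero hcont
    (fun p => innerCoord_self_nonneg (metricAt_posDef _ _) _) h2 p
  have h9 := eq_zero_of_innerCoord_self_eq_zero (metricAt_posDef S.metric p) h5
  rw [hT, hT₀, sub_sub, ← add_smul] at h9
  exact sub_eq_zero.1 h9

theorem SMMS.quasiEinstein_of_infinite {μ : ℝ} (hcrit : S.IsCriticalPoint μ)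
    (hS : S ∈ SMMS.unitVolume n M m) (hm : m = ⊤ ∨ m = ⊥) :
    ∃ lam : ℝ, S.IsQuasiEinstein lam ∧ S.HasCharacteristicConstant lam μ := by
  have hm0 : m ≠ 0 := by rcases hm with rfl | rfl <;> simp
  have hst : S.IsStationary (fun _ => μ)
      (fun p => S.weightedScalar p + 2 * μ * (S.phi p - n - 1)) :=
    hcrit.isStationary hS (fun h => absurd h hm0) fun O γ h ψ hγ h0 hγ0 hv => by
      have h1 := hγ.hasDerivAt_energy_of_infinite h0 hv μ hm
      rw [hγ0] at h1
      exact h1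
  obtain ⟨q, hq⟩ := hst.eq_smul_and_const hS hm0 (isSmoothFunction_const μ) fun a =>
    (S.isSmoothFunction_weightedScalar a).add (contDiffOn_const.mul
      (((S.contDiffOn_phi a).sub contDiffOn_const).sub contDiffOn_const))
  refine ⟨μ, fun p => (hq p).1, ?_⟩
  rw [SMMS.HasCharacteristicConstant, if_pos hm]
  exact ⟨rfl, -(q + 2 * μ), fun p => by linarith [(hq p).2]⟩

theorem SMMS.isStationary_of_finite {μ : ℝ} (hcrit : S.IsCriticalPoint μ)
    (hS : S ∈ SMMS.unitVolume n M m) (hm : m ≠ ⊤ ∧ m ≠ ⊥) (hn : m = 0 → n ≠ 0) :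
    S.IsStationary (fun p => invDim m * S.weightedLaplacianPhi p + μ * S.vInvSq p)
      (fun p => S.weightedScalar p - 2 * invDim m * S.weightedLaplacianPhi p
        + (m.toReal - 2) * μ * S.vInvSq p) :=
  hcrit.isStationary hS hn fun O γ h ψ hγ h0 hγ0 hv => by
    have h1 := hγ.hasDerivAt_energy_of_finite h0 hv μ hm
    rw [hγ0] at h1
    simp only [sub_sub _ (_ • metricAt S.metric _) (_ • metricAt S.metric _), ← add_smul] at h1
    exact h1

omit [CompactSpace M] [T2Space M] [MeasurableSpace M] [BorelSpace M] in
theorem SMMS.isSmoothFunction_vInvSq (S : SMMS n M m) : IsSmoothFunction n S.vInvSq := fun a =>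
  (contDiffOn_const.mul (S.contDiffOn_phi a)).exp

theorem SMMS.quasiEinstein_of_finite {μ : ℝ} (hcrit : S.IsCriticalPoint μ)
    (hS : S ∈ SMMS.unitVolume n M m) (hm : m ≠ ⊤ ∧ m ≠ ⊥) (hmn : m + (n : EReal) ≠ 2) :
    ∃ lam : ℝ, S.IsQuasiEinstein lam ∧ S.HasCharacteristicConstant lam μ := by
  have hmn' : m.toReal + n - 2 ≠ 0 := by
    intro h
    refine hmn ?_
    rw [← EReal.coe_toReal hm.1 hm.2]
    have h1 : ((m.toReal + (n : ℝ) : ℝ) : EReal) = ((2 : ℝ) : EReal) := by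
      rw [show m.toReal + (n : ℝ) = 2 by linarith]
    rw [EReal.coe_add] at h1
    exact h1
  have hchar : ∀ lam, (∀ p, S.weightedScalar p + m.toReal * μ * S.vInvSq p =
      (m.toReal + n) * lam) → S.HasCharacteristicConstant lam μ := fun lam h => by
    rw [SMMS.HasCharacteristicConstant, if_neg (by rintro (h | h); exacts [hm.1 h, hm.2 h])]
    exact h
  have hcs : IsSmoothFunction n fun p => invDim m * S.weightedLaplacianPhi p +
      μ * S.vInvSq p := fun a =>
    (contDiffOn_const.mul (S.isSmoothFunction_weightedLaplacianPhi a)).add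
      (contDiffOn_const.mul (S.isSmoothFunction_vInvSq a))
  have hQs : IsSmoothFunction n fun p => S.weightedScalar p
      - 2 * invDim m * S.weightedLaplacianPhi p + (m.toReal - 2) * μ * S.vInvSq p := fun a =>
    ((S.isSmoothFunction_weightedScalar a).sub (contDiffOn_const.mul
      (S.isSmoothFunction_weightedLaplacianPhi a))).add
      (contDiffOn_const.mul (S.isSmoothFunction_vInvSq a))
  by_cases hm0 : m = 0
  · have hΔ := S.weightedLaplacianPhi_of_phi_eq_zero (S.phi_eq_zero hm0)
    have hm0' : m.toReal = 0 := by rw [hm0, EReal.toReal_zero]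
    by_cases hn : n = 0
    · subst hn
      refine ⟨0, fun p => Matrix.ext fun i => i.elim0, hchar 0 fun p => ?_⟩
      have h1 : S.bakryEmeryRicci p = (0 : ℝ) • metricAt S.metric p := Matrix.ext fun i => i.elim0
      rw [S.weightedScalar_of_eq_smul h1, hΔ, hm0']
      simp
    · obtain ⟨k, hk⟩ := (S.isStationary_of_finite hcrit hS hm fun _ => hn).exists_eq_smul hS hn
        hcs hQs
      -- `R = n (R / 2 + k)`, which determines `R` as `n ≠ 2`
      have hR : ∀ p, S.weightedScalar p = n * ((1 / 2) * S.weightedScalar p + k) := fun p => by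
        have h1 := S.weightedScalar_of_eq_smul (hk p)
        rw [hΔ, hm0'] at h1
        linear_combination h1
      rw [hm0', zero_add] at hmn'
      have hR' : ∀ p, S.weightedScalar p = -2 * n * k / (n - 2) := fun p => by
        rw [eq_div_iff hmn']
        linear_combination -2 * hR p
      refine ⟨(1 / 2) * (-2 * n * k / (n - 2)) + k, fun p => ?_, hchar _ fun p => ?_⟩
      · rw [hk p, hΔ, hm0', ← hR' p]
        congr 1
        ring
      · rw [← hR' p, hm0']
        linear_combination hR p
  · obtain ⟨q, hq⟩ := (S.isStationary_of_finite hcrit hS hm fun h =>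
      absurd h hm0).eq_smul_and_const hS hm0 hcs hQs
    have hκ := toReal_mul_invDim hm hm0
    -- the trace identity turns the constancy of `Q` into that of `(1/m) Δ_φ φ + μ v⁻²`
    have hlam : ∀ p, invDim m * S.weightedLaplacianPhi p + μ * S.vInvSq p =
        q / (m.toReal + n - 2) := fun p => by
      rw [eq_div_iff hmn']
      have h1 := S.weightedScalar_of_eq_smul (hq p).1
      have h2 := (hq p).2
      linear_combination h2 - h1 + S.weightedLaplacianPhi p * hκ
    refine ⟨q / (m.toReal + n - 2), fun p => ?_, hchar _ fun p => ?_⟩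
    · rw [(hq p).1, hlam]
    · rw [← hlam p]
      have h1 := S.weightedScalar_of_eq_smul (hq p).1
      linear_combination h1 - S.weightedLaplacianPhi p * hκ

end Critical

end WeightedMeasure

end

theorem mainTheorem2 (n : ℕ) (M : Type*) [TopologicalSpace M]
    [ChartedSpace (EuclideanSpace ℝ (Fin n)) M] [IsManifold (𝓡 n) ∞ M]
    [CompactSpace M] [T2Space M] [MeasurableSpace M] [BorelSpace M]
    (m : EReal) (μ : ℝ) (S : WeightedMeasure.SMMS n M m)
    (hS : S ∈ WeightedMeasure.SMMS.unitVolume n M m) :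
    (∀ (h : ∀ x : M, TangentSpace (𝓡 n) x →L[ℝ] TangentSpace (𝓡 n) x →L[ℝ] ℝ) (ψ : M → ℝ),
      (∃ γ : ℝ → WeightedMeasure.SMMS n M m,
        WeightedMeasure.SMMS.IsUnitVolumeCurve γ S ∧ WeightedMeasure.SMMS.HasVelocity γ h ψ) →
      (0 = S.integral fun p =>
        ψ p - (1 / 2) * WeightedMeasure.traceAt S.metric p (WeightedMeasure.tensorAt h p)) ∧
      ∀ γ : ℝ → WeightedMeasure.SMMS n M m,
        WeightedMeasure.SMMS.IsSmoothCurve γ → γ 0 = S →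
        WeightedMeasure.SMMS.HasVelocity γ h ψ →
        (m ≠ ⊤ ∧ m ≠ ⊥ →
          HasDerivAt (fun s => (γ s).energy μ)
            (-S.integral fun p =>
              WeightedMeasure.innerAt S.metric p
                (S.bakryEmeryRicci p
                  - (WeightedMeasure.invDim m * S.weightedLaplacianPhi p) •
                    WeightedMeasure.metricAt S.metric p
                  - (μ * S.vInvSq p) • WeightedMeasure.metricAt S.metric p)
                (WeightedMeasure.tensorAt h p)
              + (S.weightedScalar p - 2 * WeightedMeasure.invDim m * S.weightedLaplacianPhi p
                  + (m.toReal - 2) * μ * S.vInvSq p) *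
                (ψ p - (1 / 2) *
                  WeightedMeasure.traceAt S.metric p (WeightedMeasure.tensorAt h p))) 0) ∧
        (m = ⊤ ∨ m = ⊥ →
          HasDerivAt (fun s => (γ s).energy μ)
            (-S.integral fun p =>
              WeightedMeasure.innerAt S.metric p
                (S.bakryEmeryRicci p - μ • WeightedMeasure.metricAt S.metric p)
                (WeightedMeasure.tensorAt h p)
              + (S.weightedScalar p + 2 * μ * (S.phi p - n - 1)) *
                (ψ p - (1 / 2) *
                  WeightedMeasure.traceAt S.metric p (WeightedMeasure.tensorAt h p))) 0)) ∧
    (m + (n : EReal) ≠ 2 → S.IsCriticalPoint μ →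
      ∃ lam : ℝ, S.IsQuasiEinstein lam ∧ S.HasCharacteristicConstant lam μ) := by
  refine ⟨fun h ψ ⟨γ₀, hγ₀, hv₀⟩ => ⟨?_, fun γ hγ h0 hv => ⟨fun hm => ?_, fun hm => ?_⟩⟩,
    fun hmn hcrit => ?_⟩
  · obtain ⟨ε, hε, hfam⟩ := (WeightedMeasure.isSmoothCurve_iff γ₀).1 hγ₀.1
    have h1 := hfam.integral_eq_zero_of_unitVolume ⟨neg_lt_zero.2 hε, hε⟩ hv₀ hγ₀.2.2
    rw [hγ₀.2.1] at h1
    exact h1.symm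
  · obtain ⟨ε, hε, hfam⟩ := (WeightedMeasure.isSmoothCurve_iff γ).1 hγ
    have h1 := hfam.hasDerivAt_energy_of_finite ⟨neg_lt_zero.2 hε, hε⟩ hv μ hm
    rw [h0] at h1
    exact h1
  · obtain ⟨ε, hε, hfam⟩ := (WeightedMeasure.isSmoothCurve_iff γ).1 hγ
    have h1 := hfam.hasDerivAt_energy_of_infinite ⟨neg_lt_zero.2 hε, hε⟩ hv μ hm
    rw [h0] at h1
    exact h1
  · by_cases hm : m = ⊤ ∨ m = ⊥
    · exact WeightedMeasure.SMMS.quasiEinstein_of_infinite hcrit hS hm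
    · exact WeightedMeasure.SMMS.quasiEinstein_of_finite hcrit hS (not_or.1 hm) hmn
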